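/- Let $d\ge 1$, let $\underline n=(n_1,\dots,n_p)$ and $\underline m=(m_1,\dots,m_q)$ be compositions of $d$, let $g\in\{0,\tfrac12,1,\tfrac32,\dots\}$, $k=2g-2+p+q$, $1\le r\le q$, $1\le a\le n_p$, and let $C,J,T$ be independent variables. **Refined monotone Hurwitz numbers.** Let $S_{2d}$ be the group of permutations of $\{1,\bar 1,\dots,d,\bar d\}$, $\tau=(1\,\bar 1)\cdots(d\,\bar d)$, and let it act on fixed point-free involutions $\rho$ by conjugation, $\sigma.\rho=\sigma\rho\sigma^{-1}$. The parts of (the type of) $\rho$ are the halves of the sizes of the orbits ("components") of $\langle\rho,\tau\rangle$. The weight of a transposition $\sigma$ at $\rho$ is $C$ if $\sigma.\rho$ has one part more than $\rho$ (cut), $J$ if it has one part less (join), $T$ otherwise (twist). Let $\rho_{\underline n}$ be the product over the blocks $\{l+1,\dots,l+n_i\}$, $l=n_1+\dots+n_{i-1}$, of $(\overline{l+1}\;\,l{+}2)(\overline{l+2}\;\,l{+}3)\cdots(\overline{l+n_i}\;\,l{+}1)$. Then $N^a_g\binom{n_1,\dots,n_p}{m_1,\dots,m_q|r}$ is $\frac{1}{C^qJ^p\prod_{i=1}^p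 2n_i}$ times the sum, over all pairs $((\sigma_1,\dots,\sigma_k),\preccurlyeq)$ as follows, of the product of the weights of $\sigma_i$ at $\sigma_{i-1}\cdots\sigma_1.\rho_{\underline n}$, $i=1,\dots,k$: each $\sigma_i=(p_i\,q_i)$ with $q_i\in\{1,\dots,d\}$ and $p_i\in\{1,\bar 1,\dots,q_i-1,\overline{q_i-1}\}$; $q_1\le\dots\le q_k$; $\tau,\rho_{\underline n},\sigma_1,\dots,\sigma_k$ generate a transitive group; $\preccurlyeq$ is a linear order on the components of $\varrho=\sigma_k\cdots\sigma_1.\rho_{\underline n}$ for which their sizes are $2m_1,\dots,2m_q$; the element $d$ lies in the $r$-th component; and $q_k=d-n_p+a$ (if $k=0$, this last condition is read as $a=1$). **Twisted tropical covers.** Fix points $x_1<\dots<x_k$ in $\mathbb R$. A tropical cover $\pi:\Gamma\to\mathbb R$ is a finite metric graph, whose inner vertices lie over the $x_i$, and whose edges are mapped linearly with positive integer slope (weight) $\omega(e)$ onto segments between two of the $x_i$, or (ends) onto unbounded segments, such that at each inner vertex the sums of the weights of the incoming (left) and of the outgoing (right) edges agree. A twisted tropical cover has in addition an involution $\iota$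 over $\mathbb R$; over each $x_i$ there are two 3-valent vertices or one 4-valent vertex, the edges at a 4-valent vertex have the same weight $\omega_v$, and the fixed locus of $\iota$ is the set of 4-valent vertices. We require $\Gamma/\iota$ to be connected, in-ends labelled $1,\dots,2p$ and out-ends labelled $1,\dots,2q$, where $\iota$ exchanges the in-ends $i$ and $p+i$ (of weight $n_i$) and the out-ends $j$ and $q+j$ (of weight $m_j$). **Monotone covers.** A monotone twisted tropical cover of type $(g,\underline n,\underline m)$ is such a cover, each edge coloured normal, dashed or bold, with an integer counter $c(e)\ge 0$ on each dashed or bold edge, such that: 1. In-ends $1,\dots,p$ are normal; in-ends $p+1,\dots,2p$ are dashed or bold with counter $1$; no out-end is bold. 2. Say that the in-end $p+i$ itself, and recursively each non-normal edge going out of a vertex into which a bold edge arising from $p+i$ comes, *arises from* $p+i$. If the in-end $p+i$ is bold, the bold edges arising from it form the *chain* $\mathcal C_i$; its inner vertices are the right endpoints of its edges, $l_i$ the first and $r_i$ the last. Every non-normal edge arises from exactly one of the in-ends $p+1,\dots,2p$. 3. For different chains the intervals $[\pi(l_i),\pi(r_i)]$ are disjoint, and $\pi(l_i)<\pi(l_{i'})$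 if and only if $i<i'$. 4. If the in-end $j$ or $p+j$ is attached to $v$ or $\iota(v)$, where $v$ is an inner vertex of $\mathcal C_i$, then $j\le i$. 5. For each inner vertex $v$, one of $v$ and $\iota(v)$ has exactly one incoming bold edge and exactly one outgoing non-normal edge, and the counter of the former is at most that of the latter. 6. If $e$ arises from the in-end $p+i$, then $n_i-\omega(e)<c(e)\le n_i$. It is of type $(g,\underline n,\underline m,r,a)$ if the final outgoing dashed edge of the chain $\mathcal C_i$ with the largest $i$ is the out-end $r$ or $q+r$ and has counter $a$ (if $k=0$, the dashed in-end takes the role of this edge). Isomorphisms of such covers respect all the data, except that they may exchange the labels $j$ and $q+j$ of out-ends. **Multiplicity.** An edge $e$ is contributing if neither $e$ nor $\iota(e)$ is bold; a vertex is contributing if it has an incoming bold edge. A contributing vertex $v$ has multiplicity $m(v)=C$ if it has one incoming and two outgoing edges, $m(v)=J$ if it has two incoming edges and one outgoing edge, and $m(v)=T\,(\omega_v-n_i+c(e)-1)$ if it is 4-valent, where $\mathcal C_i$ is the chain through $v$ and $e$ the non-normal edge going out of $v$. The multiplicity of the cover is $m(\pi)=\sqrt{\prod\omega(e)}\,\prod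 m(v)$, with the first product over the contributing edges that are not out-ends and the second over the contributing vertices. **Theorem.** There are finitely many isomorphism classes of monotone twisted tropical covers of type $(g,\underline n,\underline m,r,a)$ with branch points $x_1,\dots,x_k$, and in $\mathbb C(C,J,T)$ $$N^a_g\binom{n_1,\dots,n_p}{m_1,\dots,m_q|r}=\frac{1}{C^qJ^p\prod_{i=1}^p 2n_i}\sum_{\pi} m(\pi),$$ where the sum runs over these isomorphism classes. -/

import Mathlib

open scoped ENNReal

namespace RefinedHurwitz

/-! ### The coefficient field `ℂ(C, J, T)` -/

/-- The field of rational functions over `ℂ` in the three independent variables `C`, `J`, `T`. -/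
abbrev CJT : Type := FractionRing (MvPolynomial (Fin 3) ℂ)

noncomputable def varC : CJT := algebraMap (MvPolynomial (Fin 3) ℂ) CJT (MvPolynomial.X 0)

noncomputable def varJ : CJT := algebraMap (MvPolynomial (Fin 3) ℂ) CJT (MvPolynomial.X 1)

noncomputable def varT : CJT := algebraMap (MvPolynomial (Fin 3) ℂ) CJT (MvPolynomial.X 2)

/-! ### Fixed point-free involutions and twisted factorisations -/

/-- The set `{1, 1̄, …, d, d̄}`: `(x, false)` is the element `x + 1`, and `(x, true)` is the
barred element. -/
abbrev Pt (d : ℕ) : Type := Fin d × Bool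

/-- The involution `τ = (1 1̄) ⋯ (d d̄)`. -/
def tau (d : ℕ) : Equiv.Perm (Pt d) where
  toFun y := (y.1, !y.2)
  invFun y := (y.1, !y.2)
  left_inv := by intro y; simp
  right_inv := by intro y; simp

/-- The cyclic rotation of each block of the composition `n`: it sends `l + 1 ↦ l + 2 ↦ ⋯ ↦
l + nᵢ ↦ l + 1` on the block `{l + 1, …, l + nᵢ}`. -/
def blockRot {d : ℕ} (n : Composition d) : Equiv.Perm (Fin d) :=
  n.blocksFinEquiv.permCongr (Equiv.sigmaCongrRight fun i => finRotate (n.blocksFun i))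

/-- The preferred representative `ρ_n`: the product over the blocks `{l + 1, …, l + nᵢ}` of
`(\overline{l+1}  l+2)(\overline{l+2}  l+3) ⋯ (\overline{l+nᵢ}  l+1)`. -/
def rhoOf {d : ℕ} (n : Composition d) : Equiv.Perm (Pt d) where
  toFun y := if y.2 then (blockRot n y.1, false) else ((blockRot n).symm y.1, true)
  invFun y := if y.2 then (blockRot n y.1, false) else ((blockRot n).symm y.1, true)
  left_inv := by rintro ⟨y, _ | _⟩ <;> simp
  right_inv := by rintro ⟨y, _ | _⟩ <;> simp

/-- The connected component of `y` in the graph `ρ ∪ τ`. -/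
def component {d : ℕ} (ρ : Equiv.Perm (Pt d)) (y : Pt d) : Set (Pt d) :=
  MulAction.orbit (Subgroup.closure {ρ, tau d}) y

/-- The number of connected components of `ρ ∪ τ`, i.e. the number of parts of the type of `ρ`. -/
noncomputable def numParts {d : ℕ} (ρ : Equiv.Perm (Pt d)) : ℕ :=
  Set.ncard (Set.range (component ρ))

open scoped Classical in
/-- The `CJT`-weight of a transposition `s` at a fixed point-free involution `ρ`, where `s` acts
by conjugation: `C` for a cut, `J` for a join, `T` for a twist. -/
noncomputable def cjtWeight {d : ℕ} (ρ s : Equiv.Perm (Pt d)) : CJT :=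
  if numParts (s * ρ * s⁻¹) = numParts ρ + 1 then varC
  else if numParts (s * ρ * s⁻¹) + 1 = numParts ρ then varJ
  else varT

/-- The pair `(u, y)` stands for the transposition exchanging `u` and the unbarred element `y`. -/
abbrev Step (d : ℕ) : Type := Pt d × Fin d

def Step.perm {d : ℕ} (s : Step d) : Equiv.Perm (Pt d) := Equiv.swap s.1 (s.2, false)

/-- `stage ρ σ i` is the involution `σ_i ⋯ σ_1 . ρ` (for `i ≤ k`). -/
def stage {d k : ℕ} (ρ : Equiv.Perm (Pt d)) (σ : Fin k → Step d) : ℕ → Equiv.Perm (Pt d)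
  | 0 => ρ
  | i + 1 =>
    if h : i < k then (σ ⟨i, h⟩).perm * stage ρ σ i * (σ ⟨i, h⟩).perm⁻¹ else stage ρ σ i

/-- The weight of the factorisation `(ρ, σ)`, i.e. the coefficient of `σ_k ⋯ σ_1 . ρ` in the
refined action of `σ_1, …, σ_k` on `ρ`. -/
noncomputable def factWeight {d k : ℕ} (ρ : Equiv.Perm (Pt d)) (σ : Fin k → Step d) : CJT :=
  ∏ i : Fin k, cjtWeight (stage ρ σ i) (σ i).perm

/-- A transitive monotone string of transpositions, applied to `ρ`: the transposition `σ_i` is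
`(p_i q_i)` with `q_i` unbarred and `p_i` one of the elements `1, 1̄, …, q_i - 1, \overline{q_i - 1}`;
the `q_i` weakly increase; and `τ`, `ρ` and the `σ_i` generate a transitive group. -/
structure IsTransMonotone {d k : ℕ} (ρ : Equiv.Perm (Pt d)) (σ : Fin k → Step d) : Prop where
  lt : ∀ i, (σ i).1.1 < (σ i).2
  mono : Monotone fun i => (σ i).2
  trans : MulAction.IsPretransitive
    (Subgroup.closure ({tau d, ρ} ∪ Set.range fun i => (σ i).perm)) (Pt d)

/-- `lab` orders the parts of the type of `ρ`: the connected components of `ρ ∪ τ` are labelled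
bijectively by the indices of `m`, such that the component labelled `j` corresponds to a part of
size `m_j`. -/
structure IsOrdering {d : ℕ} (m : Composition d) (ρ : Equiv.Perm (Pt d))
    (lab : Pt d → Fin m.length) : Prop where
  comp : ∀ y z, lab y = lab z ↔ z ∈ component ρ y
  card : ∀ j, Set.ncard {y | lab y = j} = 2 * m.blocksFun j

/-- The last part `n_p` of a composition (of a positive integer). -/
def lastPart {d : ℕ} (n : Composition d) : ℕ := n.blocks.getLastD 0

/-- The number `k = 2g - 2 + p + q` of transpositions, or of branch points. -/
def numSteps {d : ℕ} (g : ℚ) (n m : Composition d) : ℕ :=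
  ⌊2 * g - 2 + n.length + m.length⌋₊

/-- The pairs (string of transpositions, order of the parts) counted by `N_g^a(n; m | r)`. -/
structure IsCounted {d k : ℕ} (n m : Composition d) (r : Fin m.length) (a : ℕ)
    (σ : Fin k → Step d) (lab : Pt d → Fin m.length) : Prop where
  transMono : IsTransMonotone (rhoOf n) σ
  ordering : IsOrdering m (stage (rhoOf n) σ k) lab
  /-- the largest element `d` lies in the component that has order `r` -/
  largest : ∀ y : Fin d, (y : ℕ) + 1 = d → lab (y, false) = r
  /-- the larger element of the last transposition is `d - n_p + a` -/
  last : ∀ i : Fin k, (i : ℕ) + 1 = k → ((σ i).2 : ℕ) + 1 + lastPart n = d + a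
  /-- the convention for the empty string -/
  empty : k = 0 → a = 1

/-- The factor `1 / (C^q J^p ∏ (2j)^{n_j})`; here `n_j` is the number of parts equal to `j`, so that
the product is the product of `2 nᵢ` over the parts `nᵢ` of `n`. -/
noncomputable def prefactor {d : ℕ} (n m : Composition d) : CJT :=
  1 / (varC ^ m.length * varJ ^ n.length * ∏ i, (2 * (n.blocksFun i : CJT)))

open scoped Classical in
/-- The refined monotone double Hurwitz number `N_g^a(n_1, …, n_p; m_1, …, m_q | r)`. -/
noncomputable def refinedN {d : ℕ} (g : ℚ) (n m : Composition d) (r : Fin m.length) (a : ℕ) : CJT :=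
  prefactor n m *
    ∑ f : (Fin (numSteps g n m) → Step d) × (Pt d → Fin m.length) with IsCounted n m r a f.1 f.2,
      factWeight (rhoOf n) f.1

/-! ### Tropical covers of the line -/

/-- A tropical cover of the real line subdivided at the points `x 0 < ⋯ < x (k - 1)`.
An edge is mapped linearly onto the segment between the images of its left endpoint `src` and its
right endpoint `tgt`; the value `none` means that the edge is an end going to `-∞`, respectively
`+∞` (the leaves at infinity are not recorded among the vertices). -/
structure TropicalCover {k : ℕ} (x : Fin k → ℝ) : Type 1 where
  V : Type
  E : Type
  [fintypeV : Fintype V]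
  [fintypeE : Fintype E]
  /-- the vertex `v` lies over `x (pt v)` -/
  pt : V → Fin k
  src : E → Option V
  tgt : E → Option V
  src_lt_tgt : ∀ e u v, src e = some u → tgt e = some v → pt u < pt v
  /-- the weight of an edge, i.e. the slope of the map on it -/
  wt : E → ℕ
  wt_pos : ∀ e, 0 < wt e
  /-- the length of an edge -/
  len : E → ℝ≥0∞
  len_end : ∀ e, len e = ⊤ ↔ src e = none ∨ tgt e = none
  len_inner : ∀ e u v, src e = some u → tgt e = some v →
    (wt e : ℝ≥0∞) * len e = ENNReal.ofReal (x (pt v) - x (pt u))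
  /-- harmonicity -/
  balanced : ∀ v, ∑ᶠ (e) (_ : tgt e = some v), wt e = ∑ᶠ (e) (_ : src e = some v), wt e

attribute [instance] TropicalCover.fintypeV TropicalCover.fintypeE

namespace TropicalCover

variable {k : ℕ} {x : Fin k → ℝ}

/-- The number of incoming edges of a vertex. -/
noncomputable def inDeg (c : TropicalCover x) (v : c.V) : ℕ := Set.ncard {e | c.tgt e = some v}

/-- The number of outgoing edges of a vertex. -/
noncomputable def outDeg (c : TropicalCover x) (v : c.V) : ℕ := Set.ncard {e | c.src e = some v}

noncomputable def valence (c : TropicalCover x) (v : c.V) : ℕ := c.inDeg v + c.outDeg v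

def Adjacent (c : TropicalCover x) (e : c.E) (v : c.V) : Prop :=
  c.src e = some v ∨ c.tgt e = some v

/-- Isomorphisms of tropical covers: isomorphisms of metric graphs over the line. -/
structure Iso (c c' : TropicalCover x) where
  onV : c.V ≃ c'.V
  onE : c.E ≃ c'.E
  pt_eq : ∀ v, c'.pt (onV v) = c.pt v
  src_eq : ∀ e, c'.src (onE e) = (c.src e).map onV
  tgt_eq : ∀ e, c'.tgt (onE e) = (c.tgt e).map onV
  wt_eq : ∀ e, c'.wt (onE e) = c.wt e
  len_eq : ∀ e, c'.len (onE e) = c.len e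

end TropicalCover

/-- A connected twisted tropical cover with `k` branch points and with ends of weights `n` on the
left and `m` on the right.
`inEnd (i, false)` and `inEnd (i, true)` are the in-ends labelled `i` and `p + i`, and
`outEnd (j, false)` and `outEnd (j, true)` are the out-ends labelled `j` and `q + j`. -/
structure TwistedCover {k d : ℕ} (x : Fin k → ℝ) (n m : Composition d) : Type 1
    extends TropicalCover x where
  /-- the involution -/
  inv : TropicalCover.Iso toTropicalCover toTropicalCover
  inv_inv_V : ∀ v, inv.onV (inv.onV v) = v
  inv_inv_E : ∀ e, inv.onE (inv.onE e) = e
  /-- over each branch point there are two 3-valent vertices or one 4-valent vertex -/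
  fibre : ∀ i : Fin k,
    (Set.ncard {v | pt v = i} = 2 ∧ ∀ v, pt v = i → toTropicalCover.valence v = 3) ∨
    (Set.ncard {v | pt v = i} = 1 ∧ ∀ v, pt v = i → toTropicalCover.valence v = 4)
  four_wt : ∀ v e e', toTropicalCover.valence v = 4 → toTropicalCover.Adjacent e v →
    toTropicalCover.Adjacent e' v → wt e = wt e'
  /-- the fixed locus of the involution is the set of 4-valent vertices -/
  fixed_V : ∀ v, inv.onV v = v ↔ toTropicalCover.valence v = 4
  fixed_E : ∀ e, inv.onE e ≠ e
  inEnd : Fin n.length × Bool → E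
  inEnd_inj : Function.Injective inEnd
  inEnd_range : ∀ e, src e = none ↔ e ∈ Set.range inEnd
  inEnd_inv : ∀ i b, inv.onE (inEnd (i, b)) = inEnd (i, !b)
  inEnd_wt : ∀ i b, wt (inEnd (i, b)) = n.blocksFun i
  outEnd : Fin m.length × Bool → E
  outEnd_inj : Function.Injective outEnd
  outEnd_range : ∀ e, tgt e = none ↔ e ∈ Set.range outEnd
  outEnd_inv : ∀ j b, inv.onE (outEnd (j, b)) = outEnd (j, !b)
  outEnd_wt : ∀ j b, wt (outEnd (j, b)) = m.blocksFun j
  /-- the quotient of the cover by the involution is connected -/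
  connected : ∀ e e', Relation.EqvGen
    (fun f f' => f' = inv.onE f ∨
      ∃ v, toTropicalCover.Adjacent f v ∧ toTropicalCover.Adjacent f' v) e e'

/-! ### Monotone twisted tropical covers -/

inductive Colour : Type
  | normal
  | dashed
  | bold

/-- A twisted tropical cover with coloured edges and counters. The counter is meaningful only on
edges that are not normal. -/
structure ColouredCover {k d : ℕ} (x : Fin k → ℝ) (n m : Composition d) : Type 1
    extends TwistedCover x n m where
  col : E → Colour
  cnt : E → ℕ

namespace ColouredCover

variable {k d : ℕ} {x : Fin k → ℝ} {n m : Composition d}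

/-- The edges that arise from the in-end labelled `p + i`: the in-end itself, and then every
non-normal edge going out of a vertex at which a bold edge arising from this in-end comes in.
The bold ones among them form the chain beginning at the in-end labelled `p + i`. -/
inductive Arises (c : ColouredCover x n m) (i : Fin n.length) : c.E → Prop
  | start : Arises c i (c.inEnd (i, true))
  | next (e e' : c.E) (v : c.V) : Arises c i e → c.col e = Colour.bold → c.tgt e = some v →
      c.src e' = some v → c.col e' ≠ Colour.normal → Arises c i e'

/-- The in-end labelled `p + i` is bold, i.e. a chain begins at it. -/
def HasChain (c : ColouredCover x n m) (i : Fin n.length) : Prop :=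
  c.col (c.inEnd (i, true)) = Colour.bold

/-- `v` is an inner vertex of the chain beginning at the in-end labelled `p + i`. -/
def OnChain (c : ColouredCover x n m) (i : Fin n.length) (v : c.V) : Prop :=
  ∃ e, c.Arises i e ∧ c.col e = Colour.bold ∧ c.tgt e = some v

end ColouredCover

/-- Monotone twisted tropical covers of type `(g, n, m)`, where `k = 2g - 2 + p + q`. -/
structure MonotoneCover {k d : ℕ} (x : Fin k → ℝ) (n m : Composition d) : Type 1
    extends ColouredCover x n m where
  in_normal : ∀ i, col (inEnd (i, false)) = Colour.normal
  in_not_normal : ∀ i, col (inEnd (i, true)) ≠ Colour.normal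
  /-- a bold edge ends at an inner vertex of its chain -/
  bold_tgt : ∀ e, col e = Colour.bold → tgt e ≠ none
  /-- the segments `[π(l), π(r)]` spanned by two different chains are disjoint -/
  chain_disjoint : ∀ i i', i ≠ i' → ∀ u v u' v', toColouredCover.OnChain i u →
    toColouredCover.OnChain i v → toColouredCover.OnChain i' u' → toColouredCover.OnChain i' v' →
    Disjoint (Set.Icc (x (pt u)) (x (pt v))) (Set.Icc (x (pt u')) (x (pt v')))
  /-- the order of the chains along the line is the order of the labels of their in-ends -/
  chain_order : ∀ i i' v v', toColouredCover.HasChain i → toColouredCover.HasChain i' →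
    tgt (inEnd (i, true)) = some v → tgt (inEnd (i', true)) = some v' →
    (x (pt v) < x (pt v') ↔ i < i')
  /-- the in-ends attached to a chain or to its mirror image do not have a larger label -/
  chain_label : ∀ i j b v w, toColouredCover.OnChain i v → (w = v ∨ w = inv.onV v) →
    tgt (inEnd (j, b)) = some w → j ≤ i
  in_counter : ∀ i, cnt (inEnd (i, true)) = 1
  /-- for every inner vertex `v`, one of `v` and `ι(v)` has a unique incoming bold edge and a unique
  outgoing non-normal edge, and the counters increase weakly -/
  vertex : ∀ v, ∃ w, (w = v ∨ w = inv.onV v) ∧ ∃ e e',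
    (∀ f, (tgt f = some w ∧ col f = Colour.bold) ↔ f = e) ∧
    (∀ f, (src f = some w ∧ col f ≠ Colour.normal) ↔ f = e') ∧ cnt e ≤ cnt e'
  /-- every non-normal edge arises from a unique chain -/
  unique_chain : ∀ e, col e ≠ Colour.normal → ∃! i, toColouredCover.Arises i e
  counter_bounds : ∀ i e, toColouredCover.Arises i e →
    n.blocksFun i < cnt e + wt e ∧ cnt e ≤ n.blocksFun i

namespace MonotoneCover

variable {k d : ℕ} {x : Fin k → ℝ} {n m : Composition d}

/-- The cover is of type `(g, n, m, r, a)`: the final dashed edge of the largest chain is the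
out-end labelled `r` or `q + r`, and its counter is `a`. If there are no branch points, then there
is no chain, and the dashed in-end takes the role of the final dashed edge. -/
def IsOfType (c : MonotoneCover x n m) (r : Fin m.length) (a : ℕ) : Prop :=
  ∃ i, (k = 0 ∨ (c.HasChain i ∧ ∀ j, c.HasChain j → j ≤ i)) ∧
    ∃ e b, c.Arises i e ∧ c.col e = Colour.dashed ∧ e = c.outEnd (r, b) ∧ c.cnt e = a

/-- An edge `e` is contributing if neither `e` nor `ι(e)` is bold. -/
def ContribEdge (c : MonotoneCover x n m) (e : c.E) : Prop :=
  c.col e ≠ Colour.bold ∧ c.col (c.inv.onE e) ≠ Colour.bold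

/-- A vertex is contributing if it has an incoming bold edge. -/
def ContribVertex (c : MonotoneCover x n m) (v : c.V) : Prop :=
  ∃ e, c.tgt e = some v ∧ c.col e = Colour.bold

open scoped Classical in
/-- The number `ω(v) - nᵢ + c(e) - 1`, where `v` is a contributing vertex on the chain beginning
at the in-end labelled `p + i`, and `e` is the outgoing non-normal edge at `v`. The sum below has
exactly one term, and `ω(v) = ω(e)` if `v` is 4-valent. -/
noncomputable def twistNumber (c : MonotoneCover x n m) (v : c.V) : ℤ :=
  ∑ i, ∑ e with c.src e = some v ∧ c.Arises i e,
    ((c.wt e : ℤ) - n.blocksFun i + c.cnt e - 1)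

open scoped Classical in
/-- The multiplicity of a contributing vertex: `C` for a cut, `J` for a join, and
`T (ω(v) - nᵢ + c(e) - 1)` for a 4-valent vertex. -/
noncomputable def vertexMult (c : MonotoneCover x n m) (v : c.V) : CJT :=
  if c.inDeg v = 1 then varC
  else if c.outDeg v = 1 then varJ
  else varT * (c.twistNumber v : CJT)

open scoped Classical in
/-- The multiplicity of a monotone twisted tropical cover: the square root of the product of the
weights of the contributing edges other than out-ends, times the product of the multiplicities of
the contributing vertices. -/
noncomputable def mult (c : MonotoneCover x n m) : CJT :=
  algebraMap ℂ CJT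
      ((Real.sqrt (∏ e with c.ContribEdge e ∧ c.tgt e ≠ none, (c.wt e : ℝ)) : ℝ) : ℂ) *
    ∏ v with c.ContribVertex v, c.vertexMult v

/-- Isomorphisms of monotone twisted tropical covers: they respect the cover, the involution, the
labels, the colours and the counters, where the labels `j` and `q + j` of the two out-ends of a pair
are not distinguished from each other. -/
structure Iso (c c' : MonotoneCover x n m) extends
    TropicalCover.Iso c.toTropicalCover c'.toTropicalCover where
  inv_V : ∀ v, onV (c.inv.onV v) = c'.inv.onV (onV v)
  inv_E : ∀ e, onE (c.inv.onE e) = c'.inv.onE (onE e)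
  inEnd_eq : ∀ i b, onE (c.inEnd (i, b)) = c'.inEnd (i, b)
  outEnd_eq : ∀ j b, ∃ b', onE (c.outEnd (j, b)) = c'.outEnd (j, b')
  col_eq : ∀ e, c'.col (onE e) = c.col e
  cnt_eq : ∀ e, c.col e ≠ Colour.normal → c'.cnt (onE e) = c.cnt e

namespace Iso

def refl (c : MonotoneCover x n m) : Iso c c where
  onV := Equiv.refl _
  onE := Equiv.refl _
  pt_eq := by simp
  src_eq := by simp
  tgt_eq := by simp
  wt_eq := by simp
  len_eq := by simp
  inv_V := by simp
  inv_E := by simp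
  inEnd_eq := by simp
  outEnd_eq := fun j b => ⟨b, rfl⟩
  col_eq := by simp
  cnt_eq := by simp

def symm {c c' : MonotoneCover x n m} (f : Iso c c') : Iso c' c where
  onV := f.onV.symm
  onE := f.onE.symm
  pt_eq v := by rw [← f.pt_eq, Equiv.apply_symm_apply]
  src_eq e := by
    have h := f.src_eq (f.onE.symm e)
    rw [Equiv.apply_symm_apply] at h
    rw [h, Option.map_map]; simp
  tgt_eq e := by
    have h := f.tgt_eq (f.onE.symm e)
    rw [Equiv.apply_symm_apply] at h
    rw [h, Option.map_map]; simp
  wt_eq e := by rw [← f.wt_eq, Equiv.apply_symm_apply]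
  len_eq e := by rw [← f.len_eq, Equiv.apply_symm_apply]
  inv_V v := by rw [Equiv.symm_apply_eq, f.inv_V, Equiv.apply_symm_apply]
  inv_E e := by rw [Equiv.symm_apply_eq, f.inv_E, Equiv.apply_symm_apply]
  inEnd_eq i b := by rw [Equiv.symm_apply_eq, f.inEnd_eq]
  outEnd_eq j b := by
    obtain ⟨b', hb'⟩ := f.outEnd_eq j b
    rcases Bool.eq_or_eq_not b' b with h | h
    · exact ⟨b, by rw [Equiv.symm_apply_eq, hb', h]⟩
    · refine ⟨!b, ?_⟩
      rw [Equiv.symm_apply_eq, ← c.outEnd_inv, f.inv_E, hb', c'.outEnd_inv, h, Bool.not_not]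
  col_eq e := by rw [← f.col_eq, Equiv.apply_symm_apply]
  cnt_eq e h := by
    rw [← f.cnt_eq, Equiv.apply_symm_apply]
    rwa [← f.col_eq, Equiv.apply_symm_apply]

def trans {c c' c'' : MonotoneCover x n m} (f : Iso c c') (f' : Iso c' c'') : Iso c c'' where
  onV := f.onV.trans f'.onV
  onE := f.onE.trans f'.onE
  pt_eq v := by simp [f'.pt_eq, f.pt_eq]
  src_eq e := by simp [f'.src_eq, f.src_eq, Option.map_map, Function.comp_def]
  tgt_eq e := by simp [f'.tgt_eq, f.tgt_eq, Option.map_map, Function.comp_def]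
  wt_eq e := by simp [f'.wt_eq, f.wt_eq]
  len_eq e := by simp [f'.len_eq, f.len_eq]
  inv_V v := by simp [f'.inv_V, f.inv_V]
  inv_E e := by simp [f'.inv_E, f.inv_E]
  inEnd_eq i b := by simp [f'.inEnd_eq, f.inEnd_eq]
  outEnd_eq j b := by
    obtain ⟨b', h⟩ := f.outEnd_eq j b
    obtain ⟨b'', h'⟩ := f'.outEnd_eq j b'
    exact ⟨b'', by simp [h, h']⟩
  col_eq e := by simp [f'.col_eq, f.col_eq]
  cnt_eq e h := by
    rw [Equiv.trans_apply, f'.cnt_eq _ (by rwa [f.col_eq]), f.cnt_eq e h]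

theorem src_some {c c' : MonotoneCover x n m} (f : Iso c c') (e : c.E) (v : c.V) :
    c'.src (f.onE e) = some (f.onV v) ↔ c.src e = some v := by
  rw [f.src_eq]; simp

theorem tgt_some {c c' : MonotoneCover x n m} (f : Iso c c') (e : c.E) (v : c.V) :
    c'.tgt (f.onE e) = some (f.onV v) ↔ c.tgt e = some v := by
  rw [f.tgt_eq]; simp

theorem arises {c c' : MonotoneCover x n m} (f : Iso c c') {i : Fin n.length} {e : c.E}
    (h : c.Arises i e) : c'.Arises i (f.onE e) := by
  induction h with
  | start => rw [f.inEnd_eq]; exact ColouredCover.Arises.start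
  | next e e' v _ h₁ h₂ h₃ h₄ ih =>
    exact ColouredCover.Arises.next _ _ (f.onV v) ih (by rw [f.col_eq, h₁])
      ((f.tgt_some e v).2 h₂) ((f.src_some e' v).2 h₃) (by rwa [f.col_eq])

theorem arises_iff {c c' : MonotoneCover x n m} (f : Iso c c') {i : Fin n.length} {e : c.E} :
    c'.Arises i (f.onE e) ↔ c.Arises i e := by
  refine ⟨fun h => ?_, f.arises⟩
  have h' := f.symm.arises h
  rwa [show f.symm.onE (f.onE e) = e from f.onE.symm_apply_apply e] at h'

theorem arises_ne {c : MonotoneCover x n m} {i : Fin n.length} {e : c.E}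
    (h : c.Arises i e) : c.col e ≠ Colour.normal := by
  cases h with
  | start => exact c.in_not_normal i
  | next _ _ _ _ _ _ _ h => exact h

theorem mult_eq {c c' : MonotoneCover x n m} (f : Iso c c') : c.mult = c'.mult := by
  classical
  have hin : ∀ v, c'.inDeg (f.onV v) = c.inDeg v := fun v => by
    unfold TropicalCover.inDeg
    rw [← Set.ncard_image_of_injective _ f.onE.injective]
    congr 1
    ext e
    obtain ⟨e, rfl⟩ := f.onE.surjective e
    simp [f.tgt_some]
  have hout : ∀ v, c'.outDeg (f.onV v) = c.outDeg v := fun v => by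
    unfold TropicalCover.outDeg
    rw [← Set.ncard_image_of_injective _ f.onE.injective]
    congr 1
    ext e
    obtain ⟨e, rfl⟩ := f.onE.surjective e
    simp [f.src_some]
  have htw : ∀ v, c'.twistNumber (f.onV v) = c.twistNumber v := fun v => by
    unfold twistNumber
    refine Finset.sum_congr rfl fun i _ => ?_
    symm
    refine Finset.sum_equiv f.onE (fun e => ?_) (fun e he => ?_)
    · simp [f.src_some, f.arises_iff]
    · simp only [Finset.mem_filter, Finset.mem_univ, true_and] at he
      rw [f.wt_eq, f.cnt_eq e (arises_ne he.2)]
  have hv : ∀ v, c.vertexMult v = c'.vertexMult (f.onV v) := fun v => by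
    unfold vertexMult
    rw [hin, hout, htw]
  unfold mult
  congr 1
  · congr 3
    refine Finset.prod_equiv f.onE (fun e => ?_) (fun e _ => by rw [f.wt_eq])
    rw [Finset.mem_filter, Finset.mem_filter]
    simp [ContribEdge, f.col_eq, ← f.inv_E, f.tgt_eq]
  · refine Finset.prod_equiv f.onV (fun v => ?_) (fun v _ => hv v)
    rw [Finset.mem_filter, Finset.mem_filter]
    simp only [Finset.mem_univ, true_and, ContribVertex]
    refine ⟨fun ⟨e, h, h'⟩ => ⟨f.onE e, (f.tgt_some e v).2 h, by rw [f.col_eq, h']⟩, ?_⟩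
    rintro ⟨e, h, h'⟩
    obtain ⟨e, rfl⟩ := f.onE.surjective e
    exact ⟨e, (f.tgt_some e v).1 h, by rwa [f.col_eq] at h'⟩

end Iso

end MonotoneCover

/-- Isomorphism of monotone twisted tropical covers of type `(g, n, m, r, a)`. -/
def coverSetoid {k d : ℕ} (x : Fin k → ℝ) (n m : Composition d) (r : Fin m.length) (a : ℕ) :
    Setoid {c : MonotoneCover x n m // c.IsOfType r a} where
  r c c' := Nonempty (MonotoneCover.Iso c.1 c'.1)
  iseqv :=
    { refl := fun c => ⟨MonotoneCover.Iso.refl c.1⟩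
      symm := fun ⟨f⟩ => ⟨f.symm⟩
      trans := fun ⟨f⟩ ⟨f'⟩ => ⟨f.trans f'⟩ }

/-- Monotone twisted tropical covers of type `(g, n, m, r, a)` with branch points `x`, up to
isomorphism. -/
def CoverClass {k d : ℕ} (x : Fin k → ℝ) (n m : Composition d) (r : Fin m.length) (a : ℕ) :
    Type 1 :=
  Quotient (coverSetoid x n m r a)

/-- The multiplicity of an isomorphism class of covers. -/
noncomputable def CoverClass.mult {k d : ℕ} {x : Fin k → ℝ} {n m : Composition d}
    {r : Fin m.length} {a : ℕ} (c : CoverClass x n m r a) : CJT :=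
  Quotient.lift (s := coverSetoid x n m r a) (fun c => c.1.mult) (fun _ _ ⟨f⟩ => f.mult_eq) c

end RefinedHurwitz

/-! A component of the group generated by ρ and τ is the union of two cycles of τρ, and τ exchanges
them (`not_sameCycle_flip`). These two strands are an edge of the cover and its mirror image, and
their common length is the weight of the edge. Conjugation by a transposition (p q) changes only the
strands of p and q and their mirror images. If p lies on the strand of q, that strand is cut at a
place determined by p (`ncard_cut`). If p lies on another component, the two components are joined
(`sameCycle_join`). If p lies on the mirror strand, the component is twisted (`sameCycle_twist`). So
a string of transpositions draws a twisted cover, one branch point per step.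

Monotonicity produces the chains. The unbarred elements beyond all larger elements used so far have
not been moved, so the strand of the next larger element q is known in advance (`naming_untouched`):
it is the output of the preceding step if that step worked in the same block, and otherwise the
in-end of the block. These strands are the bold edges, the block of q is the index of the chain, and
the position of q in its block is the counter.

Strings and covers are compared through a third object, the valid `Diagram`, which records the
larger elements, the partners in the joins, the output weights and the labels of the final edges.
The strings with a given diagram are counted step by step (`Diagram.Valid.ncard_realizes`). In a cut
p is determined by the weights. In a join p is any point of the partner strand, which gives its
weight as the number of choices. In a twist p is any point of the mirror strand below q, which
excludes the barred end of the block from q on and leaves ω − n_i + c − 1 choices. Since joined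
edges come in mirror pairs, the square root in the multiplicity is the product of the join weights,
and the weighted count of strings is the multiplicity of a cover built from the diagram
(`Diagram.Valid.mult_cover`).

It remains that isomorphism classes of monotone covers correspond to valid diagrams
(`coverClassOf_bijective`). The main point is that the non-normal edges arising from one in-end form
a path (`MonotoneCover.comparable`), so that exactly one bold edge ends over each branch point. This
gives every pair of mirror edges a name and every edge a strand, and the cover can be rebuilt from
its diagram. Summing over diagrams (`sum_factWeight`) proves the identity. -/

namespace RefinedHurwitz

/-! ### Strands of a pair of fixed point-free involutions -/

section Strands

open Equiv

variable {X α : Type*}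

/-- Fixed point-free involutions. -/
structure IsFpf (ρ : Perm X) : Prop where
  inv : ∀ y, ρ (ρ y) = y
  ne : ∀ y, ρ y ≠ y

theorem IsFpf.symm_apply {ρ : Perm X} (h : IsFpf ρ) (y : X) : ρ⁻¹ y = ρ y := by
  rw [Perm.inv_eq_iff_eq, h.inv]

theorem IsFpf.inv_eq {ρ : Perm X} (h : IsFpf ρ) : ρ⁻¹ = ρ := by
  ext y; exact h.symm_apply y

theorem IsFpf.conj {ρ : Perm X} (h : IsFpf ρ) (s : Perm X) : IsFpf (s * ρ * s⁻¹) where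
  inv y := by simp [h.inv]
  ne y e := by
    refine h.ne (s⁻¹ y) ?_
    rw [Perm.eq_inv_iff_eq]
    simpa using e

/-- A name and a strand for each point, such that the strands are the cycles of `τ * ρ`, and `τ`
exchanges the two strands with the same name. -/
structure IsNaming (τ ρ : Perm X) (nm : X → α × Bool) : Prop where
  flip : ∀ y, nm (τ y) = ((nm y).1, !(nm y).2)
  cyc : ∀ y z, nm y = nm z ↔ (τ * ρ).SameCycle y z

theorem sameCycle_induction {f : Perm X} {P : X → Prop} (h : ∀ y, P (f y) ↔ P y) {y z : X}
    (hyz : f.SameCycle y z) : P y ↔ P z := by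
  obtain ⟨i, rfl⟩ := hyz
  induction i using Int.induction_on with
  | zero => simp
  | succ i ih => rw [ih, add_comm, zpow_add, zpow_one, Perm.mul_apply, h]
  | pred i ih =>
    rw [ih, ← h ((f ^ (-(i : ℤ) - 1)) y), ← Perm.mul_apply, ← zpow_one_add]
    simp

/-- In a finite set the forward powers reach the whole cycle, so agreement on the invariant set P is
enough and the inverses need no attention. -/
theorem sameCycle_congr [Finite X] {f f' : Perm X} {P : X → Prop} (h : ∀ y, P (f' y) ↔ P y)
    (hf : ∀ y, P y → f y = f' y) {y z : X} (hy : P y) : f'.SameCycle y z ↔ f.SameCycle y z := by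
  have key : ∀ i : ℕ, (f ^ i) y = (f' ^ i) y ∧ P ((f' ^ i) y) := by
    intro i
    induction i with
    | zero => simpa
    | succ i ih =>
      rw [pow_succ', pow_succ', Perm.mul_apply, Perm.mul_apply, ih.1, hf _ ih.2, h]
      exact ⟨rfl, ih.2⟩
  constructor
  · intro hs
    obtain ⟨i, rfl⟩ := hs.exists_nat_pow_eq
    rw [← (key i).1]
    exact ⟨i, by simp⟩
  · intro hs
    obtain ⟨i, rfl⟩ := hs.exists_nat_pow_eq
    rw [(key i).1]
    exact ⟨i, by simp⟩

/-- τ conjugates τρ to its inverse ρτ, and a permutation has the same cycles as its inverse. -/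
theorem sameCycle_flip {τ ρ : Perm X} (hτ : IsFpf τ) (hρ : IsFpf ρ) {y z : X} :
    (τ * ρ).SameCycle (τ y) (τ z) ↔ (τ * ρ).SameCycle y z := by
  have : τ * ρ = τ * (τ * ρ)⁻¹ * τ⁻¹ := by
    rw [mul_inv_rev, hτ.inv_eq, hρ.inv_eq]
    ext x; simp [hτ.inv]
  nth_rewrite 1 [this]
  rw [Perm.sameCycle_conj, Perm.sameCycle_inv]
  simp

theorem sameCycle_flip' {τ ρ : Perm X} (hτ : IsFpf τ) (hρ : IsFpf ρ) {y z : X} :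
    (τ * ρ).SameCycle (τ y) z ↔ (τ * ρ).SameCycle y (τ z) := by
  rw [← sameCycle_flip hτ hρ, hτ.inv]

/-- On a cycle preserved by τ, the involution τ would act as a reflection of a cyclic order. If τy
is an even number 2j of steps after y, then τ fixes the point j steps after y. If it is 2j + 1 steps
after y, then ρ fixes that point. -/
theorem not_sameCycle_flip {τ ρ : Perm X} (hτ : IsFpf τ) (hρ : IsFpf ρ) (y : X) :
    ¬ (τ * ρ).SameCycle y (τ y) := by
  rintro ⟨i, hi⟩
  have hconj : ∀ (j : ℤ) (x : X), τ (((τ * ρ) ^ j) x) = ((τ * ρ) ^ (-j)) (τ x) := by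
    intro j x
    have h1 : τ * (τ * ρ) * τ⁻¹ = (τ * ρ)⁻¹ := by
      rw [mul_inv_rev, hρ.inv_eq, ← mul_assoc]
      ext x; simp [hτ.inv]
    have h2 : τ * (τ * ρ) ^ j * τ⁻¹ = (τ * ρ) ^ (-j) := by
      rw [← conj_zpow, h1, inv_zpow, zpow_neg]
    rw [← h2]; simp
  rcases Int.even_or_odd' i with ⟨j, rfl | rfl⟩
  · refine hτ.ne (((τ * ρ) ^ j) y) ?_
    rw [hconj, ← hi, ← Perm.mul_apply, ← zpow_add]
    congr 2; ring
  · refine hρ.ne (((τ * ρ) ^ j) y) ?_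
    have : ρ (((τ * ρ) ^ j) y) = τ (((τ * ρ) ^ (1 + j)) y) := by
      rw [zpow_add, zpow_one]; simp [hτ.inv]
    rw [this, hconj, ← hi, ← Perm.mul_apply, ← zpow_add]
    congr 2; ring

namespace IsNaming

variable {τ ρ : Perm X} {nm : X → α × Bool}

/-- Since τρ preserves every strand, ρ moves a point to the same strand as τ does. -/
theorem flip_rho (h : IsNaming τ ρ nm) (hρ : IsFpf ρ) (y : X) :
    nm (ρ y) = ((nm y).1, !(nm y).2) := by
  rw [← h.flip, h.cyc, ← Perm.sameCycle_apply_left]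
  simp [hρ.inv, Perm.SameCycle.refl]

theorem name_eq_iff (h : IsNaming τ ρ nm) (y z : X) :
    (nm y).1 = (nm z).1 ↔ (τ * ρ).SameCycle y z ∨ (τ * ρ).SameCycle y (τ z) := by
  rw [← h.cyc, ← h.cyc, h.flip, Prod.ext_iff, Prod.ext_iff]
  cases (nm y).2 <;> cases (nm z).2 <;> simp

theorem ncard_flip (h : IsNaming τ ρ nm) (hτ : IsFpf τ) (a : α) (b : Bool) :
    Set.ncard {y | nm y = (a, !b)} = Set.ncard {y | nm y = (a, b)} := by
  rw [← Set.ncard_image_of_injective _ τ.injective]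
  congr 1
  ext y
  simp only [Set.mem_image, Set.mem_ofPred_eq]
  constructor
  · rintro ⟨z, hz, rfl⟩
    rw [h.flip, hz]; simp
  · intro hy
    exact ⟨τ y, by rw [h.flip, hy], hτ.inv y⟩

theorem ncard_eq (h : IsNaming τ ρ nm) (hτ : IsFpf τ) (a : α) (b b' : Bool) :
    Set.ncard {y | nm y = (a, b)} = Set.ncard {y | nm y = (a, b')} := by
  rcases Bool.eq_or_eq_not b' b with rfl | rfl
  · rfl
  · rw [h.ncard_flip hτ]

theorem ncard_name [Finite X] (h : IsNaming τ ρ nm) (hτ : IsFpf τ) (a : α) :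
    Set.ncard {y | (nm y).1 = a} = 2 * Set.ncard {y | nm y = (a, true)} := by
  have : {y | (nm y).1 = a} = {y | nm y = (a, true)} ∪ {y | nm y = (a, false)} := by
    ext y
    simp only [Set.mem_ofPred_eq, Set.mem_union, Prod.ext_iff]
    cases (nm y).2 <;> simp
  rw [this, Set.ncard_union_eq _ (Set.toFinite _) (Set.toFinite _), h.ncard_eq hτ a false true,
    two_mul]
  rw [Set.disjoint_left]
  intro y (hy : nm y = _) (hy' : nm y = _)
  rw [hy] at hy'; simp at hy'

end IsNaming

/-! ### The effect of a transposition on the strands -/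

open scoped Classical in
/-- New names `A` and `B` for the strands changed when a transposition exchanging `p` and `q` is
applied; `φ` is the permutation whose cycles are the new strands. -/
noncomputable def relabel (τ φ : Perm X) (A B : α) (p q : X) (nm : X → α × Bool) (y : X) :
    α × Bool :=
  if φ.SameCycle q y then (A, true) else if φ.SameCycle q (τ y) then (A, false)
  else if φ.SameCycle p y then (B, true) else if φ.SameCycle p (τ y) then (B, false) else nm y

/-- The touched points, on the new strands of p and q and their mirror images, form an invariant set
outside which the two permutations agree. There the old names still describe the cycles. On the
touched points the new names separate the cycles because a strand never meets its mirror image, and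
A and B are fresh. -/
theorem relabel_isNaming_of_congr [Finite X] {τ ρ ρ' : Perm X} {nm : X → α × Bool} {p q : X}
    (h : IsNaming τ ρ nm) (hτ : IsFpf τ) (hρ' : IsFpf ρ') {A B : α}
    (hAB : A ≠ B) (hA : ∀ y, (nm y).1 ≠ A) (hB : ∀ y, (nm y).1 ≠ B)
    (ht : ∀ y, ((τ * ρ').SameCycle q ((τ * ρ') y) ∨ (τ * ρ').SameCycle q (τ ((τ * ρ') y)) ∨
      (τ * ρ').SameCycle p ((τ * ρ') y) ∨ (τ * ρ').SameCycle p (τ ((τ * ρ') y))) ↔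
      ((τ * ρ').SameCycle q y ∨ (τ * ρ').SameCycle q (τ y) ∨ (τ * ρ').SameCycle p y ∨
        (τ * ρ').SameCycle p (τ y)))
    (hρ : ∀ y, ¬ ((τ * ρ').SameCycle q y ∨ (τ * ρ').SameCycle q (τ y) ∨ (τ * ρ').SameCycle p y ∨
        (τ * ρ').SameCycle p (τ y)) → (τ * ρ) y = (τ * ρ') y) :
    IsNaming τ ρ' (relabel τ (τ * ρ') A B p q nm) := by
  have hd : ∀ x y, (τ * ρ').SameCycle x y → ¬ (τ * ρ').SameCycle x (τ y) :=
    fun x y h₁ h₂ => not_sameCycle_flip hτ hρ' y (h₁.symm.trans h₂)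
  have hc : ∀ y z, ¬ ((τ * ρ').SameCycle q y ∨ (τ * ρ').SameCycle q (τ y) ∨
      (τ * ρ').SameCycle p y ∨ (τ * ρ').SameCycle p (τ y)) →
      (nm y = nm z ↔ (τ * ρ').SameCycle y z) := fun y z hy => by
    rw [h.cyc]
    exact (sameCycle_congr (P := fun y => ¬ ((τ * ρ').SameCycle q y ∨ (τ * ρ').SameCycle q (τ y) ∨
      (τ * ρ').SameCycle p y ∨ (τ * ρ').SameCycle p (τ y)))
      (fun y => not_congr (ht y)) hρ hy).symm
  have hs : ∀ y z, (τ * ρ').SameCycle (τ y) (τ z) ↔ (τ * ρ').SameCycle y z :=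
    fun y z => sameCycle_flip hτ hρ'
  have htr : ∀ x y z, (τ * ρ').SameCycle x y → ((τ * ρ').SameCycle x z ↔ (τ * ρ').SameCycle y z) :=
    fun x y z h => ⟨h.symm.trans, h.trans⟩
  have htr' : ∀ x y z, (τ * ρ').SameCycle y z → ((τ * ρ').SameCycle x z ↔ (τ * ρ').SameCycle x y) :=
    fun x y z h => ⟨fun h' => h'.trans h.symm, fun h' => h'.trans h⟩
  unfold relabel
  clear hρ ht
  constructor
  all_goals generalize τ * ρ' = ψ at *
  · intro y
    rw [hτ.inv, h.flip]
    have h₁ := hd q y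
    have h₂ := hd p y
    split_ifs <;> first | rfl | (exfalso; tauto)
  · intro y z
    have hAy := hA y
    have hBy := hB y
    have hAz := hA z
    have hBz := hB z
    constructor
    · intro e
      by_cases c₁ : ψ.SameCycle q y
      · rw [← htr _ _ _ c₁]
        rw [if_pos c₁] at e
        split_ifs at e with d₁ d₂ d₃ d₄
        · exact d₁
        all_goals exfalso; first | exact absurd (congrArg Prod.fst e) hAB | skip
        · simp at e
        · exact hAz (congrArg Prod.fst e).symm
      by_cases c₂ : ψ.SameCycle q (τ y)
      · rw [← hs, ← htr _ _ _ c₂]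
        rw [if_neg c₁, if_pos c₂] at e
        split_ifs at e with d₁ d₂ d₃ d₄
        · simp at e
        · exact d₂
        all_goals exfalso; first | exact absurd (congrArg Prod.fst e) hAB | skip
        · exact hAz (congrArg Prod.fst e).symm
      by_cases c₃ : ψ.SameCycle p y
      · rw [← htr _ _ _ c₃]
        rw [if_neg c₁, if_neg c₂, if_pos c₃] at e
        split_ifs at e with d₁ d₂ d₃ d₄
        · exact absurd (congrArg Prod.fst e).symm hAB
        · exact absurd (congrArg Prod.fst e).symm hAB
        · exact d₃
        · simp at e
        · exact absurd (congrArg Prod.fst e).symm hBz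
      by_cases c₄ : ψ.SameCycle p (τ y)
      · rw [← hs, ← htr _ _ _ c₄]
        rw [if_neg c₁, if_neg c₂, if_neg c₃, if_pos c₄] at e
        split_ifs at e with d₁ d₂ d₃ d₄
        · exact absurd (congrArg Prod.fst e).symm hAB
        · exact absurd (congrArg Prod.fst e).symm hAB
        · simp at e
        · exact d₄
        · exact absurd (congrArg Prod.fst e).symm hBz
      rw [if_neg c₁, if_neg c₂, if_neg c₃, if_neg c₄] at e
      split_ifs at e with d₁ d₂ d₃ d₄
      · exact absurd (congrArg Prod.fst e) hAy
      · exact absurd (congrArg Prod.fst e) hAy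
      · exact absurd (congrArg Prod.fst e) hBy
      · exact absurd (congrArg Prod.fst e) hBy
      · exact (hc y z (by tauto)).1 e
    · intro e
      have e' := (hs y z).2 e
      rw [htr' _ _ _ e, htr' _ _ _ e', htr' _ _ _ e, htr' _ _ _ e']
      split_ifs with c₁ c₂ c₃ c₄ <;> try rfl
      exact (hc y z (by tauto)).2 e

theorem relabel_eq_main {τ ψ : Perm X} {nm : X → α × Bool} {p q : X} {A B : α} (hAB : A ≠ B)
    (hA : ∀ y, (nm y).1 ≠ A) (y : X) :
    relabel τ ψ A B p q nm y = (A, true) ↔ ψ.SameCycle q y := by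
  unfold relabel
  split_ifs with h₁ h₂ h₃ h₄
  · simp [h₁]
  · simp [h₁]
  · simp [h₁, hAB.symm]
  · simp [h₁, hAB.symm]
  · simp only [h₁, iff_false]
    exact fun e => hA y (congrArg Prod.fst e)

variable [DecidableEq X]

theorem conj_swap_of_ne {ρ : Perm X} {p q y : X} (h₁ : y ≠ p) (h₂ : y ≠ q) (h₃ : ρ y ≠ p)
    (h₄ : ρ y ≠ q) : (swap p q * ρ * (swap p q)⁻¹) y = ρ y := by
  simp [swap_apply_of_ne_of_ne, *]

theorem conj_swap_right {ρ : Perm X} (hρ : IsFpf ρ) {p q : X} (h : ρ p ≠ q) :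
    (swap p q * ρ * (swap p q)⁻¹) q = ρ p := by
  simp [swap_apply_of_ne_of_ne (hρ.ne p) h]

theorem conj_swap_left {ρ : Perm X} (hρ : IsFpf ρ) {p q : X} (h : ρ q ≠ p) :
    (swap p q * ρ * (swap p q)⁻¹) p = ρ q := by
  simp [swap_apply_of_ne_of_ne h (hρ.ne q)]

section Step

variable [Finite X] {τ ρ : Perm X} {nm : X → α × Bool} {p q : X}

local notation "φ" => τ * ρ
local notation "ψ" => τ * (swap p q * ρ * (swap p q)⁻¹)

omit [Finite X] in
theorem touched_apply (hτ : IsFpf τ) (hρ : IsFpf ρ) (y : X) :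
    ((ψ).SameCycle q (ψ y) ∨ (ψ).SameCycle q (τ (ψ y)) ∨ (ψ).SameCycle p (ψ y) ∨
      (ψ).SameCycle p (τ (ψ y))) ↔
    ((ψ).SameCycle q y ∨ (ψ).SameCycle q (τ y) ∨ (ψ).SameCycle p y ∨ (ψ).SameCycle p (τ y)) := by
  have hρ' := hρ.conj (swap p q)
  simp only [← sameCycle_flip' hτ hρ', Perm.sameCycle_apply_right]

omit [Finite X] in
-- The conjugated involution differs from ρ at most at p, q, ρp and ρq. The last two are touched as
-- well: the new permutation sends q to τρp and p to τρq.
theorem step_eq_of_not_touched (hρ : IsFpf ρ) {y : X}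
    (hy : ¬ ((ψ).SameCycle q y ∨ (ψ).SameCycle q (τ y) ∨ (ψ).SameCycle p y ∨
      (ψ).SameCycle p (τ y))) : (φ) y = (ψ) y := by
  have h₁ : y ≠ p := by rintro rfl; exact hy (Or.inr (Or.inr (Or.inl (Perm.SameCycle.refl _ _))))
  have h₂ : y ≠ q := by rintro rfl; exact hy (Or.inl (Perm.SameCycle.refl _ _))
  have h₃ : ρ y ≠ p := by
    rintro rfl
    refine hy (Or.inr (Or.inl ⟨1, ?_⟩))
    rw [zpow_one, Perm.mul_apply, conj_swap_right hρ (by rwa [hρ.inv]), hρ.inv]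
  have h₄ : ρ y ≠ q := by
    rintro rfl
    refine hy (Or.inr (Or.inr (Or.inr ⟨1, ?_⟩)))
    rw [zpow_one, Perm.mul_apply, conj_swap_left hρ (by rwa [hρ.inv]), hρ.inv]
  rw [Perm.mul_apply, Perm.mul_apply, conj_swap_of_ne h₁ h₂ h₃ h₄]

/-- The points on the components of p and q are preserved by the swap, by ρ and by τ, hence by the
new permutation. Conversely an untouched point has the same cycle before and after, so sharing a
component with p or q would make it touched. -/
theorem touched_iff (h : IsNaming τ ρ nm) (hτ : IsFpf τ) (hρ : IsFpf ρ) (y : X) :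
    ((ψ).SameCycle q y ∨ (ψ).SameCycle q (τ y) ∨ (ψ).SameCycle p y ∨ (ψ).SameCycle p (τ y)) ↔
      ((nm y).1 = (nm p).1 ∨ (nm y).1 = (nm q).1) := by
  have hρ' := hρ.conj (swap p q)
  constructor
  · have hs : ∀ z, ((nm (swap p q z)).1 = (nm p).1 ∨ (nm (swap p q z)).1 = (nm q).1) ↔
        ((nm z).1 = (nm p).1 ∨ (nm z).1 = (nm q).1) := by
      intro z
      rw [swap_apply_def]
      split_ifs with h₁ h₂
      · simp [h₁]
      · simp [h₂]
      · rfl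
    have hψ : ∀ z, ((nm ((ψ) z)).1 = (nm p).1 ∨ (nm ((ψ) z)).1 = (nm q).1) ↔
        ((nm z).1 = (nm p).1 ∨ (nm z).1 = (nm q).1) := by
      intro z
      rw [Perm.mul_apply, h.flip, Perm.mul_apply, Perm.mul_apply, hs, h.flip_rho hρ, swap_inv,
        hs]
    have key := fun {x z : X} => sameCycle_induction
      (P := fun z => (nm z).1 = (nm p).1 ∨ (nm z).1 = (nm q).1) (y := x) (z := z) hψ
    rintro (h' | h' | h' | h')
    · exact (key h').1 (Or.inr rfl)
    · simpa [h.flip] using (key h').1 (Or.inr rfl)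
    · exact (key h').1 (Or.inl rfl)
    · simpa [h.flip] using (key h').1 (Or.inl rfl)
  · intro hy
    by_contra hn
    have hc := fun z => sameCycle_congr (f := φ) (f' := ψ)
      (P := fun y => ¬ ((ψ).SameCycle q y ∨ (ψ).SameCycle q (τ y) ∨ (ψ).SameCycle p y ∨
        (ψ).SameCycle p (τ y))) (fun y => not_congr (touched_apply hτ hρ y))
      (fun y => step_eq_of_not_touched hρ) hn (z := z)
    rw [h.name_eq_iff, h.name_eq_iff, ← hc, ← hc, ← hc, ← hc] at hy
    refine hn ?_
    rcases hy with (hy | hy) | (hy | hy)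
    · exact Or.inr (Or.inr (Or.inl hy.symm))
    · exact Or.inr (Or.inr (Or.inr ((sameCycle_flip' hτ hρ').1 hy.symm)))
    · exact Or.inl hy.symm
    · exact Or.inr (Or.inl ((sameCycle_flip' hτ hρ').1 hy.symm))

theorem relabel_of_not_touched (h : IsNaming τ ρ nm) (hτ : IsFpf τ) (hρ : IsFpf ρ) {A B : α}
    {y : X} (hp : (nm y).1 ≠ (nm p).1) (hq : (nm y).1 ≠ (nm q).1) :
    relabel τ (ψ) A B p q nm y = nm y := by
  have := (touched_iff h hτ hρ (p := p) (q := q) y).not.2 (by tauto)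
  unfold relabel
  rw [if_neg (by tauto), if_neg (by tauto), if_neg (by tauto), if_neg (by tauto)]

theorem relabel_of_touched (h : IsNaming τ ρ nm) (hτ : IsFpf τ) (hρ : IsFpf ρ) {A B : α}
    {y : X} (hy : (nm y).1 = (nm p).1 ∨ (nm y).1 = (nm q).1) :
    (relabel τ (ψ) A B p q nm y).1 = A ∨ (relabel τ (ψ) A B p q nm y).1 = B := by
  have := (touched_iff h hτ hρ (p := p) (q := q) y).2 hy
  unfold relabel
  split_ifs <;> simp_all

theorem relabel_isNaming (h : IsNaming τ ρ nm) (hτ : IsFpf τ) (hρ : IsFpf ρ) {A B : α}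
    (hAB : A ≠ B) (hA : ∀ y, (nm y).1 ≠ A) (hB : ∀ y, (nm y).1 ≠ B) :
    IsNaming τ (swap p q * ρ * (swap p q)⁻¹) (relabel τ (ψ) A B p q nm) :=
  relabel_isNaming_of_congr h hτ (hρ.conj _) hAB hA hB (touched_apply hτ hρ)
    (fun _ => step_eq_of_not_touched hρ)

end Step

end Strands
end RefinedHurwitz

/-! ### The lengths of the strands after a cut, a join or a twist -/

namespace RefinedHurwitz

section Strands

open Equiv

variable {X α : Type*}

theorem mem_cycle_of_period {f : Perm X} {y z : X} {m : ℕ} (hm : 0 < m) (h : (f ^ m) y = y)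
    (hz : f.SameCycle y z) : ∃ i < m, (f ^ i) y = z := by
  have := (sameCycle_induction (P := fun z => ∃ i < m, (f ^ i) y = z) (fun z => ?_) hz).1
    ⟨0, hm, rfl⟩
  · exact this
  · constructor
    · rintro ⟨i, hi, e⟩
      rcases i with _ | i
      · refine ⟨m - 1, by omega, f.injective ?_⟩
        rw [← e, ← Perm.mul_apply, ← pow_succ', Nat.sub_add_cancel hm, h]; simp
      · refine ⟨i, by omega, f.injective ?_⟩
        rw [← e, ← Perm.mul_apply, ← pow_succ']
    · rintro ⟨i, hi, rfl⟩
      rcases Nat.lt_or_ge (i + 1) m with h' | h'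
      · exact ⟨i + 1, h', by rw [pow_succ', Perm.mul_apply]⟩
      · refine ⟨0, hm, ?_⟩
        obtain rfl : i + 1 = m := by omega
        rw [← Perm.mul_apply, ← pow_succ', h]; simp

theorem pow_ne_of_lt {f : Perm X} {y : X} {m : ℕ}
    (h' : ∀ j, 0 < j → j < m → (f ^ j) y ≠ y) {i j : ℕ} (hij : i < j) (hj : j < m) :
    (f ^ i) y ≠ (f ^ j) y := by
  intro e
  refine h' (j - i) (by omega) (by omega) ((f ^ i).injective ?_)
  rw [e, ← Perm.mul_apply, ← pow_add, Nat.add_sub_cancel' hij.le]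

theorem ncard_cycle_of_period {f : Perm X} {y : X} {m : ℕ} (hm : 0 < m) (h : (f ^ m) y = y)
    (h' : ∀ j, 0 < j → j < m → (f ^ j) y ≠ y) : Set.ncard {z | f.SameCycle y z} = m := by
  classical
  have : {z | f.SameCycle y z} = ((Finset.range m).image fun j => (f ^ j) y : Finset X) := by
    ext z
    simp only [Set.mem_ofPred_eq, Finset.coe_image, Finset.coe_range, Set.mem_image, Set.mem_Iio]
    constructor
    · exact fun hz => mem_cycle_of_period hm h hz
    · rintro ⟨i, _, rfl⟩; exact ⟨i, by simp⟩
  rw [this, Set.ncard_coe_finset, Finset.card_image_of_injOn, Finset.card_range]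
  intro i hi j hj e
  simp only [Finset.coe_range, Set.mem_Iio] at hi hj
  rcases lt_trichotomy i j with hij | hij | hij
  · exact absurd e (pow_ne_of_lt h' hij hj)
  · exact hij
  · exact absurd e.symm (pow_ne_of_lt h' hij hi)

/-- The number of elements of a cycle is its minimal period. -/
theorem cycle_period [Finite X] (f : Perm X) (y : X) :
    0 < Set.ncard {z | f.SameCycle y z} ∧ (f ^ Set.ncard {z | f.SameCycle y z}) y = y ∧
      ∀ j, 0 < j → j < Set.ncard {z | f.SameCycle y z} → (f ^ j) y ≠ y := by
  classical
  have hex : ∃ m, 0 < m ∧ (f ^ m) y = y := ⟨orderOf f, orderOf_pos f, by rw [pow_orderOf_eq_one]; rfl⟩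
  have h := Nat.find_spec hex
  have h' : ∀ j, 0 < j → j < Nat.find hex → (f ^ j) y ≠ y :=
    fun j hj hlt e => Nat.find_min hex hlt ⟨hj, e⟩
  rw [ncard_cycle_of_period h.1 h.2 h']
  exact ⟨h.1, h.2, h'⟩

section Step

variable [DecidableEq X] [Finite X] {τ ρ : Perm X} {nm : X → α × Bool} {p q : X}

local notation "φ" => τ * ρ
local notation "ψ" => τ * (swap p q * ρ * (swap p q)⁻¹)

omit [DecidableEq X] [Finite X] in
theorem nm_pow (h : IsNaming τ ρ nm) (y : X) (i : ℕ) : nm (((φ) ^ i) y) = nm y :=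
  ((h.cyc _ _).2 ⟨i, by simp⟩).symm

/-- Cutting a strand. -/
theorem ncard_cut (h : IsNaming τ ρ nm) (hρ : IsFpf ρ) {i : ℕ} (hi : 0 < i)
    (hi' : i < Set.ncard {z | nm z = nm q}) (hp : p = ((φ) ^ i) q) :
    Set.ncard {z | (ψ).SameCycle q z} = Set.ncard {z | nm z = nm q} - i := by
  have hset : {z | nm z = nm q} = {z | (φ).SameCycle q z} := by
    ext z
    rw [Set.mem_ofPred_eq, eq_comm, h.cyc]; rfl
  rw [hset] at hi' ⊢
  obtain ⟨hω, hper, hmin⟩ := cycle_period (φ) q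
  set ω := Set.ncard {z | (φ).SameCycle q z}
  have hnp : nm p = nm q := by rw [hp, nm_pow h]
  -- The new permutation jumps from q to the successor of p on the old cycle and then follows that
  -- cycle until it returns to q. The i points from the successor of q up to p are skipped.
  have hstep : ∀ j, 1 ≤ j → j ≤ ω - i → ((ψ) ^ j) q = ((φ) ^ (i + j)) q := by
    intro j hj
    induction j, hj using Nat.le_induction with
    | base =>
      intro _
      rw [pow_one, Perm.mul_apply, conj_swap_right hρ, hp, add_comm, pow_add, pow_one]
      · rfl
      · intro e
        have := h.flip_rho hρ p
        rw [e, hnp] at this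
        simpa using congrArg Prod.snd this
    | succ j hj ih =>
      intro hj'
      rw [pow_succ', Perm.mul_apply, ih (by omega), Perm.mul_apply, conj_swap_of_ne, ← add_assoc,
        add_comm _ 1, pow_add (φ) 1, pow_one]
      · rfl
      · rw [hp]
        exact (pow_ne_of_lt hmin (by omega) (by omega)).symm
      · exact hmin _ (by omega) (by omega)
      · intro e
        have := h.flip_rho hρ (((φ) ^ (i + j)) q)
        rw [e, hnp, nm_pow h] at this
        simpa using congrArg Prod.snd this
      · intro e
        have := h.flip_rho hρ (((φ) ^ (i + j)) q)
        rw [e, nm_pow h] at this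
        simpa using congrArg Prod.snd this
  refine ncard_cycle_of_period (by omega) ?_ ?_
  · rw [hstep _ (by omega) le_rfl, Nat.add_sub_cancel' hi'.le, hper]
  · intro j hj hj'
    rw [hstep j hj (by omega)]
    exact hmin _ (by omega) (by omega)

/-- Joining two strands. -/
theorem sameCycle_join (h : IsNaming τ ρ nm) (hρ : IsFpf ρ) (hpq : (nm p).1 ≠ (nm q).1) :
    (ψ).SameCycle q p := by
  obtain ⟨hω, hper, hmin⟩ := cycle_period (φ) p
  set ω := Set.ncard {z | (φ).SameCycle p z}
  -- From q the new permutation runs through the old cycle of p, and reaches p itself after one full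
  -- turn.
  have hstep : ∀ j, 1 ≤ j → j ≤ ω → ((ψ) ^ j) q = ((φ) ^ j) p := by
    intro j hj
    induction j, hj using Nat.le_induction with
    | base =>
      intro _
      rw [pow_one, Perm.mul_apply, conj_swap_right hρ, pow_one]
      · rfl
      · intro e
        have := h.flip_rho hρ p
        rw [e] at this
        exact hpq (congrArg Prod.fst this).symm
    | succ j hj ih =>
      intro hj'
      have h₁ : nm (((φ) ^ j) p) = nm p := nm_pow h p j
      rw [pow_succ', Perm.mul_apply, ih (by omega), Perm.mul_apply, conj_swap_of_ne, pow_succ' (φ)]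
      · rfl
      · exact hmin _ (by omega) (by omega)
      · intro e
        rw [e] at h₁
        exact hpq (congrArg Prod.fst h₁).symm
      · intro e
        have := h.flip_rho hρ (((φ) ^ j) p)
        rw [e, h₁] at this
        simpa using congrArg Prod.snd this
      · intro e
        have := h.flip_rho hρ (((φ) ^ j) p)
        rw [e, h₁] at this
        exact hpq (congrArg Prod.fst this).symm
  refine ⟨ω, ?_⟩
  rw [zpow_natCast, hstep ω hω le_rfl, hper]

/-- Twisting a strand. -/
theorem sameCycle_twist (h : IsNaming τ ρ nm) (hτ : IsFpf τ) (hρ : IsFpf ρ) (hpq : p ≠ τ q)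
    (hnm : nm p = ((nm q).1, !(nm q).2)) : (ψ).SameCycle q (τ p) := by
  have hρ' := hρ.conj (swap p q)
  rw [← sameCycle_flip' hτ hρ']
  obtain ⟨hω, hper, hmin⟩ := cycle_period (φ) q
  have hsc : (φ).SameCycle q (τ p) := by
    rw [← h.cyc, h.flip, hnm]; simp
  obtain ⟨i, hi, hip⟩ := mem_cycle_of_period hω hper hsc
  have hi0 : i ≠ 0 := by
    rintro rfl
    refine hpq ?_
    rw [pow_zero, Perm.one_apply] at hip
    rw [hip, hτ.inv]
  set ω := Set.ncard {z | (φ).SameCycle q z}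
  have hpτ : p = τ (((φ) ^ i) q) := by rw [hip, hτ.inv]
  have hnq : nm p ≠ nm q := by
    rw [hnm]; intro e; simpa using congrArg Prod.snd e
  -- Here τp is i steps after q on the old strand. From p the new permutation follows this strand
  -- for i − 1 steps. At the i-th step ρ would lead to p, the swap replaces p by q, and τq is
  -- reached.
  have hstep : ∀ j, 1 ≤ j → j < i → ((ψ) ^ j) p = ((φ) ^ j) q := by
    intro j hj
    induction j, hj using Nat.le_induction with
    | base =>
      intro _
      rw [pow_one, Perm.mul_apply, conj_swap_left hρ, pow_one]
      · rfl
      · intro e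
        refine pow_ne_of_lt hmin (i := 1) (j := i) (by omega) hi ?_
        rw [hip, pow_one, Perm.mul_apply, e]
    | succ j hj ih =>
      intro hj'
      have h₁ : nm (((φ) ^ j) q) = nm q := nm_pow h q j
      rw [pow_succ', Perm.mul_apply, ih (by omega), Perm.mul_apply, conj_swap_of_ne, pow_succ' (φ)]
      · rfl
      · intro e
        rw [e] at h₁; exact hnq h₁
      · exact hmin _ (by omega) (by omega)
      · intro e
        refine pow_ne_of_lt hmin (i := j + 1) (j := i) (by omega) hi ?_
        rw [hip, pow_succ', Perm.mul_apply, Perm.mul_apply, e]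
      · intro e
        have := h.flip_rho hρ (((φ) ^ j) q)
        rw [e, h₁] at this
        simpa using congrArg Prod.snd this
  refine ((?_ : (ψ).SameCycle p (τ q))).symm
  rcases Nat.lt_or_ge 1 i with h1 | h1
  · refine ⟨i, ?_⟩
    obtain ⟨j, rfl⟩ : ∃ j, i = j + 1 := ⟨i - 1, by omega⟩
    have e : ρ (((φ) ^ j) q) = p := by
      rw [hpτ, pow_succ', Perm.mul_apply, Perm.mul_apply, hτ.inv]
    rw [zpow_natCast, pow_succ', Perm.mul_apply, hstep j (by omega) (by omega)]
    have h₁ : nm (((φ) ^ j) q) = nm q := nm_pow h q j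
    have h₂ : ((φ) ^ j) q ≠ p := fun e' => hnq (by rw [← h₁, e'])
    have h₃ : ((φ) ^ j) q ≠ q := hmin _ (by omega) (by omega)
    simp [swap_apply_of_ne_of_ne h₂ h₃, e]
  · obtain rfl : i = 1 := by omega
    have e : ρ q = p := by
      rw [hpτ, pow_one, Perm.mul_apply, hτ.inv]
    exact ⟨1, by simp [e]⟩

variable {A B : α}

/-- The number of points is preserved. -/
theorem ncard_relabel (h : IsNaming τ ρ nm) (hτ : IsFpf τ) (hρ : IsFpf ρ)
    (hAB : A ≠ B) (hA : ∀ y, (nm y).1 ≠ A) (hB : ∀ y, (nm y).1 ≠ B) :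
    Set.ncard {y | relabel τ (ψ) A B p q nm y = (A, true)} +
      Set.ncard {y | relabel τ (ψ) A B p q nm y = (B, true)} =
    Set.ncard {y | nm y = ((nm q).1, true)} +
      open scoped Classical in
      if (nm p).1 = (nm q).1 then 0 else Set.ncard {y | nm y = ((nm p).1, true)} := by
  have h' := relabel_isNaming h hτ hρ hAB hA hB (p := p) (q := q)
  -- Only the components of p and q are redistributed. Each component has twice as many points as
  -- either of its strands, so the factor 2 cancels at the end.
  have hset : {y | (relabel τ (ψ) A B p q nm y).1 = A} ∪ {y | (relabel τ (ψ) A B p q nm y).1 = B} =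
      {y | (nm y).1 = (nm q).1} ∪ {y | (nm y).1 = (nm p).1} := by
    ext y
    simp only [Set.mem_union, Set.mem_ofPred_eq]
    by_cases hy : (nm y).1 = (nm p).1 ∨ (nm y).1 = (nm q).1
    · have := relabel_of_touched h hτ hρ hy (A := A) (B := B)
      tauto
    · push Not at hy
      rw [relabel_of_not_touched h hτ hρ hy.1 hy.2]
      have := hA y
      have := hB y
      tauto
  have hc := congrArg Set.ncard hset
  rw [Set.ncard_union_eq (by rw [Set.disjoint_left]; intro y (h₁ : _ = _) (h₂ : _ = _); exact hAB (h₁ ▸ h₂))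
    (Set.toFinite _) (Set.toFinite _), h'.ncard_name hτ, h'.ncard_name hτ] at hc
  split_ifs with hpq
  · rw [hpq, Set.union_self, h.ncard_name hτ] at hc
    omega
  · rw [Set.ncard_union_eq (by rw [Set.disjoint_left]; intro y (h₁ : _ = _) (h₂ : _ = _); exact hpq (h₂ ▸ h₁))
      (Set.toFinite _) (Set.toFinite _), h.ncard_name hτ, h.ncard_name hτ] at hc
    omega

/-- There is no second strand unless `p` and `q` lie on the same strand. -/
theorem relabel_ne_side (h : IsNaming τ ρ nm) (hτ : IsFpf τ) (hρ : IsFpf ρ)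
    (hAB : A ≠ B) (hB : ∀ y, (nm y).1 ≠ B) (hpq : p ≠ τ q) (hnm : nm p ≠ nm q) (y : X) :
    (relabel τ (ψ) A B p q nm y).1 ≠ B := by
  have hρ' := hρ.conj (swap p q)
  -- The first case is the twist and the second the join. In both, p or its mirror point lies on the
  -- new strand of q, so nothing is left over for the name B.
  have key : (ψ).SameCycle q p ∨ (ψ).SameCycle q (τ p) := by
    by_cases hn : (nm p).1 = (nm q).1
    · refine Or.inr (sameCycle_twist h hτ hρ hpq (Prod.ext hn ?_))
      have : (nm p).2 ≠ (nm q).2 := fun e => hnm (Prod.ext hn e)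
      simpa using Bool.eq_not_of_ne this
    · exact Or.inl (sameCycle_join h hρ hn)
  have key' : ∀ z, (ψ).SameCycle p z → (ψ).SameCycle q z ∨ (ψ).SameCycle q (τ z) := by
    intro z hz
    rcases key with k | k
    · exact Or.inl (k.trans hz)
    · exact Or.inr (k.trans ((sameCycle_flip hτ hρ').2 hz))
  have h₁ := key' y
  have h₂ := key' (τ y)
  rw [hτ.inv] at h₂
  unfold relabel
  split_ifs
  · exact hAB
  · exact hAB
  · tauto
  · tauto
  · exact hB y

end Step
end Strands
end RefinedHurwitz

namespace RefinedHurwitz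

/-! ### Positions in a composition -/

section Blocks

variable {d : ℕ} (n : Composition d)

/-- The position of `z` in its block, counted from `0`. -/
def offset (z : Fin d) : ℕ := n.invEmbedding z

theorem index_offset (z : Fin d) : (z : ℕ) = n.sizeUpTo (n.index z) + offset n z := by
  rw [offset, n.coe_invEmbedding, Nat.add_sub_cancel' (n.sizeUpTo_index_le z)]

theorem index_mono : Monotone n.index := by
  intro y z hyz
  by_contra hlt
  push Not at hlt
  have h₁ := n.lt_sizeUpTo_index_succ z
  have h₂ := n.sizeUpTo_index_le y
  have h₃ : n.sizeUpTo (n.index z).succ ≤ n.sizeUpTo (n.index y) := n.monotone_sizeUpTo hlt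
  have h₄ : (y : ℕ) ≤ z := hyz
  omega

theorem offset_lt (z : Fin d) : offset n z < n.blocksFun (n.index z) :=
  (n.invEmbedding z).2

theorem le_iff_offset_le {y z : Fin d} (h : n.index y = n.index z) :
    y ≤ z ↔ offset n y ≤ offset n z := by
  have h₁ := index_offset n y
  have h₂ := index_offset n z
  rw [h] at h₁
  rw [Fin.le_def]
  omega

theorem eq_of_index_offset {y z : Fin d} (h : n.index y = n.index z)
    (h' : offset n y = offset n z) : y = z := by
  have h₁ := index_offset n y
  have h₂ := index_offset n z
  rw [h] at h₁
  exact Fin.ext (by omega)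

theorem index_between {x y z : Fin d} (h : n.index x = n.index z) (hxy : x ≤ y) (hyz : y ≤ z) :
    n.index y = n.index z :=
  le_antisymm (index_mono n hyz) (h ▸ index_mono n hxy)

theorem ncard_block_from (q : Fin d) : Set.ncard {z : Fin d | q ≤ z ∧ n.index z = n.index q} +
    offset n q = n.blocksFun (n.index q) := by
  unfold offset
  have : {z : Fin d | q ≤ z ∧ n.index z = n.index q} =
      (n.embedding (n.index q)) '' (Finset.Ici (n.invEmbedding q) : Finset _) := by
    ext z
    simp only [Set.mem_ofPred_eq, Finset.coe_Ici, Set.mem_image, Set.mem_Ici]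
    constructor
    · rintro ⟨h₁, h₂⟩
      have hz := n.mem_range_embedding z
      rw [h₂] at hz
      obtain ⟨j, rfl⟩ := hz
      refine ⟨j, ?_, rfl⟩
      exact (n.embedding _).le_iff_le.1 ((n.embedding_comp_inv q).trans_le h₁)
    · rintro ⟨j, hj, rfl⟩
      exact ⟨(n.embedding_comp_inv q).symm.trans_le ((n.embedding _).le_iff_le.2 hj),
        n.index_embedding _ _⟩
  rw [this, Set.ncard_image_of_injective _ (n.embedding _).injective, Set.ncard_coe_finset,
    Fin.card_Ici]
  omega

theorem ncard_block (i : Fin n.length) : Set.ncard {z : Fin d | n.index z = i} = n.blocksFun i := by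
  have : {z : Fin d | n.index z = i} = Set.range (n.embedding i) := by
    ext z
    rw [n.mem_range_embedding_iff', Set.mem_ofPred_eq, eq_comm]
  rw [this, ← Set.image_univ, Set.ncard_image_of_injective _ (n.embedding i).injective,
    Set.ncard_univ, Nat.card_eq_fintype_card, Fintype.card_fin]

theorem blockRot_apply (z : Fin d) :
    blockRot n z = n.embedding (n.index z) (finRotate _ (n.invEmbedding z)) := rfl

theorem index_blockRot (z : Fin d) : n.index (blockRot n z) = n.index z := by
  rw [blockRot_apply, n.index_embedding]

theorem index_blockRot_symm (z : Fin d) : n.index ((blockRot n).symm z) = n.index z := by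
  rw [← index_blockRot, Equiv.apply_symm_apply]

theorem finRotate_of_succ_lt {N : ℕ} (j : Fin N) (h : (j : ℕ) + 1 < N) :
    (finRotate N j : ℕ) = j + 1 := by
  cases N with
  | zero => exact j.elim0
  | succ N =>
    rw [coe_finRotate_of_ne_last]
    rintro rfl
    simp at h

theorem blockRot_of_succ {y z : Fin d} (hyz : (z : ℕ) = y + 1) (h : n.index y = n.index z) :
    blockRot n y = z := by
  have h₁ := index_offset n y
  have h₂ := index_offset n z
  rw [h] at h₁
  have h₃ := offset_lt n z
  rw [← h] at h₃
  have h₄ := finRotate_of_succ_lt (n.invEmbedding y) (by change offset n y + 1 < _; omega)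
  apply Fin.ext
  rw [blockRot_apply, n.coe_embedding, h₄]
  change _ + (offset n y + 1) = _
  rw [h]
  omega

end Blocks

/-! ### The involutions τ and ρ_n and their components -/

section Involutions

variable {d : ℕ}

theorem tau_apply (y : Pt d) : tau d y = (y.1, !y.2) := rfl

theorem isFpf_tau : IsFpf (tau d) where
  inv y := by simp [tau_apply]
  ne y e := Bool.not_ne_self y.2 (congrArg Prod.snd e)

theorem rhoOf_true (n : Composition d) (z : Fin d) : rhoOf n (z, true) = (blockRot n z, false) := rfl

theorem rhoOf_false (n : Composition d) (z : Fin d) :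
    rhoOf n (z, false) = ((blockRot n).symm z, true) := rfl

theorem isFpf_rhoOf (n : Composition d) : IsFpf (rhoOf n) where
  inv := (rhoOf n).left_inv
  ne := by
    rintro ⟨z, _ | _⟩ e
    · exact Bool.noConfusion (congrArg Prod.snd e)
    · exact Bool.noConfusion (congrArg Prod.snd e)

/-- On barred elements τρ_n rotates each block forwards, on unbarred ones backwards. Hence each
block is one component, and its unbarred elements form the strand `true`. -/
theorem isNaming_rhoOf {α : Type*} (n : Composition d) {f : Fin n.length → α}
    (hf : Function.Injective f) :
    IsNaming (tau d) (rhoOf n) fun y => (f (n.index y.1), !y.2) where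
  flip y := rfl
  cyc := by
    have hsc : ∀ y : Fin d, (tau d * rhoOf n).SameCycle (y, true) (blockRot n y, true) :=
      fun y => ⟨1, rfl⟩
    have hsc' : ∀ y : Fin d, (tau d * rhoOf n).SameCycle (y, false) (blockRot n y, false) := by
      intro y
      refine Equiv.Perm.SameCycle.symm ⟨1, ?_⟩
      rw [zpow_one, Equiv.Perm.mul_apply, rhoOf_false, Equiv.symm_apply_apply]
      rfl
    have hsb : ∀ (b : Bool) (y z : Fin d), (z : ℕ) = y + 1 → n.index y = n.index z →
        (tau d * rhoOf n).SameCycle (y, b) (z, b) := by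
      intro b y z hyz h
      rw [← blockRot_of_succ n hyz h]
      cases b
      · exact hsc' y
      · exact hsc y
    have hle : ∀ (b : Bool) (N : ℕ) (y z : Fin d), (z : ℕ) = y + N → n.index y = n.index z →
        (tau d * rhoOf n).SameCycle (y, b) (z, b) := by
      intro b N
      induction N with
      | zero =>
        intro y z h _
        obtain rfl : z = y := Fin.ext h
        exact Equiv.Perm.SameCycle.refl _ _
      | succ N ih =>
        intro y z h hi
        have hy' : (y : ℕ) + N < d := by have := z.2; omega
        have hi' : n.index ⟨y + N, hy'⟩ = n.index z :=
          index_between n hi (Fin.le_def.2 (by simp)) (Fin.le_def.2 (by simp; omega))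
        exact (ih y ⟨y + N, hy'⟩ rfl (by rw [hi, hi'])).trans (hsb b _ _ (by simp; omega) hi')
    rintro ⟨y, b⟩ ⟨z, c⟩
    constructor
    · intro e
      obtain ⟨e₁, e₂⟩ := Prod.ext_iff.1 e
      replace e₁ := hf e₁
      have e₂ : b = c := by simpa using e₂
      subst e₂
      rcases le_total y z with h | h
      · exact hle b (z - y) y z (by have : (y : ℕ) ≤ z := h; omega) e₁
      · exact (hle b (y - z) z y (by have : (z : ℕ) ≤ y := h; omega) e₁.symm).symm
    · intro e
      refine ((sameCycle_induction (P := fun w => (f (n.index y), !b) =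
        (f (n.index w.1), !w.2)) ?_ e).1 rfl)
      rintro ⟨w, _ | _⟩
      · simp [rhoOf_false, tau_apply, index_blockRot_symm]
      · simp [rhoOf_true, tau_apply, index_blockRot]

/-- Both generators exchange the cycle of y with the cycle of τy, so the union of these two cycles
is the whole orbit. -/
theorem mem_component_iff {ρ : Equiv.Perm (Pt d)} (hρ : IsFpf ρ) (y z : Pt d) :
    z ∈ component ρ y ↔
      (tau d * ρ).SameCycle y z ∨ (tau d * ρ).SameCycle y (tau d z) := by
  constructor
  · rintro ⟨⟨g, hg⟩, rfl⟩
    change (tau d * ρ).SameCycle y (g y) ∨ (tau d * ρ).SameCycle y (tau d (g y))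
    induction hg using Subgroup.closure_induction_left with
    | one => exact Or.inl (Equiv.Perm.SameCycle.refl _ _)
    | mul_left s hs g hg ih =>
      have hτ : ∀ w, (tau d * ρ).SameCycle y (ρ w) ↔ (tau d * ρ).SameCycle y (tau d w) := by
        intro w
        rw [← Equiv.Perm.sameCycle_apply_right, Equiv.Perm.mul_apply, hρ.inv]
      have hτ' : ∀ w, (tau d * ρ).SameCycle y (tau d (ρ w)) ↔ (tau d * ρ).SameCycle y w := by
        intro w
        rw [← Equiv.Perm.mul_apply, Equiv.Perm.sameCycle_apply_right]
      rcases hs with rfl | rfl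
      · rw [Equiv.Perm.mul_apply, hτ, hτ']; tauto
      · rw [Equiv.Perm.mul_apply, isFpf_tau.inv]; tauto
    | inv_mul_cancel s hs g hg ih =>
      have hτ : ∀ w, (tau d * ρ).SameCycle y (ρ w) ↔ (tau d * ρ).SameCycle y (tau d w) := by
        intro w
        rw [← Equiv.Perm.sameCycle_apply_right, Equiv.Perm.mul_apply, hρ.inv]
      have hτ' : ∀ w, (tau d * ρ).SameCycle y (tau d (ρ w)) ↔ (tau d * ρ).SameCycle y w := by
        intro w
        rw [← Equiv.Perm.mul_apply, Equiv.Perm.sameCycle_apply_right]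
      rcases hs with rfl | rfl
      · rw [hρ.inv_eq, Equiv.Perm.mul_apply, hτ, hτ']; tauto
      · rw [isFpf_tau.inv_eq, Equiv.Perm.mul_apply, isFpf_tau.inv]; tauto
  · have hτm : tau d ∈ Subgroup.closure {ρ, tau d} := Subgroup.subset_closure (by simp)
    have hρm : ρ ∈ Subgroup.closure {ρ, tau d} := Subgroup.subset_closure (by simp)
    rintro (⟨i, hi⟩ | ⟨i, hi⟩)
    · exact ⟨⟨_, zpow_mem (mul_mem hτm hρm) i⟩, hi⟩
    · refine ⟨⟨_, mul_mem hτm (zpow_mem (mul_mem hτm hρm) i)⟩, ?_⟩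
      change tau d (((tau d * ρ) ^ i) y) = z
      rw [hi, isFpf_tau.inv]

theorem IsNaming.mem_component {α : Type*} {ρ : Equiv.Perm (Pt d)} {nm : Pt d → α × Bool}
    (h : IsNaming (tau d) ρ nm) (hρ : IsFpf ρ) (y z : Pt d) :
    z ∈ component ρ y ↔ (nm y).1 = (nm z).1 := by
  rw [mem_component_iff hρ, h.name_eq_iff]

theorem IsNaming.numParts_eq {α : Type*} {ρ : Equiv.Perm (Pt d)} {nm : Pt d → α × Bool}
    (h : IsNaming (tau d) ρ nm) (hρ : IsFpf ρ) :
    numParts ρ = Set.ncard (Set.range fun y => (nm y).1) := by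
  have hinj : Set.InjOn (fun a => {z | (nm z).1 = a}) (Set.range fun y => (nm y).1) := by
    rintro _ ⟨y, rfl⟩ a _ e
    have : y ∈ {z | (nm z).1 = a} := by
      rw [← show {z | (nm z).1 = (nm y).1} = {z | (nm z).1 = a} from e]; rfl
    exact this
  rw [numParts, ← hinj.ncard_image, ← Set.range_comp]
  congr 2
  ext y z
  rw [h.mem_component hρ, eq_comm]
  rfl

end Involutions

end RefinedHurwitz

namespace RefinedHurwitz

/-! ### Diagrams -/

section Diagrams

variable {d k : ℕ} {n m : Composition d}

/-- Names for the pairs of edges of a cover: in-ends, and the outputs of the vertices, where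
`(t, true)` is the non-normal output at the `t`-th branch point. -/
abbrev Name (n : Composition d) (k : ℕ) : Type := Fin n.length ⊕ (Fin k × Bool)

/-- The name of the edge that contains the last element of the `i`-th block after `t` steps,
provided that no later block has been touched. -/
def head (n : Composition d) (q : Fin k → Fin d) : ℕ → Fin n.length → Name n k
  | 0, i => Sum.inl i
  | t + 1, i => if h : t < k then
      if n.index (q ⟨t, h⟩) = i then Sum.inr (⟨t, h⟩, true) else Sum.inl i
    else Sum.inl i

/-- The combinatorial data of a monotone cover, or of a monotone string of transpositions: the
larger elements of the transpositions, the partners in the joins, the weights of the outputs, and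
the labels of the final edges. -/
@[ext]
structure Diagram (n m : Composition d) (k : ℕ) where
  q : Fin k → Fin d
  other : Fin k → Option (Name n k × Bool)
  ow : Fin k × Bool → ℕ
  lab : Name n k → Option (Fin m.length)

namespace Diagram

variable (D : Diagram n m k)

/-- The block, i.e. the chain, that is active at the `t`-th branch point. -/
def blk (t : Fin k) : Fin n.length := n.index (D.q t)

/-- The counter of the non-normal output; `offset` starts at 0 and counters start at 1. -/
def ctr (t : Fin k) : ℕ := offset n (D.q t) + 1

def wt : Name n k → ℕ := Sum.elim n.blocksFun D.ow

/-- The name of the bold edge that ends at the `t`-th branch point. -/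
def main (t : Fin k) : Name n k := head n D.q t (D.blk t)

def Uses (t : Fin k) (a : Name n k) : Prop := a = D.main t ∨ ∃ b, D.other t = some (a, b)

end Diagram

/-- Steps are numbered from 0, so the outputs of step s are present after s + 1 steps, whereas
in-ends are present from the start. -/
def Born (t : ℕ) : Name n k → Prop
  | Sum.inl _ => True
  | Sum.inr (s, _) => (s : ℕ) < t

namespace Diagram

variable (D : Diagram n m k)

/-- The edge named `a` is present after `t` steps. -/
def Live (t : ℕ) (a : Name n k) : Prop :=
  0 < D.wt a ∧ Born t a ∧ ∀ s : Fin k, (s : ℕ) < t → ¬ D.Uses s a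

/-- These are the names of the edges adjacent to a vertex over t. The positive weight discards the
second output where there is no cut. -/
def Touches (t : Fin k) (a : Name n k) : Prop :=
  D.Uses t a ∨ (∃ b, a = Sum.inr (t, b)) ∧ 0 < D.wt a

/-- The conditions are chosen to make sense for strings and for covers. `conserve` is harmonicity,
and `bound` is the lower bound in condition 6, which for strings expresses that the end of the block
from q on lies on the strand of q. The last clause of `other_live` is condition 4. Connectedness is
expressed by closed sets of names instead of paths, so that it can be applied directly to orbits or
to classes of edges. -/
structure Valid (r : Fin m.length) (c : ℕ) : Prop where
  mono : Monotone D.q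
  other_live : ∀ t a b, D.other t = some (a, b) →
    D.Live t a ∧ a ≠ D.main t ∧ ∀ i, a = Sum.inl i → i ≤ D.blk t
  conserve : ∀ t, D.ow (t, true) + D.ow (t, false) =
    D.wt (D.main t) + (D.other t).elim 0 fun f => D.wt f.1
  side : ∀ t, 0 < D.ow (t, false) → D.other t = none
  bound : ∀ t, n.blocksFun (D.blk t) < D.ow (t, true) + D.ctr t
  conn : ∀ S : Set (Name n k),
    (∀ t a a', D.Touches t a → D.Touches t a' → a ∈ S → a' ∈ S) →
    ∀ a a', 0 < D.wt a → 0 < D.wt a' → a ∈ S → a' ∈ S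
  lab_some : ∀ a, (D.lab a).isSome ↔ D.Live k a
  lab_inj : ∀ a a' j, D.lab a = some j → D.lab a' = some j → a = a'
  lab_surj : ∀ j, ∃ a, D.lab a = some j
  lab_wt : ∀ a j, D.lab a = some j → D.wt a = m.blocksFun j
  final : ∀ t : Fin k, (t : ℕ) + 1 = k → D.lab (Sum.inr (t, true)) = some r ∧ D.ctr t = c
  final_zero : k = 0 → c = 1 ∧ ∀ i, D.lab (Sum.inl i) = some r

end Diagram

theorem head_eq_inr {q : Fin k → Fin d} {t : ℕ} {i : Fin n.length} {s : Fin k} {b : Bool}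
    (h : head n q t i = Sum.inr (s, b)) : (s : ℕ) + 1 = t ∧ b = true ∧ n.index (q s) = i := by
  cases t with
  | zero => simp [head] at h
  | succ t =>
    rw [head] at h
    split_ifs at h with h₁ h₂
    simp only [Sum.inr.injEq, Prod.mk.injEq] at h
    obtain ⟨rfl, rfl⟩ := h
    exact ⟨rfl, rfl, h₂⟩

theorem head_eq_inl {q : Fin k → Fin d} {t : ℕ} {i j : Fin n.length}
    (h : head n q t i = Sum.inl j) : j = i := by
  cases t with
  | zero => simpa [head, eq_comm] using h
  | succ t =>
    rw [head] at h
    split_ifs at h with h₁ h₂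
    · simpa [eq_comm] using h
    · simpa [eq_comm] using h

theorem head_succ {q : Fin k → Fin d} (t : Fin k) (i : Fin n.length) :
    head n q (t + 1) i = if n.index (q t) = i then Sum.inr (t, true) else Sum.inl i := by
  rw [head, dif_pos t.2]

theorem head_of_ne {q : Fin k → Fin d} {t : ℕ} {i : Fin n.length}
    (h : ∀ s : Fin k, (s : ℕ) + 1 = t → n.index (q s) ≠ i) : head n q t i = Sum.inl i := by
  cases t with
  | zero => rfl
  | succ t =>
    rw [head]
    split_ifs with h₁ h₂
    · exact absurd h₂ (h _ rfl)
    · rfl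
    · rfl

theorem born_head (q : Fin k → Fin d) (t : ℕ) (i : Fin n.length) : Born t (head n q t i) := by
  rcases h : head n q t i with j | ⟨s, b⟩
  · trivial
  · have := (head_eq_inr h).1
    change (s : ℕ) < t
    omega

theorem Born.mono {t t' : ℕ} (h : t ≤ t') {a : Name n k} (ha : Born t a) : Born t' a := by
  rcases a with j | ⟨s, b⟩
  · trivial
  · exact lt_of_lt_of_le ha h

/-! ### The edges of the cover defined by a string of transpositions -/

theorem stage_succ {ρ : Equiv.Perm (Pt d)} (σ : Fin k → Step d) (t : Fin k) :
    stage ρ σ (t + 1) = Equiv.swap (σ t).1 ((σ t).2, false) * stage ρ σ t *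
      (Equiv.swap (σ t).1 ((σ t).2, false))⁻¹ := by
  rw [stage, dif_pos t.2]; rfl

open Sum in
/-- The name and the strand of each point after `t` steps. -/
noncomputable def naming (n : Composition d) (σ : Fin k → Step d) : ℕ → Pt d → Name n k × Bool
  | 0, y => (inl (n.index y.1), !y.2)
  | t + 1, y => if h : t < k then
      relabel (tau d) (tau d * stage (rhoOf n) σ (t + 1)) (inr (⟨t, h⟩, true))
        (inr (⟨t, h⟩, false)) (σ ⟨t, h⟩).1 ((σ ⟨t, h⟩).2, false) (naming n σ t) y
    else naming n σ t y

variable (σ : Fin k → Step d)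

theorem isFpf_stage (t : ℕ) : IsFpf (stage (rhoOf n) σ t) := by
  induction t with
  | zero => exact isFpf_rhoOf n
  | succ t ih =>
    rw [stage]
    split_ifs
    · exact ih.conj _
    · exact ih

theorem naming_succ (t : Fin k) (y : Pt d) : naming n σ (t + 1) y =
    relabel (tau d) (tau d * (Equiv.swap (σ t).1 ((σ t).2, false) * stage (rhoOf n) σ t *
      (Equiv.swap (σ t).1 ((σ t).2, false))⁻¹)) (Sum.inr (t, true))
      (Sum.inr (t, false)) (σ t).1 ((σ t).2, false) (naming n σ t) y := by
  rw [naming, dif_pos t.2, stage_succ]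

/-- The two claims need each other: the names given in step t are fresh because all names in use
were born earlier, and freshness is what makes `relabel` a naming. -/
theorem isNaming_and_born (t : ℕ) (ht : t ≤ k) :
    IsNaming (tau d) (stage (rhoOf n) σ t) (naming n σ t) ∧
      ∀ y, Born t (naming n σ t y).1 := by
  induction t with
  | zero => exact ⟨isNaming_rhoOf n Sum.inl_injective, fun y => trivial⟩
  | succ t ih =>
    obtain ⟨h₁, h₂⟩ := ih (by omega)
    have hne : ∀ b y, (naming n σ t y).1 ≠ Sum.inr (⟨t, ht⟩, b) := by
      intro b y e
      have := h₂ y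
      rw [e] at this
      exact lt_irrefl t this
    refine ⟨?_, ?_⟩
    · have := relabel_isNaming (p := (σ ⟨t, ht⟩).1) (q := ((σ ⟨t, ht⟩).2, false)) h₁ isFpf_tau
        (isFpf_stage σ t) (A := Sum.inr (⟨t, ht⟩, true)) (B := Sum.inr (⟨t, ht⟩, false))
        (by simp) (hne true) (hne false)
      rw [show t + 1 = ((⟨t, ht⟩ : Fin k) : ℕ) + 1 from rfl, stage_succ]
      convert this using 1
      funext y
      exact naming_succ σ ⟨t, ht⟩ y
    · intro y
      rw [show t + 1 = ((⟨t, ht⟩ : Fin k) : ℕ) + 1 from rfl, naming_succ]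
      by_cases hy : (naming n σ t y).1 = (naming n σ t (σ ⟨t, ht⟩).1).1 ∨
          (naming n σ t y).1 = (naming n σ t ((σ ⟨t, ht⟩).2, false)).1
      · rcases relabel_of_touched h₁ isFpf_tau (isFpf_stage σ t) hy
          (A := Sum.inr (⟨t, ht⟩, true)) (B := Sum.inr (⟨t, ht⟩, false)) with e | e <;> rw [e] <;>
          exact Nat.lt_succ_self t
      · push Not at hy
        rw [relabel_of_not_touched h₁ isFpf_tau (isFpf_stage σ t) hy.1 hy.2]
        exact (h₂ y).mono (Nat.le_succ t)

theorem isNaming_naming {t : ℕ} (ht : t ≤ k) :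
    IsNaming (tau d) (stage (rhoOf n) σ t) (naming n σ t) :=
  (isNaming_and_born σ t ht).1

theorem born_naming {t : ℕ} (ht : t ≤ k) (y : Pt d) : Born t (naming n σ t y).1 :=
  (isNaming_and_born σ t ht).2 y

theorem naming_ne (t : Fin k) (b : Bool) (y : Pt d) : (naming n σ t y).1 ≠ Sum.inr (t, b) := by
  intro e
  have := born_naming (n := n) σ t.2.le y
  rw [e] at this
  exact lt_irrefl _ this

/-- The points whose name changes in the `t`-th step. -/
def Moved (n : Composition d) (σ : Fin k → Step d) (t : Fin k) (y : Pt d) : Prop :=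
  (naming n σ t y).1 = (naming n σ t (σ t).1).1 ∨
    (naming n σ t y).1 = (naming n σ t ((σ t).2, false)).1

variable {σ}

theorem naming_succ_of_moved {t : Fin k} {y : Pt d} (h : Moved n σ t y) :
    ∃ b, (naming n σ (t + 1) y).1 = Sum.inr (t, b) := by
  rw [naming_succ]
  rcases relabel_of_touched (isNaming_naming σ t.2.le) isFpf_tau (isFpf_stage σ t) h
    (A := Sum.inr (t, true)) (B := Sum.inr (t, false)) with e | e
  · exact ⟨true, e⟩
  · exact ⟨false, e⟩

theorem naming_succ_of_not_moved {t : Fin k} {y : Pt d} (h : ¬ Moved n σ t y) :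
    naming n σ (t + 1) y = naming n σ t y := by
  rw [naming_succ]
  unfold Moved at h
  push Not at h
  exact relabel_of_not_touched (isNaming_naming σ t.2.le) isFpf_tau (isFpf_stage σ t) h.1 h.2

theorem not_moved_of_ne {t : Fin k} {y : Pt d}
    (h : ∀ b, (naming n σ (t + 1) y).1 ≠ Sum.inr (t, b)) : ¬ Moved n σ t y := by
  intro h'
  obtain ⟨b, e⟩ := naming_succ_of_moved h'
  exact h b e

theorem naming_succ_main (t : Fin k) (y : Pt d) :
    naming n σ (t + 1) y = (Sum.inr (t, true), true) ↔
      (tau d * stage (rhoOf n) σ (t + 1)).SameCycle ((σ t).2, false) y := by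
  rw [naming_succ, relabel_eq_main (by simp) (naming_ne σ t true), stage_succ]

/-- A point that is renamed gets a name born at that moment. So a point bearing an old name has
borne it, with the same strand, ever since. -/
theorem naming_of_le {a : Name n k} {s t : ℕ} (hst : s ≤ t) (ht : t ≤ k) (ha : Born s a) {y : Pt d}
    (h : (naming n σ t y).1 = a) : naming n σ t y = naming n σ s y := by
  induction t, hst using Nat.le_induction with
  | base => rfl
  | succ t hst ih =>
    have e := naming_succ_of_not_moved (t := ⟨t, ht⟩) (y := y) (n := n) (σ := σ) <| by
      refine not_moved_of_ne fun b e => ?_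
      change (naming n σ (t + 1) y).1 = _ at e
      rw [h] at e
      rw [e] at ha
      have : t < s := ha
      omega
    change naming n σ (t + 1) y = _ at e
    rw [e] at h ⊢
    exact ih (by omega) h

theorem index_of_naming {t : ℕ} (ht : t ≤ k) {y : Pt d} {i : Fin n.length}
    (h : (naming n σ t y).1 = Sum.inl i) : n.index y.1 = i := by
  have := naming_of_le (Nat.zero_le t) ht (a := Sum.inl i) trivial h
  rw [this] at h
  simpa [naming] using h

end Diagrams

end RefinedHurwitz

/-! ### The names of the points during a monotone string -/

namespace RefinedHurwitz

section Realizes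

variable {d k : ℕ} {n m : Composition d}

open scoped Classical in
/-- The name and the strand of the smaller element of the `t`-th transposition, if this
transposition is a join. -/
noncomputable def partner (n : Composition d) (σ : Fin k → Step d) (t : Fin k) :
    Option (Name n k × Bool) :=
  if (naming n σ t (σ t).1).1 = (naming n σ t ((σ t).2, false)).1 then none
  else some (naming n σ t (σ t).1)

/-- The `t`-th entries of the diagram `D` are those of the string `σ`. -/
structure Realizes (D : Diagram n m k) (σ : Fin k → Step d) (t : Fin k) : Prop where
  lt : (σ t).1.1 < (σ t).2
  q : D.q t = (σ t).2
  other : D.other t = partner n σ t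
  ow : ∀ b, D.ow (t, b) = Set.ncard {y | naming n σ (t + 1) y = (Sum.inr (t, b), true)}

variable {D : Diagram n m k} {σ : Fin k → Step d}

/-- So far every smaller element lies strictly below y and every larger element is unbarred and at
most y. Hence neither z nor the bar of y has been moved, and the initial value of ρ_n survives. -/
theorem stage_untouched {t : ℕ} (ht : t ≤ k) (hlt : ∀ s : Fin k, (s : ℕ) < t → (σ s).1.1 < (σ s).2)
    {y z : Fin d} (hyz : (z : ℕ) = y + 1) (hi : n.index y = n.index z)
    (hz : ∀ s : Fin k, (s : ℕ) < t → (σ s).2 ≤ y) :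
    stage (rhoOf n) σ t (z, false) = (y, true) := by
  induction t with
  | zero =>
    rw [stage, rhoOf_false, ← blockRot_of_succ n hyz hi, Equiv.symm_apply_apply]
  | succ t ih =>
    have ih := ih (by omega) (fun s hs => hlt s (by omega)) (fun s hs => hz s (by omega))
    rw [show t + 1 = ((⟨t, ht⟩ : Fin k) : ℕ) + 1 from rfl, stage_succ, conj_swap_of_ne, ih]
    all_goals
      have h₁ := Fin.lt_def.1 (hlt ⟨t, ht⟩ (Nat.lt_succ_self t))
      have h₂ := Fin.le_def.1 (hz ⟨t, ht⟩ (Nat.lt_succ_self t))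
      intro e
      try rw [ih] at e
    · have := congrArg (fun u => (u.1 : ℕ)) e
      simp only at this
      omega
    · have := congrArg (fun u => (u.1 : ℕ)) e
      simp only at this
      omega
    · have := congrArg (fun u => (u.1 : ℕ)) e
      simp only at this
      omega
    · exact Bool.noConfusion (congrArg Prod.snd e)

/-- This is where monotonicity enters. In the active block, τρ still walks down from z to the
current larger element, so both are on the strand `true` of the main output. A later block has not
been reached at all, because a point that still bears the name of an in-end belongs to the block of
that in-end (`index_of_naming`). -/
theorem naming_untouched {q : Fin k → Fin d} (hq : Monotone q) {t : ℕ} (ht : t ≤ k)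
    (hlt : ∀ s : Fin k, (s : ℕ) < t → (σ s).1.1 < (σ s).2)
    (hσ : ∀ s : Fin k, (s : ℕ) < t → q s = (σ s).2) {z : Fin d}
    (hz : ∀ s : Fin k, (s : ℕ) < t → q s ≤ z) :
    naming n σ t (z, false) = (head n q t (n.index z), true) := by
  induction t generalizing z with
  | zero => rfl
  | succ t ih =>
    have ih := fun z => ih (z := z) (by omega) (fun s hs => hlt s (by omega))
      (fun s hs => hσ s (by omega))
    set T : Fin k := ⟨t, ht⟩
    have hqT : q T = (σ T).2 := hσ T (Nat.lt_succ_self t)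
    rw [show t + 1 = (T : ℕ) + 1 from rfl, head_succ]
    have hzT : q T ≤ z := hz T (Nat.lt_succ_self t)
    split_ifs with hi
    · rw [naming_succ_main, ← hqT]
      have key : ∀ (N : ℕ) (z : Fin d), (z : ℕ) = q T + N → n.index (q T) = n.index z →
          (tau d * stage (rhoOf n) σ (T + 1)).SameCycle (q T, false) (z, false) := by
        intro N
        induction N with
        | zero =>
          intro z hz _
          rw [show q T = z from Fin.ext (by omega)]
        | succ N ihN =>
          intro z hz hiz
          have hy : (q T : ℕ) + N < d := by have := z.2; omega
          have hiy : n.index ⟨q T + N, hy⟩ = n.index z :=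
            index_between n hiz (Fin.le_def.2 (by simp)) (Fin.le_def.2 (by simp; omega))
          refine (ihN ⟨q T + N, hy⟩ rfl (by rw [hiy, hiz])).trans ?_
          refine Equiv.Perm.SameCycle.symm ⟨1, ?_⟩
          rw [zpow_one, Equiv.Perm.mul_apply,
            stage_untouched (y := ⟨q T + N, hy⟩) ht hlt (by simp; omega) hiy]
          · rfl
          · intro s hs
            rw [← hσ s hs]
            exact (hq (Fin.le_def.2 (Nat.lt_succ_iff.1 hs) : s ≤ T)).trans (Fin.le_def.2 (by simp))
      exact key (z - q T) z (by have := Fin.le_def.1 hzT; omega) hi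
    · have hlt' : n.index (q T) < n.index z := lt_of_le_of_ne (index_mono n hzT) hi
      have hh : head n q t (n.index z) = Sum.inl (n.index z) := by
        refine head_of_ne fun s hs e => ?_
        have := index_mono n (hq (Fin.le_def.2 (by change (s : ℕ) ≤ t; omega) : s ≤ T))
        rw [e] at this
        exact absurd hlt' (not_lt.2 this)
      have h₁ : naming n σ t (z, false) = (Sum.inl (n.index z), true) := by
        rw [ih z fun s hs => hz s (by omega), hh]
      rw [naming_succ_of_not_moved, h₁]
      unfold Moved
      rw [show naming n σ (T : ℕ) (z, false) = _ from h₁]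
      rintro (e | e)
      · have e' := index_of_naming (by omega) e.symm
        have h₂ := index_mono n (hlt T (Nat.lt_succ_self t)).le
        rw [e', ← hqT] at h₂
        exact absurd hlt' (not_lt.2 h₂)
      · have e' := index_of_naming (by omega) e.symm
        rw [← hqT] at e'
        exact hi e'

theorem naming_larger (hq : Monotone D.q) {t : Fin k}
    (h : ∀ s < t, Realizes D σ s) {z : Fin d} (hz : D.q t ≤ z) :
    naming n σ t (z, false) = (head n D.q t (n.index z), true) :=
  naming_untouched hq t.2.le (fun s hs => (h s hs).lt) (fun s hs => (h s hs).q)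
    fun _ hs => (hq (Fin.le_def.2 hs.le)).trans hz

theorem uses_iff_of (hq : Monotone D.q) {t : Fin k}
    (h : ∀ s < t, Realizes D σ s) (hqt : D.q t = (σ t).2) (ho : D.other t = partner n σ t)
    (a : Name n k) :
    D.Uses t a ↔ a = (naming n σ t (σ t).1).1 ∨ a = (naming n σ t ((σ t).2, false)).1 := by
  have h₁ := naming_larger hq h le_rfl
  rw [hqt] at h₁
  have h₂ : (naming n σ t ((σ t).2, false)).1 = D.main t := by
    rw [h₁]; unfold Diagram.main Diagram.blk; rw [hqt]
  unfold Diagram.Uses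
  rw [ho, partner, h₂]
  split_ifs with e
  · rw [e]; simp
  · constructor
    · rintro (rfl | ⟨b, hb⟩)
      · exact Or.inr rfl
      · simp only [Option.some.injEq] at hb
        exact Or.inl (by rw [hb])
    · rintro (rfl | rfl)
      · exact Or.inr ⟨_, rfl⟩
      · exact Or.inl rfl

theorem Realizes.uses_iff (hq : Monotone D.q) {t : Fin k} (h : ∀ s ≤ t, Realizes D σ s)
    (a : Name n k) :
    D.Uses t a ↔ a = (naming n σ t (σ t).1).1 ∨ a = (naming n σ t ((σ t).2, false)).1 :=
  uses_iff_of hq (fun s hs => h s hs.le) (h t le_rfl).q (h t le_rfl).other a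

theorem naming_main (hq : Monotone D.q) {t : Fin k}
    (h : ∀ s < t, Realizes D σ s) (hqt : D.q t = (σ t).2) :
    naming n σ t ((σ t).2, false) = (D.main t, true) := by
  have h₁ := naming_larger hq h le_rfl
  rw [hqt] at h₁
  rw [h₁]; unfold Diagram.main Diagram.blk; rw [hqt]

theorem uses_born (hq : Monotone D.q) {t : Fin k} (h : ∀ s ≤ t, Realizes D σ s)
    {a : Name n k} (ha : D.Uses t a) : Born t a := by
  rcases (Realizes.uses_iff hq h a).1 ha with rfl | rfl
  · exact born_naming σ t.2.le _
  · exact born_naming σ t.2.le _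

theorem moved_iff_uses (hq : Monotone D.q) {t : Fin k} (h : ∀ s ≤ t, Realizes D σ s) (y : Pt d) :
    Moved n σ t y ↔ D.Uses t (naming n σ t y).1 := by
  rw [Realizes.uses_iff hq h]; rfl

/-- An edge that has ended is not the name of any point. -/
theorem naming_not_used (hq : Monotone D.q) {t : ℕ} (ht : t ≤ k)
    (h : ∀ s : Fin k, (s : ℕ) < t → Realizes D σ s) (y : Pt d) (s : Fin k) (hs : (s : ℕ) < t) :
    ¬ D.Uses s (naming n σ t y).1 := by
  induction t with
  | zero => omega
  | succ t ih =>
    set T : Fin k := ⟨t, ht⟩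
    have hsT : s ≤ T := Fin.le_def.2 (Nat.lt_succ_iff.1 hs)
    intro hu
    have hb := uses_born hq (fun s' hs' => h s' (lt_of_le_of_lt (Fin.le_def.1 hs') hs)) hu
    have hm : ¬ Moved n σ T y := by
      refine not_moved_of_ne fun b e => ?_
      change (naming n σ (t + 1) y).1 = _ at e
      rw [e] at hb
      have h₁ : t < (s : ℕ) := hb
      have h₂ : (s : ℕ) ≤ t := Fin.le_def.1 hsT
      omega
    have e := naming_succ_of_not_moved hm
    change naming n σ (t + 1) y = naming n σ t y at e
    rw [e] at hu
    rcases Nat.lt_or_ge s t with hst | hst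
    · exact ih (by omega) (fun s' hs' => h s' (by omega)) hst hu
    · obtain rfl : s = T := Fin.ext (by have := Fin.le_def.1 hsT; change (s : ℕ) = t; change (s : ℕ) ≤ t at this; omega)
      rw [moved_iff_uses hq fun s' hs' => h s' (lt_of_le_of_lt (Fin.le_def.1 hs') (Nat.lt_succ_self t))] at hm
      exact hm hu

/-- A strand keeps exactly the same points from its birth until it is used, so the weight recorded
at birth remains its length. -/
theorem ncard_naming (hq : Monotone D.q) {t : ℕ} (ht : t ≤ k)
    (h : ∀ s : Fin k, (s : ℕ) < t → Realizes D σ s) {a : Name n k} (hb : Born t a)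
    (hu : ∀ s : Fin k, (s : ℕ) < t → ¬ D.Uses s a) :
    Set.ncard {y | naming n σ t y = (a, true)} = D.wt a := by
  induction t with
  | zero =>
    rcases a with i | ⟨s, b⟩
    · have : {y : Pt d | naming n σ 0 y = (Sum.inl i, true)} =
          (fun z => (z, false)) '' {z | n.index z = i} := by
        ext ⟨z, b⟩
        simp only [naming, Set.mem_ofPred_eq, Set.mem_image, Prod.mk.injEq, Sum.inl.injEq]
        cases b <;> simp
      rw [this, Set.ncard_image_of_injective _ (fun _ _ e => congrArg Prod.fst e), ncard_block]
      rfl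
    · exact absurd hb (Nat.not_lt_zero _)
  | succ t ih =>
    set T : Fin k := ⟨t, ht⟩
    by_cases ha : ∃ b, a = Sum.inr (T, b)
    · obtain ⟨b, rfl⟩ := ha
      exact ((h T (Nat.lt_succ_self t)).ow b).symm
    · push Not at ha
      have hb' : Born t a := by
        rcases a with i | ⟨s, b⟩
        · trivial
        · have h₁ : (s : ℕ) < t + 1 := hb
          have h₂ : (s : ℕ) ≠ t := fun e => ha b (by rw [show s = T from Fin.ext e])
          change (s : ℕ) < t
          omega
      rw [← ih (by omega) (fun s hs => h s (by omega)) hb' (fun s hs => hu s (by omega))]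
      congr 1
      ext y
      change naming n σ (t + 1) y = _ ↔ naming n σ t y = _
      constructor
      · intro e
        rw [← naming_of_le (Nat.le_succ t) ht hb' (congrArg Prod.fst e), e]
      · intro e
        have hm : ¬ Moved n σ T y := by
          rw [moved_iff_uses hq fun s' hs' => h s' (lt_of_le_of_lt (Fin.le_def.1 hs') (Nat.lt_succ_self t))]
          rw [show naming n σ (T : ℕ) y = _ from e]
          exact hu T (Nat.lt_succ_self t)
        rw [show naming n σ (t + 1) y = naming n σ t y from naming_succ_of_not_moved hm, e]

theorem live_naming (hq : Monotone D.q) {t : ℕ} (ht : t ≤ k)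
    (h : ∀ s : Fin k, (s : ℕ) < t → Realizes D σ s) (y : Pt d) : D.Live t (naming n σ t y).1 := by
  have hb := born_naming (n := n) σ ht y
  have hu := naming_not_used hq ht h y
  refine ⟨?_, hb, hu⟩
  rw [← ncard_naming hq ht h hb hu, Set.ncard_pos]
  have hN := isNaming_naming (n := n) σ ht
  rcases hy : (naming n σ t y).2 with _ | _
  · exact ⟨tau d y, by rw [Set.mem_ofPred_eq, hN.flip, hy]; rfl⟩
  · exact ⟨y, by rw [Set.mem_ofPred_eq, ← hy]⟩

theorem exists_naming (hq : Monotone D.q) {t : ℕ} (ht : t ≤ k)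
    (h : ∀ s : Fin k, (s : ℕ) < t → Realizes D σ s) {a : Name n k} (ha : D.Live t a) :
    ∃ y, naming n σ t y = (a, true) := by
  have := ha.1
  rw [← ncard_naming hq ht h ha.2.1 ha.2.2, Set.ncard_pos] at this
  exact this

theorem live_iff (hq : Monotone D.q) {t : ℕ} (ht : t ≤ k)
    (h : ∀ s : Fin k, (s : ℕ) < t → Realizes D σ s) (a : Name n k) :
    D.Live t a ↔ ∃ y, (naming n σ t y).1 = a := by
  constructor
  · intro ha
    obtain ⟨y, hy⟩ := exists_naming hq ht h ha
    exact ⟨y, by rw [hy]⟩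
  · rintro ⟨y, rfl⟩
    exact live_naming hq ht h y

end Realizes
end RefinedHurwitz

/-! ### Single steps: dependence on the prefix, and weights of the outputs -/

namespace RefinedHurwitz

section Steps

variable {d k : ℕ} {n m : Composition d}

theorem stage_congr {ρ : Equiv.Perm (Pt d)} {σ σ' : Fin k → Step d} {t : ℕ}
    (h : ∀ s : Fin k, (s : ℕ) < t → σ s = σ' s) : stage ρ σ t = stage ρ σ' t := by
  induction t with
  | zero => rfl
  | succ t ih =>
    rw [stage, stage, ih fun s hs => h s (by omega)]
    split_ifs with ht
    · rw [h ⟨t, ht⟩ (Nat.lt_succ_self t)]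
    · rfl

theorem naming_congr {σ σ' : Fin k → Step d} {t : ℕ}
    (h : ∀ s : Fin k, (s : ℕ) < t → σ s = σ' s) : naming n σ t = naming n σ' t := by
  induction t with
  | zero => rfl
  | succ t ih =>
    funext y
    rw [naming, naming, ih fun s hs => h s (by omega), stage_congr h]
    split_ifs with ht
    · rw [h ⟨t, ht⟩ (Nat.lt_succ_self t)]
    · rfl

theorem partner_congr {σ σ' : Fin k → Step d} {t : Fin k} (h : ∀ s ≤ t, σ s = σ' s) :
    partner n σ t = partner n σ' t := by
  rw [partner, partner, naming_congr (σ := σ) (σ' := σ') fun s hs => h s (Fin.le_def.2 hs.le),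
    h t le_rfl]

/-- Step t is judged by the transpositions up to t alone. This is what allows the strings to be
counted one step at a time. -/
theorem Realizes.congr {D : Diagram n m k} {σ σ' : Fin k → Step d} {t : Fin k}
    (h : ∀ s ≤ t, σ s = σ' s) (hr : Realizes D σ t) : Realizes D σ' t where
  lt := h t le_rfl ▸ hr.lt
  q := h t le_rfl ▸ hr.q
  other := by rw [hr.other, partner_congr h]
  ow b := by
    rw [hr.ow, naming_congr (σ := σ) (σ' := σ') fun s hs => h s (Fin.le_def.2 (by omega))]

/-- The weight of the output `(t, b)` in the cover defined by `σ`. -/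
noncomputable def outWeight (n : Composition d) (σ : Fin k → Step d) (t : Fin k) (b : Bool) : ℕ :=
  Set.ncard {y | naming n σ (t + 1) y = (Sum.inr (t, b), true)}

variable {D : Diagram n m k} {σ : Fin k → Step d} {t : Fin k}

theorem live_main (hq : Monotone D.q) (h : ∀ s < t, Realizes D σ s) (hqt : D.q t = (σ t).2) :
    D.Live t (D.main t) := by
  have := live_naming hq t.2.le (fun s hs => h s hs) ((σ t).2, false)
  rwa [naming_main hq h hqt] at this

theorem ncard_main (hq : Monotone D.q) (h : ∀ s < t, Realizes D σ s) (hqt : D.q t = (σ t).2) :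
    Set.ncard {y | naming n σ t y = (D.main t, true)} = D.wt (D.main t) := by
  have := live_main hq h hqt
  exact ncard_naming hq t.2.le (fun s hs => h s hs) this.2.1 this.2.2

theorem outWeight_add (hq : Monotone D.q) (h : ∀ s < t, Realizes D σ s) (hqt : D.q t = (σ t).2)
    (ho : D.other t = partner n σ t) :
    outWeight n σ t true + outWeight n σ t false =
      D.wt (D.main t) + (D.other t).elim 0 fun f => D.wt f.1 := by
  classical
  have h₁ := ncard_relabel (isNaming_naming σ t.2.le) isFpf_tau (isFpf_stage σ t)
    (p := (σ t).1) (q := ((σ t).2, false))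
    (show (Sum.inr (t, true) : Name n k) ≠ Sum.inr (t, false) by simp)
    (naming_ne σ t true) (naming_ne σ t false)
  simp only [← naming_succ] at h₁
  rw [naming_main hq h hqt, ncard_main hq h hqt] at h₁
  rw [outWeight, outWeight, h₁, ho, partner, naming_main hq h hqt]
  congr 1
  split_ifs with e
  · rfl
  · have := live_naming hq t.2.le (fun s hs => h s hs) (σ t).1
    exact ncard_naming hq t.2.le (fun s hs => h s hs) this.2.1 this.2.2

theorem outWeight_side (hlt : (σ t).1.1 < (σ t).2)
    (hne : naming n σ t (σ t).1 ≠ naming n σ t ((σ t).2, false)) : outWeight n σ t false = 0 := by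
  rw [outWeight, Set.ncard_eq_zero, Set.eq_empty_iff_forall_notMem]
  intro y e
  refine relabel_ne_side (isNaming_naming σ t.2.le) isFpf_tau (isFpf_stage σ t)
    (p := (σ t).1) (q := ((σ t).2, false))
    (show (Sum.inr (t, true) : Name n k) ≠ Sum.inr (t, false) by simp)
    (naming_ne σ t false) ?_ hne y ?_
  · intro e
    rw [e] at hlt
    exact lt_irrefl _ hlt
  · rw [← naming_succ, show naming n σ (t + 1) y = _ from e]

theorem outWeight_cut (hq : Monotone D.q) (h : ∀ s < t, Realizes D σ s) (hqt : D.q t = (σ t).2)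
    {i : ℕ} (hi : 0 < i) (hi' : i < D.wt (D.main t))
    (hp : (σ t).1 = ((tau d * stage (rhoOf n) σ t) ^ i) ((σ t).2, false)) :
    outWeight n σ t true = D.wt (D.main t) - i := by
  have h₁ := ncard_cut (isNaming_naming (n := n) σ t.2.le) (isFpf_stage σ t) hi
    (by rwa [naming_main hq h hqt, ncard_main hq h hqt]) hp
  rw [naming_main hq h hqt, ncard_main hq h hqt] at h₁
  rw [← h₁, outWeight]
  simp only [naming_succ_main, stage_succ]

theorem exists_pow (hq : Monotone D.q) (h : ∀ s < t, Realizes D σ s) (hqt : D.q t = (σ t).2)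
    {y : Pt d} (hy : naming n σ t y = (D.main t, true)) :
    ∃ i < D.wt (D.main t), ((tau d * stage (rhoOf n) σ t) ^ i) ((σ t).2, false) = y := by
  have hN := isNaming_naming (n := n) σ t.2.le
  have hset : {z | naming n σ t z = (D.main t, true)} =
      {z | (tau d * stage (rhoOf n) σ t).SameCycle ((σ t).2, false) z} := by
    ext z
    rw [Set.mem_ofPred_eq, eq_comm, ← naming_main hq h hqt, hN.cyc]; rfl
  obtain ⟨hω, hper, -⟩ := cycle_period (tau d * stage (rhoOf n) σ t) ((σ t).2, false)
  rw [← hset, ncard_main hq h hqt] at hω hper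
  refine mem_cycle_of_period hω hper ?_
  rw [← hN.cyc, hy, naming_main hq h hqt]

theorem pow_main_ne (hq : Monotone D.q) (h : ∀ s < t, Realizes D σ s) (hqt : D.q t = (σ t).2)
    {i : ℕ} (hi : 0 < i) (hi' : i < D.wt (D.main t)) :
    ((tau d * stage (rhoOf n) σ t) ^ i) ((σ t).2, false) ≠ ((σ t).2, false) := by
  have hN := isNaming_naming (n := n) σ t.2.le
  have hset : {z | naming n σ t z = (D.main t, true)} =
      {z | (tau d * stage (rhoOf n) σ t).SameCycle ((σ t).2, false) z} := by
    ext z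
    rw [Set.mem_ofPred_eq, eq_comm, ← naming_main hq h hqt, hN.cyc]; rfl
  obtain ⟨-, -, hmin⟩ := cycle_period (tau d * stage (rhoOf n) σ t) ((σ t).2, false)
  rw [← hset, ncard_main hq h hqt] at hmin
  exact hmin i hi hi'

/-- On the unmoved unbarred elements of the block, τρ lowers the position by one. -/
theorem pow_untouched (hq : Monotone D.q) (h : ∀ s < t, Realizes D σ s) (N : ℕ) {z : Fin d}
    (hz : (z : ℕ) = D.q t + N) (hi : n.index (D.q t) = n.index z) :
    ((tau d * stage (rhoOf n) σ t) ^ N) (z, false) = (D.q t, false) := by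
  induction N generalizing z with
  | zero => rw [show z = D.q t from Fin.ext (by omega)]; rfl
  | succ N ih =>
    have hy : (D.q t : ℕ) + N < d := by have := z.2; omega
    have hiy : n.index ⟨D.q t + N, hy⟩ = n.index z :=
      index_between n hi (Fin.le_def.2 (by simp)) (Fin.le_def.2 (by simp; omega))
    rw [pow_succ, Equiv.Perm.mul_apply, Equiv.Perm.mul_apply,
      stage_untouched (y := ⟨D.q t + N, hy⟩) t.2.le (fun s hs => (h s hs).lt) (by simp; omega) hiy]
    · exact ih rfl (by rw [hi, hiy])
    · intro s hs
      rw [← (h s hs).q]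
      exact (hq (Fin.le_def.2 (le_of_lt hs) : s ≤ t)).trans (Fin.le_def.2 (by simp))

theorem naming_larger_eq_main (hq : Monotone D.q) (h : ∀ s < t, Realizes D σ s)
    {z : Fin d} (hz : D.q t ≤ z) (b : Bool) :
    (naming n σ t (z, b)).1 = D.main t ↔ n.index z = D.blk t := by
  have h₁ : (naming n σ t (z, b)).1 = head n D.q t (n.index z) := by
    cases b
    · rw [naming_larger hq h hz]
    · change (naming n σ t (tau d (z, false))).1 = _
      rw [(isNaming_naming σ t.2.le).flip, naming_larger hq h hz]
  rw [h₁, Diagram.main]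
  constructor
  · intro e
    rcases h₂ : head n D.q t (D.blk t) with j | ⟨s, c⟩
    · rw [h₂] at e
      rw [← head_eq_inl h₂, ← head_eq_inl e]
    · rw [h₂] at e
      rw [← (head_eq_inr h₂).2.2, ← (head_eq_inr e).2.2]
  · intro e; rw [e]

theorem naming_larger_snd (hq : Monotone D.q) (h : ∀ s < t, Realizes D σ s)
    {z : Fin d} (hz : D.q t ≤ z) (b : Bool) : (naming n σ t (z, b)).2 = !b := by
  cases b
  · rw [naming_larger hq h hz]; rfl
  · change (naming n σ t (tau d (z, false))).2 = _
    rw [(isNaming_naming σ t.2.le).flip, naming_larger hq h hz]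

/-- By `naming_untouched` the unbarred elements from q to the end of its block all lie on the new
main strand, which is therefore at least that long. -/
theorem outWeight_bound (hq : Monotone D.q) (h : ∀ s < t, Realizes D σ s) (hqt : D.q t = (σ t).2)
    (hlt : (σ t).1.1 < (σ t).2) : n.blocksFun (D.blk t) < outWeight n σ t true + D.ctr t := by
  have h₁ := ncard_block_from n (D.q t)
  have h₂ : Set.ncard {z : Fin d | D.q t ≤ z ∧ n.index z = n.index (D.q t)} ≤
      outWeight n σ t true := by
    rw [← Set.ncard_image_of_injective (f := fun z : Fin d => ((z, false) : Pt d)) _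
      (fun _ _ e => congrArg Prod.fst e)]
    refine Set.ncard_le_ncard ?_ (Set.toFinite _)
    rintro _ ⟨z, ⟨hz, hi⟩, rfl⟩
    change naming n σ (t + 1) (z, false) = _
    have hle : ∀ s : Fin k, (s : ℕ) < t + 1 → s ≠ t → s < t := by
      intro s hs hst
      have := Fin.val_ne_of_ne hst
      exact Fin.lt_def.2 (by omega)
    rw [naming_untouched hq t.2, head_succ, if_pos hi.symm]
    · intro s hs
      by_cases hst : s = t
      · rw [hst]; exact hlt
      · exact (h s (hle s hs hst)).lt
    · intro s hs
      by_cases hst : s = t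
      · rw [hst]; exact hqt
      · exact (h s (hle s hs hst)).q
    · intro s hs
      exact (hq (Fin.le_def.2 (Nat.lt_succ_iff.1 hs))).trans hz
  unfold Diagram.ctr Diagram.blk
  omega

end Steps

/-! ### Counting the strings with a given diagram -/

section Count

variable {d k : ℕ} {n m : Composition d}

/-- The number of choices of the smaller element in the `t`-th step. -/
def Diagram.choices (D : Diagram n m k) (t : Fin k) : ℕ :=
  match D.other t with
  | some f => D.wt f.1
  | none => if 0 < D.ow (t, false) then 1 else D.ow (t, true) + D.ctr t - n.blocksFun (D.blk t) - 1

variable {D : Diagram n m k} {σ : Fin k → Step d} {t : Fin k} {r : Fin m.length} {c : ℕ}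

theorem Diagram.Valid.ow_pos (hD : D.Valid r c) (t : Fin k) : 0 < D.ow (t, true) := by
  have h₁ := hD.bound t
  have h₂ := offset_lt n (D.q t)
  unfold Diagram.ctr Diagram.blk at h₁
  omega

/-- Every point of the partner strand is admissible, because it is automatically smaller than q: an
element not below q bears the name given by `head`, which is either the main name or an in-end of a
later block, and both are excluded by `other_live`. -/
theorem Diagram.Valid.realizes_iff_join (hD : D.Valid r c) (h : ∀ s < t, Realizes D σ s)
    (hqt : D.q t = (σ t).2) {f : Name n k × Bool} (hf : D.other t = some f) :
    Realizes D σ t ↔ naming n σ t (σ t).1 = f := by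
  constructor
  · intro hr
    have := hr.other
    rw [hf, partner] at this
    split_ifs at this
    simpa using this.symm
  · intro e
    obtain ⟨h₁, h₂, h₃⟩ := hD.other_live t f.1 f.2 hf
    have ho : D.other t = partner n σ t := by
      rw [hf, partner, if_neg, e]
      rw [e, naming_main hD.mono h hqt]
      exact h₂
    have hlt : (σ t).1.1 < (σ t).2 := by
      by_contra hle
      push Not at hle
      rw [← hqt] at hle
      have e₁ := naming_larger hD.mono h hle
      have e₂ : f.1 = head n D.q t (n.index (σ t).1.1) := by
        rw [← e]
        rcases hσ : (σ t).1 with ⟨z, b⟩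
        rw [hσ] at e₁
        cases b
        · rw [e₁]
        · change (naming n σ t (tau d (z, false))).1 = _
          rw [(isNaming_naming σ t.2.le).flip, e₁]
      rcases hh : head n D.q t (n.index (σ t).1.1) with j | ⟨s, b⟩
      · have h₄ := head_eq_inl hh
        rw [hh] at e₂
        have h₅ := h₃ _ e₂
        have h₆ : D.blk t ≤ n.index (σ t).1.1 := index_mono n hle
        rw [h₄] at h₅
        refine h₂ ?_
        rw [e₂, Diagram.main, ← hh, le_antisymm h₅ h₆]
      · have h₄ := head_eq_inr hh
        refine h₂ ?_
        rw [e₂, Diagram.main]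
        congr 1
        refine le_antisymm ?_ (index_mono n hle)
        rw [← h₄.2.2]
        exact index_mono n (hD.mono (Fin.le_def.2 (by omega)))
    have hs : outWeight n σ t false = 0 := by
      refine outWeight_side hlt ?_
      rw [e, naming_main hD.mono h hqt]
      intro e'
      exact h₂ (by rw [e'])
    have hs' : D.ow (t, false) = 0 := by
      by_contra h0
      have := hD.side t (Nat.pos_of_ne_zero h0)
      rw [hf] at this
      simp at this
    have hc := outWeight_add hD.mono h hqt ho
    rw [← hD.conserve t, hs, hs'] at hc
    refine ⟨hlt, hqt, ho, ?_⟩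
    rintro (_ | _)
    · rw [hs', ← hs]; rfl
    · exact hc.symm

/-- The weight cut off is the number of steps from q to p along the strand, so the weights leave
exactly one choice of p. -/
theorem Diagram.Valid.realizes_iff_cut (hD : D.Valid r c) (h : ∀ s < t, Realizes D σ s)
    (hqt : D.q t = (σ t).2) (hs : 0 < D.ow (t, false)) :
    Realizes D σ t ↔
      (σ t).1 = ((tau d * stage (rhoOf n) σ t) ^ D.ow (t, false)) ((σ t).2, false) := by
  have ho := hD.side t hs
  have hc := hD.conserve t
  rw [ho] at hc
  simp only [Option.elim_none, add_zero] at hc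
  have hpos := hD.ow_pos t
  constructor
  · intro hr
    have hn : naming n σ t (σ t).1 = naming n σ t ((σ t).2, false) := by
      by_contra hne
      have := outWeight_side hr.lt hne
      rw [outWeight, ← hr.ow] at this
      omega
    rw [naming_main hD.mono h hqt] at hn
    obtain ⟨i, hi, hp⟩ := exists_pow hD.mono h hqt hn
    have hi0 : 0 < i := by
      rcases Nat.eq_zero_or_pos i with rfl | h0
      · have := hr.lt
        rw [← hp] at this
        exact absurd this (lt_irrefl _)
      · exact h0
    have := outWeight_cut hD.mono h hqt hi0 hi hp.symm
    rw [outWeight, ← hr.ow] at this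
    rw [← hp]
    congr 2
    omega
  · intro hp
    have hN := isNaming_naming (n := n) σ t.2.le
    have hn : naming n σ t (σ t).1 = naming n σ t ((σ t).2, false) := by
      rw [hp, nm_pow hN]
    have hpart : D.other t = partner n σ t := by
      rw [ho, partner, if_pos (by rw [hn])]
    have hw := outWeight_cut hD.mono h hqt hs (by omega) hp
    have hc' := outWeight_add hD.mono h hqt hpart
    rw [ho] at hc'
    simp only [Option.elim_none, add_zero] at hc'
    refine ⟨?_, hqt, hpart, ?_⟩
    -- If p were not below q, it would be an unbarred element of the same block, and τρ would return
    -- from p to q in p − q steps. Then q would have a period smaller than the length of its strand,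
    -- since `bound` makes p − q smaller than the weight kept.
    · by_contra hle
      push Not at hle
      rw [← hqt] at hle
      have hm := naming_main hD.mono h hqt
      have h₁ := naming_larger_eq_main hD.mono h hle (σ t).1.2
      have h₂ := naming_larger_snd hD.mono h hle (σ t).1.2
      rw [Prod.mk.eta, hn, hm] at h₁ h₂
      have h₃ : n.index (σ t).1.1 = D.blk t := h₁.1 rfl
      have h₄ : (σ t).1.2 = false := by simpa using h₂
      have h₅ : (σ t).1 = ((σ t).1.1, false) := Prod.ext rfl h₄
      have h₆ := pow_untouched hD.mono h ((σ t).1.1 - D.q t)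
        (z := (σ t).1.1) (by have := Fin.le_def.1 hle; omega) h₃.symm
      rw [← h₅, hp, ← Equiv.Perm.mul_apply, ← pow_add, hqt] at h₆
      refine pow_main_ne hD.mono h hqt (by omega) ?_ h₆
      have h₇ := index_offset n (D.q t)
      have h₈ := index_offset n (σ t).1.1
      have h₉ := offset_lt n (σ t).1.1
      have hb := hD.bound t
      rw [h₃] at h₈ h₉
      unfold Diagram.ctr at hb
      change _ = n.sizeUpTo (D.blk t) + _ at h₇
      rw [hqt] at h₇ hb
      rw [← hp]
      omega
    · rintro (_ | _)
      · change _ = outWeight n σ t false; omega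
      · change _ = outWeight n σ t true; omega

/-- A point p on the strand of q itself would cut off a positive weight, contrary to conservation
with no second output. So p must lie on the mirror strand. -/
theorem Diagram.Valid.realizes_iff_twist (hD : D.Valid r c) (h : ∀ s < t, Realizes D σ s)
    (hqt : D.q t = (σ t).2) (ho : D.other t = none) (hs : D.ow (t, false) = 0) :
    Realizes D σ t ↔ naming n σ t (σ t).1 = (D.main t, false) ∧ (σ t).1.1 < (σ t).2 := by
  have hc := hD.conserve t
  rw [ho, hs] at hc
  simp only [Option.elim_none, add_zero] at hc
  have hm := naming_main hD.mono h hqt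
  constructor
  · intro hr
    refine ⟨?_, hr.lt⟩
    have hn : (naming n σ t (σ t).1).1 = D.main t := by
      have := hr.other
      rw [ho, partner] at this
      split_ifs at this with e
      rw [e, hm]
    refine Prod.ext hn ?_
    by_contra hne
    have hn' : naming n σ t (σ t).1 = (D.main t, true) := Prod.ext hn (by simpa using hne)
    obtain ⟨i, hi, hp⟩ := exists_pow hD.mono h hqt hn'
    have hi0 : 0 < i := by
      rcases Nat.eq_zero_or_pos i with rfl | h0
      · have := hr.lt
        rw [← hp] at this
        exact absurd this (lt_irrefl _)
      · exact h0
    have := outWeight_cut hD.mono h hqt hi0 hi hp.symm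
    rw [outWeight, ← hr.ow] at this
    omega
  · rintro ⟨hn, hlt⟩
    have hpart : D.other t = partner n σ t := by
      rw [ho, partner, if_pos (by rw [hn, hm])]
    have hw : outWeight n σ t false = 0 := by
      refine outWeight_side hlt ?_
      rw [hn, hm]; simp
    have hc' := outWeight_add hD.mono h hqt hpart
    rw [ho] at hc'
    simp only [Option.elim_none, add_zero] at hc'
    refine ⟨hlt, hqt, hpart, ?_⟩
    rintro (_ | _)
    · rw [hs, ← hw]; rfl
    · change _ = outWeight n σ t true; omega

theorem Diagram.Valid.ncard_realizes (hD : D.Valid r c) (h : ∀ s < t, Realizes D σ s) :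
    Set.ncard {s : Step d | Realizes D (Function.update σ t s) t} = D.choices t := by
  have hsub : {s : Step d | Realizes D (Function.update σ t s) t} = (fun p : Pt d => (p, D.q t)) ''
      {p | Realizes D (Function.update σ t (p, D.q t)) t} := by
    ext ⟨p, q⟩
    simp only [Set.mem_ofPred_eq, Set.mem_image, Prod.mk.injEq]
    constructor
    · intro hr
      have : D.q t = q := by simpa using hr.q
      subst this
      exact ⟨p, hr, rfl, rfl⟩
    · rintro ⟨p, hr, rfl, rfl⟩
      exact hr
  rw [hsub, Set.ncard_image_of_injective _ (fun _ _ e => congrArg Prod.fst e)]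
  have hne : ∀ (p : Pt d), ∀ s < t, Function.update σ t (p, D.q t) s = σ s :=
    fun p s hs => Function.update_of_ne hs.ne _ _
  have h' : ∀ p : Pt d, ∀ s < t, Realizes D (Function.update σ t (p, D.q t)) s :=
    fun p s hs => (h s hs).congr fun s' hs' => (hne p s' (lt_of_le_of_lt hs' hs)).symm
  have hn : ∀ p : Pt d, naming n (Function.update σ t (p, D.q t)) t = naming n σ t :=
    fun p => naming_congr fun s hs => hne p s hs
  have hst : ∀ p : Pt d, stage (rhoOf n) (Function.update σ t (p, D.q t)) t =
      stage (rhoOf n) σ t := fun p => stage_congr fun s hs => hne p s hs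
  have hqt : ∀ p : Pt d, D.q t = (Function.update σ t (p, D.q t) t).2 := by simp
  have hN := isNaming_naming (n := n) σ t.2.le
  unfold Diagram.choices
  rcases ho : D.other t with _ | f
  · by_cases hs : 0 < D.ow (t, false)
    · simp only [hD.realizes_iff_cut (h' _) (hqt _) hs, hst, Function.update_self]
      simp [hs]
    · have hs0 : D.ow (t, false) = 0 := by omega
      simp only [hD.realizes_iff_twist (h' _) (hqt _) ho hs0, hn, Function.update_self, if_neg hs]
      have hc := hD.conserve t
      rw [ho, hs0] at hc
      simp only [Option.elim_none, add_zero] at hc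
      set σ₀ := Function.update σ t ((D.q t, false), D.q t)
      have hcard : Set.ncard {y | naming n σ t y = (D.main t, false)} = D.wt (D.main t) := by
        rw [hN.ncard_eq isFpf_tau _ _ true, ← ncard_main hD.mono (h' (D.q t, false)) (hqt _), hn]
      -- The points of the mirror strand that are not below q are the barred elements of the block
      -- from q on. Removing these n_i − c + 1 points, with c the counter, leaves the number ω − n_i
      -- + c − 1 of a twist.
      have hu : {y | naming n σ t y = (D.main t, false)} =
          {p | naming n σ t p = (D.main t, false) ∧ p.1 < D.q t} ∪
          (fun z => (z, true)) '' {z | D.q t ≤ z ∧ n.index z = n.index (D.q t)} := by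
        ext ⟨z, b⟩
        simp only [Set.mem_ofPred_eq, Set.mem_union, Set.mem_image, Prod.mk.injEq]
        rcases lt_or_ge z (D.q t) with hz | hz
        · simp [hz, not_le.2 hz]
        · have h₁ := naming_larger_eq_main hD.mono h hz b
          have h₂ := naming_larger_snd hD.mono h hz b
          rw [Prod.ext_iff]
          simp only [h₁, h₂, not_lt.2 hz, and_false, false_or]
          unfold Diagram.blk
          cases b <;> simp [hz]
      rw [hu, Set.ncard_union_eq _ (Set.toFinite _) (Set.toFinite _),
        Set.ncard_image_of_injective _ (fun _ _ e => congrArg Prod.fst e)] at hcard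
      · have hb := ncard_block_from n (D.q t)
        have hbd := hD.bound t
        unfold Diagram.ctr Diagram.blk at hbd ⊢
        omega
      · rw [Set.disjoint_left]
        rintro _ ⟨_, h₁⟩ ⟨z, ⟨h₂, _⟩, rfl⟩
        exact absurd h₁ (not_lt.2 h₂)
  · simp only [hD.realizes_iff_join (h' _) (hqt _) ho, hn, Function.update_self]
    obtain ⟨h₁, -, -⟩ := hD.other_live t f.1 f.2 ho
    rw [← ncard_naming hD.mono t.2.le (fun s hs => h s hs) h₁.2.1 h₁.2.2]
    exact hN.ncard_eq isFpf_tau f.1 f.2 true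

end Count
end RefinedHurwitz

namespace RefinedHurwitz

/-! ### The weighted count of the strings with a given diagram -/

/-- If every admissible prefix has the same number of admissible continuations, the total is the
product of these numbers. -/
theorem card_prefix {S : Type*} [Finite S] [Nonempty S] {k : ℕ} (P : Fin k → (Fin k → S) → Prop)
    (hP : ∀ t σ σ', (∀ s ≤ t, σ s = σ' s) → P t σ → P t σ') (c : Fin k → ℕ)
    (hc : ∀ t σ, (∀ s < t, P s σ) → Set.ncard {x | P t (Function.update σ t x)} = c t) :
    Set.ncard {σ | ∀ t, P t σ} = ∏ t, c t := by
  classical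
  have := Fintype.ofFinite S
  obtain ⟨x₀⟩ := ‹Nonempty S›
  -- Prefixes of length j are represented by full strings padded with x₀, so that all of them live
  -- in one type.
  let A : ℕ → Finset (Fin k → S) := fun j => Finset.univ.filter fun σ =>
    (∀ t : Fin k, (t : ℕ) < j → P t σ) ∧ ∀ t : Fin k, j ≤ t → σ t = x₀
  have key : ∀ j ≤ k, (A j).card = ∏ i ∈ Finset.range j, if h : i < k then c ⟨i, h⟩ else 1 := by
    intro j
    induction j with
    | zero =>
      intro _
      rw [Finset.prod_range_zero, Finset.card_eq_one]
      refine ⟨fun _ => x₀, ?_⟩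
      ext σ
      simp [A, funext_iff]
    | succ j ih =>
      intro hj
      set J : Fin k := ⟨j, hj⟩
      have hlt : ∀ {s : Fin k}, (s : ℕ) < j → s < J := fun h => h
      have hmaps : ∀ σ ∈ A (j + 1), Function.update σ J x₀ ∈ A j := by
        intro σ hσ
        simp only [A, Finset.mem_filter, Finset.mem_univ, true_and] at hσ ⊢
        refine ⟨fun t ht => hP t σ _ (fun s hs => ?_) (hσ.1 t (by omega)), fun t ht => ?_⟩
        · exact (Function.update_of_ne (lt_of_le_of_lt hs (hlt ht)).ne _ _).symm
        · by_cases htJ : t = J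
          · rw [htJ, Function.update_self]
          · rw [Function.update_of_ne htJ]
            have : (t : ℕ) ≠ j := fun e => htJ (Fin.ext e)
            exact hσ.2 t (by omega)
      rw [Finset.card_eq_sum_card_fiberwise hmaps, Finset.prod_range_succ, dif_pos (show j < k from hj),
        ← ih (by omega)]
      refine Finset.sum_const_nat fun σ hσ => ?_
      simp only [A, Finset.mem_filter, Finset.mem_univ, true_and] at hσ
      rw [← hc J σ fun s hs => hσ.1 s hs, ← Set.ncard_coe_finset,
        ← Set.ncard_image_of_injective {x | P J (Function.update σ J x)}
          (Function.update_injective σ J)]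
      congr 1
      ext σ'
      simp only [A, Finset.coe_filter, Finset.mem_filter, Finset.mem_univ, true_and,
        Set.mem_ofPred_eq, Set.mem_image]
      constructor
      · rintro ⟨⟨h₁, h₂⟩, rfl⟩
        refine ⟨σ' J, ?_, ?_⟩
        · simpa using h₁ J (Nat.lt_succ_self j)
        · simp
      · rintro ⟨x, hx, rfl⟩
        refine ⟨⟨fun t ht => ?_, fun t ht => ?_⟩, ?_⟩
        · by_cases htJ : t = J
          · rw [htJ]; exact hx
          · have : (t : ℕ) ≠ j := fun e => htJ (Fin.ext e)
            have htj : (t : ℕ) < j := by omega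
            refine hP t σ _ (fun s hs => ?_) (hσ.1 t htj)
            exact (Function.update_of_ne (lt_of_le_of_lt hs (hlt htj)).ne _ _).symm
        · have htJ : t ≠ J := fun e => by rw [e] at ht; change j + 1 ≤ j at ht; omega
          rw [Function.update_of_ne htJ]
          exact hσ.2 t (by omega)
        · rw [Function.update_idem, ← hσ.2 J le_rfl, Function.update_eq_self]
  have h := key k le_rfl
  rw [Finset.prod_range] at h
  simp only [Fin.is_lt, dite_true, Fin.eta] at h
  rw [← h, ← Set.ncard_coe_finset]
  congr 1
  ext σ
  simp only [A, Set.mem_ofPred_eq, Finset.coe_filter, Finset.mem_univ, true_and]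
  exact ⟨fun h => ⟨fun t _ => h t, fun t ht => absurd t.2 (not_lt.2 ht)⟩,
    fun h t => h.1 t t.2⟩

/-! ### The weights C, J, T of the steps -/

section Weights

variable {d k : ℕ} {n m : Composition d}

open scoped Classical in
/-- The weight of the `t`-th transposition. -/
noncomputable def Diagram.stepVar (D : Diagram n m k) (t : Fin k) : CJT :=
  if D.other t = none then if 0 < D.ow (t, false) then varC else varT else varJ

noncomputable def Diagram.weight (D : Diagram n m k) : CJT :=
  ∏ t, D.stepVar t * (D.choices t : CJT)

variable {D : Diagram n m k} {σ : Fin k → Step d} {r : Fin m.length} {c : ℕ}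

theorem Diagram.Valid.live_succ (D : Diagram n m k) (hu : ∀ s a, D.Uses s a → Born s a) (t : Fin k)
    (a : Name n k) :
    D.Live (t + 1) a ↔ (D.Live t a ∧ ¬ D.Uses t a) ∨ ∃ b, a = Sum.inr (t, b) ∧ 0 < D.ow (t, b) := by
  constructor
  · rintro ⟨h₁, h₂, h₃⟩
    by_cases ha : ∃ b, a = Sum.inr (t, b)
    · obtain ⟨b, rfl⟩ := ha
      exact Or.inr ⟨b, rfl, h₁⟩
    · refine Or.inl ⟨⟨h₁, ?_, fun s hs => h₃ s (by omega)⟩, h₃ t (Nat.lt_succ_self t)⟩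
      rcases a with i | ⟨s, b⟩
      · trivial
      · have h₄ : (s : ℕ) < t + 1 := h₂
        have h₅ : (s : ℕ) ≠ t := fun e => ha ⟨b, by rw [show s = t from Fin.ext e]⟩
        change (s : ℕ) < t
        omega
  · rintro (⟨⟨h₁, h₂, h₃⟩, h₄⟩ | ⟨b, rfl, hb⟩)
    · refine ⟨h₁, h₂.mono (Nat.le_succ t), fun s hs => ?_⟩
      rcases Nat.lt_succ_iff_lt_or_eq.1 hs with h | h
      · exact h₃ s h
      · rw [Fin.ext h]; exact h₄
    · refine ⟨hb, Nat.lt_succ_self t, fun s hs hus => ?_⟩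
      have : (t : ℕ) < s := hu s _ hus
      omega

/-- The parts correspond to the live names. A step removes the names it uses, all of which are live,
and adds its outputs of positive weight. -/
theorem Diagram.Valid.numParts_succ (hD : D.Valid r c) (h : ∀ s, Realizes D σ s) (t : Fin k) :
    numParts (stage (rhoOf n) σ (t + 1)) + Set.ncard {a | D.Uses t a} =
      numParts (stage (rhoOf n) σ t) + Set.ncard {a : Name n k | ∃ b, a = Sum.inr (t, b) ∧ 0 < D.ow (t, b)} := by
  have hr : ∀ j ≤ k, (Set.range fun y => (naming n σ j y).1) = {a | D.Live j a} := by
    intro j hj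
    ext a
    rw [Set.mem_ofPred_eq, live_iff hD.mono hj fun s _ => h s]
    rfl
  rw [(isNaming_naming σ t.2).numParts_eq (isFpf_stage σ _),
    (isNaming_naming σ t.2.le).numParts_eq (isFpf_stage σ _), hr _ t.2, hr _ t.2.le]
  have h₁ : {a | D.Live (t + 1) a} = ({a | D.Live t a} \ {a | D.Uses t a}) ∪
      {a | ∃ b, a = Sum.inr (t, b) ∧ 0 < D.ow (t, b)} := by
    ext a
    exact Diagram.Valid.live_succ D (fun s a hs => uses_born hD.mono (fun s' _ => h s') hs) t a
  have hsub : {a | D.Uses t a} ⊆ {a | D.Live t a} := by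
    rintro a (rfl | ⟨b, hb⟩)
    · exact live_main hD.mono (fun s _ => h s) (h t).q
    · exact (hD.other_live t a b hb).1
  rw [h₁, Set.ncard_union_eq _ (Set.toFinite _) (Set.toFinite _)]
  · have := Set.ncard_sdiff_add_ncard_of_subset hsub (Set.toFinite _)
    omega
  · rw [Set.disjoint_left]
    rintro _ ⟨h₂, _⟩ ⟨b, rfl, _⟩
    exact lt_irrefl (t : ℕ) h₂.2.1

/-- A cut uses one name and creates two, a join uses two and creates one, and a twist uses one and
creates one. -/
theorem Diagram.Valid.cjtWeight_eq (hD : D.Valid r c) (h : ∀ s, Realizes D σ s) (t : Fin k) :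
    cjtWeight (stage (rhoOf n) σ t) (σ t).perm = D.stepVar t := by
  have hc := hD.numParts_succ h t
  have hN₂ : 0 < D.ow (t, false) → Set.ncard {a : Name n k | ∃ b, a = Sum.inr (t, b) ∧
      0 < D.ow (t, b)} = 2 := by
    intro hs
    rw [← Set.ncard_pair (a := (Sum.inr (t, true) : Name n k)) (b := Sum.inr (t, false)) (by simp)]
    congr 1
    ext a
    simp [hs, hD.ow_pos t, or_comm]
  have hN₁ : D.ow (t, false) = 0 → Set.ncard {a : Name n k | ∃ b, a = Sum.inr (t, b) ∧
      0 < D.ow (t, b)} = 1 := by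
    intro hs
    rw [← Set.ncard_singleton (Sum.inr (t, true) : Name n k)]
    congr 1
    ext a
    simp [hs, hD.ow_pos t]
  have hU₁ : D.other t = none → Set.ncard {a | D.Uses t a} = 1 := by
    intro ho
    rw [← Set.ncard_singleton (D.main t)]
    congr 1
    ext a
    simp [Diagram.Uses, ho]
  have hU₂ : ∀ f, D.other t = some f → Set.ncard {a | D.Uses t a} = 2 := by
    intro f ho
    rw [← Set.ncard_pair (a := D.main t) (b := f.1) (hD.other_live t f.1 f.2 ho).2.1.symm]
    congr 1
    ext a
    simp only [Diagram.Uses, ho, Set.mem_ofPred_eq, Set.mem_insert_iff, Set.mem_singleton_iff,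
      Option.some.injEq]
    refine or_congr Iff.rfl ⟨?_, ?_⟩
    · rintro ⟨b, rfl⟩; rfl
    · rintro rfl; exact ⟨f.2, rfl⟩
  rw [stage_succ] at hc
  unfold cjtWeight Diagram.stepVar Step.perm
  rcases ho : D.other t with _ | f
  · rw [hU₁ ho] at hc
    by_cases hs : 0 < D.ow (t, false)
    · rw [hN₂ hs] at hc
      rw [if_pos (by omega), if_pos rfl, if_pos hs]
    · rw [hN₁ (by omega)] at hc
      rw [if_neg (by omega), if_neg (by omega), if_pos rfl, if_neg hs]
  · have hs : D.ow (t, false) = 0 := by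
      by_contra h0
      have := hD.side t (Nat.pos_of_ne_zero h0)
      rw [ho] at this
      simp at this
    rw [hU₂ f ho, hN₁ hs] at hc
    rw [if_neg (by omega), if_pos (by omega), if_neg (by simp)]

theorem Diagram.Valid.ncard_realizing (hd : 0 < d) (hD : D.Valid r c) :
    Set.ncard {σ | ∀ t, Realizes D σ t} = ∏ t, D.choices t := by
  have : Nonempty (Step d) := ⟨((⟨0, hd⟩, true), ⟨0, hd⟩)⟩
  exact card_prefix _ (fun _ _ _ h hr => hr.congr h) _ fun _ _ h => hD.ncard_realizes h

theorem Diagram.Valid.factWeight_eq (hD : D.Valid r c) (h : ∀ s, Realizes D σ s) :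
    factWeight (rhoOf n) σ = ∏ t, D.stepVar t :=
  Finset.prod_congr rfl fun t _ => hD.cjtWeight_eq h t

end Weights

end RefinedHurwitz

/-! ### The last block -/

namespace RefinedHurwitz

section LastBlock

variable {d : ℕ} (n : Composition d)

theorem lastPart_eq {i : Fin n.length} (hi : ∀ j, j ≤ i) :
    lastPart n = n.blocksFun i ∧ n.sizeUpTo i + n.blocksFun i = d := by
  have hp : 0 < n.length := i.pos
  have h₁ := Fin.le_def.1 (hi ⟨n.length - 1, by omega⟩)
  have h₂ : (i : ℕ) + 1 = n.length := by have := i.2; simp only at h₁; omega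
  have hne : n.blocks ≠ [] := by
    intro e
    have := n.blocks_length
    rw [e] at this
    simp at this
    omega
  constructor
  · rw [lastPart, List.getLastD_eq_getLast?, List.getLast?_eq_getLast_of_ne_nil hne,
      Option.getD_some, List.getLast_eq_getElem]
    unfold Composition.blocksFun
    rw [List.get_eq_getElem]
    congr 1
    have := n.blocks_length
    omega
  · rw [← n.sizeUpTo_succ', h₂, n.sizeUpTo_length]

/-- The last block begins at d − n_p. As c is at least 1, the equation places q in this block, at
the c-th position. -/
theorem last_position_iff (q : Fin d) {c : ℕ} (hc : 1 ≤ c) :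
    (q : ℕ) + 1 + lastPart n = d + c ↔ (∀ j, j ≤ n.index q) ∧ offset n q + 1 = c := by
  have hp : 0 < n.length := (n.index q).pos
  set l : Fin n.length := ⟨n.length - 1, by omega⟩
  have hl : ∀ j, j ≤ l := fun j => Fin.le_def.2 (by change (j : ℕ) ≤ n.length - 1; omega)
  have h₁ := index_offset n q
  constructor
  · intro e
    have h₂ := lastPart_eq n hl
    have h₃ : n.index q = l := by
      refine le_antisymm (hl _) ?_
      by_contra hlt
      push Not at hlt
      have h₄ := n.lt_sizeUpTo_index_succ q
      have h₅ : n.sizeUpTo (n.index q).succ ≤ n.sizeUpTo l := n.monotone_sizeUpTo hlt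
      omega
    rw [h₃] at h₁ ⊢
    exact ⟨hl, by omega⟩
  · rintro ⟨h₂, h₃⟩
    have h₄ := lastPart_eq n h₂
    omega

end LastBlock

/-! ### Counted strings and valid diagrams -/

section Diagram

variable {d k : ℕ} {n m : Composition d} {r : Fin m.length} {c : ℕ} {D : Diagram n m k}
  {σ : Fin k → Step d}

/-- By connectedness every in-end is used at some step, and then its label is at most the block
active there, which is at most the last one. An in-end that is never used would be a closed set by
itself. -/
theorem Diagram.Valid.blk_last (hD : D.Valid r c) {t : Fin k} (ht : (t : ℕ) + 1 = k)
    (i : Fin n.length) : i ≤ D.blk t := by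
  by_cases h : ∃ s, D.Touches s (Sum.inl i)
  · obtain ⟨s, h | ⟨⟨b, h⟩, -⟩⟩ := h
    · have hs : D.blk s ≤ D.blk t :=
        index_mono n (hD.mono (Fin.le_def.2 (by have := s.2; omega)))
      rcases h with h | ⟨b, h⟩
      · exact (head_eq_inl h.symm).trans_le hs
      · exact ((hD.other_live s _ b h).2.2 i rfl).trans hs
    · simp at h
  · push Not at h
    have := hD.conn {Sum.inl i} (fun s a a' ha _ has => absurd (has ▸ ha) (h s))
      (Sum.inl i) (Sum.inr (t, true)) (n.one_le_blocksFun i) (hD.ow_pos t) rfl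
    simp at this

open Classical in
/-- The diagram of a string of transpositions and an order of the final components. -/
noncomputable def diagramOf (n m : Composition d) (σ : Fin k → Step d)
    (lab : Pt d → Fin m.length) : Diagram n m k where
  q t := (σ t).2
  other := partner n σ
  ow f := outWeight n σ f.1 f.2
  lab a := if h : ∃ y, (naming n σ k y).1 = a then some (lab h.choose) else none

theorem realizes_diagramOf {lab : Pt d → Fin m.length} {t : Fin k} (h : (σ t).1.1 < (σ t).2) :
    Realizes (diagramOf n m σ lab) σ t :=
  ⟨h, rfl, rfl, fun _ => rfl⟩

theorem IsOrdering.lab_eq_iff {lab : Pt d → Fin m.length}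
    (h : IsOrdering m (stage (rhoOf n) σ k) lab) (y z : Pt d) :
    lab y = lab z ↔ (naming n σ k y).1 = (naming n σ k z).1 := by
  rw [h.comp, (isNaming_naming σ le_rfl).mem_component (isFpf_stage σ k)]

theorem IsOrdering.diagramOf_lab {lab : Pt d → Fin m.length}
    (h : IsOrdering m (stage (rhoOf n) σ k) lab) (y : Pt d) :
    (diagramOf n m σ lab).lab (naming n σ k y).1 = some (lab y) := by
  have hex : ∃ z, (naming n σ k z).1 = (naming n σ k y).1 := ⟨y, rfl⟩
  unfold diagramOf
  simp only [dif_pos hex, Option.some.injEq]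
  rw [h.lab_eq_iff]
  exact hex.choose_spec

theorem diagramOf_lab_eq_some {lab : Pt d → Fin m.length}
    (h : IsOrdering m (stage (rhoOf n) σ k) lab) {a : Name n k} {j : Fin m.length}
    (ha : (diagramOf n m σ lab).lab a = some j) : ∃ y, (naming n σ k y).1 = a ∧ lab y = j := by
  by_cases hex : ∃ y, (naming n σ k y).1 = a
  · obtain ⟨y, rfl⟩ := hex
    rw [h.diagramOf_lab] at ha
    exact ⟨y, rfl, by simpa using ha⟩
  · simp only [diagramOf, dif_neg hex, reduceCtorEq] at ha

/-- Whenever a point changes its name, the old and the new name touch the same branch point. So a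
closed set of names cannot separate the successive names of a point. -/
theorem naming_mem_iff (hq : Monotone D.q) (h : ∀ s, Realizes D σ s) {S : Set (Name n k)}
    (hS : ∀ t a a', D.Touches t a → D.Touches t a' → a ∈ S → a' ∈ S) {t : ℕ} (ht : t ≤ k)
    (y : Pt d) : (naming n σ t y).1 ∈ S ↔ (naming n σ 0 y).1 ∈ S := by
  induction t with
  | zero => rfl
  | succ t ih =>
    rw [← ih (by omega)]
    set T : Fin k := ⟨t, ht⟩
    by_cases hm : Moved n σ T y
    · have h₁ : D.Touches T (naming n σ t y).1 :=
        Or.inl ((moved_iff_uses hq (fun s _ => h s) y).1 hm)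
      have h₂ : D.Touches T (naming n σ (t + 1) y).1 :=
        Or.inr ⟨naming_succ_of_moved hm, (live_naming hq ht (fun s _ => h s) y).1⟩
      exact ⟨hS T _ _ h₂ h₁, hS T _ _ h₁ h₂⟩
    · rw [show naming n σ (t + 1) y = naming n σ t y from naming_succ_of_not_moved hm]

theorem exists_naming_of_pos (hq : Monotone D.q) (h : ∀ s, Realizes D σ s) {a : Name n k}
    (ha : 0 < D.wt a) : ∃ t ≤ k, ∃ y, (naming n σ t y).1 = a := by
  rcases a with i | ⟨s, b⟩
  · obtain ⟨y, hy⟩ := exists_naming (t := 0) hq (Nat.zero_le k) (fun s _ => h s)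
      (a := Sum.inl i) ⟨ha, trivial, fun s hs => absurd hs (Nat.not_lt_zero _)⟩
    exact ⟨0, Nat.zero_le k, y, by rw [hy]⟩
  · obtain ⟨y, hy⟩ := exists_naming (t := s + 1) hq s.2 (fun s _ => h s)
      (a := Sum.inr (s, b)) ⟨ha, Nat.lt_succ_self s, fun s' hs' hu => by
        have h₁ : (s : ℕ) < s' := uses_born hq (fun s _ => h s) hu
        omega⟩
    exact ⟨s + 1, s.2, y, by rw [hy]⟩

theorem IsCounted.valid {lab : Pt d → Fin m.length} (hc : 1 ≤ c)
    (h : IsCounted n m r c σ lab) : (diagramOf n m σ lab).Valid r c := by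
  set D := diagramOf n m σ lab with hDdef
  have hq : Monotone D.q := h.transMono.mono
  have hlt := h.transMono.lt
  have hr : ∀ t, Realizes D σ t := fun t => realizes_diagramOf (hlt t)
  have hconn : ∀ S : Set (Name n k),
      (∀ t a a', D.Touches t a → D.Touches t a' → a ∈ S → a' ∈ S) →
      ∀ a a', 0 < D.wt a → 0 < D.wt a' → a ∈ S → a' ∈ S := by
    intro S hS a a' ha ha' haS
    obtain ⟨t, ht, y, rfl⟩ := exists_naming_of_pos hq hr ha
    obtain ⟨t', ht', y', rfl⟩ := exists_naming_of_pos hq hr ha'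
    rw [naming_mem_iff hq hr hS ht'] 
    rw [naming_mem_iff hq hr hS ht] at haS
    have htr := h.transMono.trans
    obtain ⟨⟨g, hg⟩, rfl⟩ := MulAction.exists_smul_eq
      (Subgroup.closure ({tau d, rhoOf n} ∪ Set.range fun i => (σ i).perm)) y y'
    -- Each generator preserves the set of points whose initial name lies in S: τ and ρ_n keep the
    -- block, and the names of p and q touch a common branch point. Transitivity then leaves no
    -- point outside.
    have hgen : ∀ s ∈ ({tau d, rhoOf n} ∪ Set.range fun i => (σ i).perm : Set (Equiv.Perm (Pt d))),
        ∀ z, (naming n σ 0 (s z)).1 ∈ S ↔ (naming n σ 0 z).1 ∈ S := by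
      have hN := isNaming_naming (n := n) σ (Nat.zero_le k)
      rintro s ((rfl | rfl) | ⟨t, rfl⟩) z
      · rw [hN.flip]
      · rw [show rhoOf n = stage (rhoOf n) σ 0 from rfl, hN.flip_rho (isFpf_stage σ 0)]
      · have hpq : (naming n σ 0 (σ t).1).1 ∈ S ↔ (naming n σ 0 ((σ t).2, false)).1 ∈ S := by
          rw [← naming_mem_iff hq hr hS t.2.le, ← naming_mem_iff hq hr hS t.2.le]
          have hu := Realizes.uses_iff hq (fun s (_ : s ≤ t) => hr s)
          have h₁ : D.Touches t (naming n σ t (σ t).1).1 := Or.inl ((hu _).2 (Or.inl rfl))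
          have h₂ : D.Touches t (naming n σ t ((σ t).2, false)).1 :=
            Or.inl ((hu _).2 (Or.inr rfl))
          exact ⟨hS t _ _ h₁ h₂, hS t _ _ h₂ h₁⟩
        change (naming n σ 0 (Equiv.swap (σ t).1 ((σ t).2, false) z)).1 ∈ S ↔ _
        rw [Equiv.swap_apply_def]
        split_ifs with h₁ h₂
        · rw [h₁, hpq]
        · rw [h₂, hpq]
        · rfl
    change (naming n σ 0 (g y)).1 ∈ S
    clear ha'
    have hall : ∀ z, (naming n σ 0 (g z)).1 ∈ S ↔ (naming n σ 0 z).1 ∈ S := by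
      induction hg using Subgroup.closure_induction with
      | mem s hs => exact hgen s hs
      | one => intro z; rfl
      | mul g g' _ _ ih ih' => intro z; rw [Equiv.Perm.mul_apply, ih, ih']
      | inv g _ ih => intro z; rw [← ih (g⁻¹ z)]; simp
    exact (hall y).2 haS
  refine ⟨hq, ?_, ?_, ?_, ?_, hconn, ?_, ?_, ?_, ?_, ?_, ?_⟩
  · intro t a b hab
    change partner n σ t = _ at hab
    rw [partner] at hab
    split_ifs at hab with e
    simp only [Option.some.injEq] at hab
    have ha : (naming n σ t (σ t).1).1 = a := by rw [hab]
    refine ⟨ha ▸ live_naming hq t.2.le (fun s _ => hr s) _, ?_, ?_⟩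
    · rw [naming_main hq (fun s _ => hr s) (hr t).q, ha] at e
      exact e
    · rintro i rfl
      rw [← index_of_naming t.2.le ha]
      exact index_mono n (hlt t).le
  · intro t
    exact outWeight_add hq (fun s _ => hr s) (hr t).q (hr t).other
  · intro t ht
    have hn : naming n σ t (σ t).1 = naming n σ t ((σ t).2, false) := by
      by_contra hne
      have := outWeight_side (hlt t) hne
      change 0 < outWeight n σ t false at ht
      omega
    exact if_pos (by rw [hn])
  · intro t
    exact outWeight_bound hq (fun s _ => hr s) (hr t).q (hlt t)
  · intro a
    rw [live_iff hq le_rfl (fun s _ => hr s)]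
    constructor
    · intro ha
      obtain ⟨j, hj⟩ := Option.isSome_iff_exists.1 ha
      obtain ⟨y, hy, -⟩ := diagramOf_lab_eq_some h.ordering hj
      exact ⟨y, hy⟩
    · rintro ⟨y, rfl⟩
      rw [h.ordering.diagramOf_lab]; rfl
  · intro a a' j hj hj'
    obtain ⟨y, rfl, rfl⟩ := diagramOf_lab_eq_some h.ordering hj
    obtain ⟨y', rfl, e⟩ := diagramOf_lab_eq_some h.ordering hj'
    exact (h.ordering.lab_eq_iff _ _).1 e.symm
  · intro j
    have h₁ := h.ordering.card j
    have h₂ := m.one_le_blocksFun j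
    obtain ⟨y, hy⟩ : {y | lab y = j}.Nonempty := by
      rw [← Set.ncard_pos]; omega
    exact ⟨_, by rw [h.ordering.diagramOf_lab, show lab y = j from hy]⟩
  · intro a j hj
    obtain ⟨y, rfl, rfl⟩ := diagramOf_lab_eq_some h.ordering hj
    have h₁ := h.ordering.card (lab y)
    have hl := live_naming hq le_rfl (fun s _ => hr s) y
    have h₂ : {z | lab z = lab y} = {z | (naming n σ k z).1 = (naming n σ k y).1} := by
      ext z
      exact h.ordering.lab_eq_iff z y
    rw [h₂, (isNaming_naming σ le_rfl).ncard_name isFpf_tau,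
      ncard_naming hq le_rfl (fun s _ => hr s) hl.2.1 hl.2.2] at h₁
    omega
  · intro t ht
    have h₁ := (last_position_iff n (σ t).2 hc).1 (h.last t ht)
    refine ⟨?_, h₁.2⟩
    have hd : d - 1 < d := by have := (σ t).2.2; omega
    have hz : ∀ s : Fin k, (s : ℕ) < k → D.q s ≤ ⟨d - 1, hd⟩ :=
      fun s _ => Fin.le_def.2 (by have := (D.q s).2; simp only; omega)
    have h₂ := naming_untouched (n := n) hq le_rfl (fun s _ => hlt s) (fun s _ => rfl) hz
    have h₃ : head n D.q k (n.index ⟨d - 1, hd⟩) = Sum.inr (t, true) := by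
      rw [show head n D.q k _ = head n D.q (t + 1) _ from congrArg (fun j => head n D.q j _) ht.symm,
        head_succ, if_pos]
      exact le_antisymm (index_mono n (hz t t.2)) (h₁.1 _)
    have h₄ := h.ordering.diagramOf_lab (⟨d - 1, hd⟩, false)
    rw [h₂, h₃, h.largest _ (by simp only; omega)] at h₄
    exact h₄
  · intro hk
    refine ⟨h.empty hk, fun i => ?_⟩
    have hd : d - 1 < d := by
      have := n.one_le_blocksFun i
      have := n.blocksFun_le i
      omega
    subst hk
    have h₄ := h.ordering.diagramOf_lab (⟨d - 1, hd⟩, false)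
    rw [h.largest _ (by simp only; omega)] at h₄
    -- Without branch points every set of names is closed, so there is only one in-end.
    have h₅ := hconn {Sum.inl i} (fun t => t.elim0) (Sum.inl i)
      (Sum.inl (n.index ⟨d - 1, hd⟩)) (n.one_le_blocksFun i) (n.one_le_blocksFun _) rfl
    rw [← h₅]
    exact h₄

theorem Diagram.Valid.exists_lab (hD : D.Valid r c) (h : ∀ s, Realizes D σ s) (y : Pt d) :
    ∃ j, D.lab (naming n σ k y).1 = some j :=
  Option.isSome_iff_exists.1
    ((hD.lab_some _).2 (live_naming hD.mono le_rfl (fun s _ => h s) y))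

/-- All the intermediate involutions lie in the group, so points that bear the same name, even at
different times, lie in one orbit. The names borne by the points of an orbit then form a closed set,
and `conn` makes this set contain the names of all points. -/
theorem Diagram.Valid.isPretransitive (hD : D.Valid r c) (h : ∀ s, Realizes D σ s) :
    MulAction.IsPretransitive
      (Subgroup.closure ({tau d, rhoOf n} ∪ Set.range fun i => (σ i).perm)) (Pt d) := by
  set G := Subgroup.closure ({tau d, rhoOf n} ∪ Set.range fun i => (σ i).perm) with hG
  have hτ : tau d ∈ G := Subgroup.subset_closure (by simp)
  have hρ : rhoOf n ∈ G := Subgroup.subset_closure (by simp)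
  have hs : ∀ t, Equiv.swap (σ t).1 ((σ t).2, false) ∈ G :=
    fun t => Subgroup.subset_closure (Or.inr ⟨t, rfl⟩)
  have hst : ∀ t, stage (rhoOf n) σ t ∈ G := by
    intro t
    induction t with
    | zero => exact hρ
    | succ t ih =>
      rw [stage]
      split_ifs with ht
      · exact mul_mem (mul_mem (hs _) ih) (inv_mem (hs _))
      · exact ih
  have hmem : ∀ {g : Equiv.Perm (Pt d)}, g ∈ G → ∀ y, MulAction.orbit G (g y) = MulAction.orbit G y :=
    fun {g} hg y => MulAction.orbit_smul (⟨g, hg⟩ : G) y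
  have hname : ∀ {t}, t ≤ k → ∀ y z, (naming n σ t y).1 = (naming n σ t z).1 →
      MulAction.orbit G y = MulAction.orbit G z := by
    intro t ht y z e
    rw [← (isNaming_naming σ ht).mem_component (isFpf_stage σ t),
      mem_component_iff (isFpf_stage σ t)] at e
    rcases e with ⟨i, rfl⟩ | ⟨i, hi⟩
    · rw [hmem (zpow_mem (mul_mem hτ (hst t)) i)]
    · rw [← hmem hτ z, ← hi, hmem (zpow_mem (mul_mem hτ (hst t)) i)]
  have hname' : ∀ {t t'}, t ≤ k → t' ≤ k → ∀ y z, (naming n σ t y).1 = (naming n σ t' z).1 →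
      MulAction.orbit G y = MulAction.orbit G z := by
    intro t t' ht ht' y z e
    rcases le_total t t' with htt | htt
    · have hb := born_naming (n := n) σ ht y
      have := naming_of_le htt ht' hb e.symm
      exact hname ht y z (by rw [e, this])
    · have hb := born_naming (n := n) σ ht' z
      have := naming_of_le htt ht hb e
      exact hname ht' y z (by rw [← e, this])
  constructor
  intro y z
  have key := hD.conn {a | ∃ t ≤ k, ∃ w, (naming n σ t w).1 = a ∧
    MulAction.orbit G w = MulAction.orbit G y} ?_ (naming n σ 0 y).1 (naming n σ 0 z).1
    (n.one_le_blocksFun _) (n.one_le_blocksFun _) ⟨0, Nat.zero_le k, y, rfl, rfl⟩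
  · obtain ⟨t, ht, w, hw, hwy⟩ := key
    have := hname' ht (Nat.zero_le k) w z hw
    rw [hwy] at this
    have hz : z ∈ MulAction.orbit G y := by rw [this]; exact MulAction.mem_orbit_self z
    exact hz
  · have htouch : ∀ t a, D.Touches t a → ∃ t' ≤ k, ∃ w, (naming n σ t' w).1 = a ∧
        MulAction.orbit G w = MulAction.orbit G (((σ t).2, false) : Pt d) := by
      have hpq : ∀ t, MulAction.orbit G (σ t).1 = MulAction.orbit G (((σ t).2, false) : Pt d) := by
        intro t
        rw [← hmem (hs t) (σ t).1, Equiv.swap_apply_left]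
      rintro t a (hu | ⟨⟨b, rfl⟩, hw⟩)
      · rcases (Realizes.uses_iff hD.mono (fun s _ => h s) a).1 hu with rfl | rfl
        · exact ⟨t, t.2.le, _, rfl, hpq t⟩
        · exact ⟨t, t.2.le, _, rfl, rfl⟩
      · obtain ⟨t', ht', w, hw⟩ := exists_naming_of_pos hD.mono h hw
        refine ⟨t', ht', w, hw, ?_⟩
        have htt : (t : ℕ) + 1 ≤ t' := by
          have := born_naming (n := n) σ ht' w
          rw [hw] at this
          exact this
        have e := naming_of_le htt ht' (a := Sum.inr (t, b)) (Nat.lt_succ_self (t : ℕ)) hw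
        rw [e] at hw
        have hm : Moved n σ t w := by
          by_contra hm
          rw [naming_succ_of_not_moved hm] at hw
          exact naming_ne σ t b w hw
        rcases hm with e | e
        · rw [hname t.2.le _ _ e, hpq]
        · rw [hname t.2.le _ _ e]
    rintro t a a' ha ha' ⟨t', ht', w, hw, hwy⟩
    obtain ⟨t₁, ht₁, w₁, hw₁, ho₁⟩ := htouch t a ha
    obtain ⟨t₂, ht₂, w₂, hw₂, ho₂⟩ := htouch t a' ha'
    refine ⟨t₂, ht₂, w₂, hw₂, ?_⟩
    rw [ho₂, ← ho₁, ← hwy]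
    exact hname' ht₁ ht' _ _ (hw₁.trans hw.symm)

theorem Diagram.Valid.isCounted (hc : 1 ≤ c) (hD : D.Valid r c)
    (h : ∀ s, Realizes D σ s) {lab : Pt d → Fin m.length}
    (hlab : ∀ y, D.lab (naming n σ k y).1 = some (lab y)) : IsCounted n m r c σ lab where
  transMono :=
    { lt := fun i => (h i).lt
      mono := fun i j hij => by simp only [← (h _).q]; exact hD.mono hij
      trans := hD.isPretransitive h }
  ordering := by
    have hN := isNaming_naming (n := n) σ le_rfl
    have hiff : ∀ y z, lab y = lab z ↔ (naming n σ k y).1 = (naming n σ k z).1 := by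
      intro y z
      constructor
      · intro e
        exact hD.lab_inj _ _ _ (hlab y) (e ▸ hlab z)
      · intro e
        have := hlab y
        rw [e, hlab z] at this
        simpa using this.symm
    refine ⟨fun y z => ?_, fun j => ?_⟩
    · rw [hiff, hN.mem_component (isFpf_stage σ k)]
    · obtain ⟨a, ha⟩ := hD.lab_surj j
      have hl : D.Live k a := (hD.lab_some a).1 (by rw [ha]; rfl)
      have h₁ : {y | lab y = j} = {y | (naming n σ k y).1 = a} := by
        ext y
        constructor
        · rintro rfl
          exact hD.lab_inj _ _ _ (hlab y) ha
        · rintro rfl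
          have := hlab y
          rw [ha] at this
          simpa using this.symm
      rw [h₁, hN.ncard_name isFpf_tau, ncard_naming hD.mono le_rfl (fun s _ => h s) hl.2.1 hl.2.2,
        hD.lab_wt a j ha]
  largest := by
    intro y hy
    have hz : ∀ s : Fin k, (s : ℕ) < k → D.q s ≤ y :=
      fun s _ => Fin.le_def.2 (by have := (D.q s).2; omega)
    have h₁ := naming_untouched (n := n) hD.mono le_rfl (fun s _ => (h s).lt) (fun s _ => (h s).q) hz
    have h₂ := hlab (y, false)
    rw [h₁] at h₂
    rcases Nat.eq_zero_or_pos k with hk | hk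
    · subst hk
      have h₃ := (hD.final_zero rfl).2 (n.index y)
      change D.lab (Sum.inl _) = _ at h₂
      rw [h₃] at h₂
      simpa using h₂.symm
    · set t : Fin k := ⟨k - 1, by omega⟩
      have ht : (t : ℕ) + 1 = k := by simp only [t]; omega
      have h₃ : head n D.q k (n.index y) = Sum.inr (t, true) := by
        rw [show head n D.q k _ = head n D.q (t + 1) _ from
          congrArg (fun j => head n D.q j _) ht.symm, head_succ, if_pos]
        exact le_antisymm (index_mono n (hz t t.2)) (hD.blk_last ht _)
      rw [h₃, (hD.final t ht).1] at h₂
      simpa using h₂.symm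
  last := by
    intro t ht
    rw [← (h t).q]
    exact (last_position_iff n (D.q t) hc).2 ⟨hD.blk_last ht, (hD.final t ht).2⟩
  empty := fun hk => (hD.final_zero hk).1

theorem diagramOf_eq (hq : Monotone D.q) (hl : ∀ a, (D.lab a).isSome ↔ D.Live k a)
    (h : ∀ s, Realizes D σ s) {lab : Pt d → Fin m.length}
    (hlab : ∀ y, D.lab (naming n σ k y).1 = some (lab y)) : diagramOf n m σ lab = D := by
  ext1
  · funext t; exact (h t).q.symm
  · funext t; exact (h t).other.symm
  · funext ⟨t, b⟩; exact ((h t).ow b).symm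
  · funext a
    by_cases hex : ∃ y, (naming n σ k y).1 = a
    · unfold diagramOf
      simp only [dif_pos hex]
      rw [← hlab, hex.choose_spec]
    · unfold diagramOf
      simp only [dif_neg hex]
      rw [← live_iff hq le_rfl (fun s _ => h s), ← hl] at hex
      exact (Option.not_isSome_iff_eq_none.1 hex).symm

/-- An output weighs at most the sum of two earlier edges, so weights at most double. The crude
bound only serves to make the set of valid diagrams finite. -/
theorem Diagram.Valid.wt_le (hD : D.Valid r c) (t : ℕ) {a : Name n k} (ha : Born t a) :
    D.wt a ≤ 2 ^ t * d := by
  induction t generalizing a with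
  | zero =>
    rcases a with i | ⟨s, b⟩
    · exact (n.blocksFun_le i).trans (by simp)
    · exact absurd ha (Nat.not_lt_zero _)
  | succ t ih =>
    rcases a with i | ⟨s, b⟩
    · refine (n.blocksFun_le i).trans (Nat.le_mul_of_pos_left _ (by positivity))
    · have hst : (s : ℕ) ≤ t := Nat.lt_succ_iff.1 ha
      have h₁ := hD.conserve s
      have h₂ : D.wt (D.main s) ≤ 2 ^ t * d := ih ((born_head _ _ _).mono hst)
      have h₃ : ((D.other s).elim 0 fun f => D.wt f.1) ≤ 2 ^ t * d := by
        rcases ho : D.other s with _ | f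
        · simp
        · exact ih ((hD.other_live s f.1 f.2 ho).1.2.1.mono hst)
      have h₄ : D.wt (Sum.inr (s, b)) ≤ D.ow (s, true) + D.ow (s, false) := by
        cases b
        · exact Nat.le_add_left _ _
        · exact Nat.le_add_right _ _
      rw [pow_succ]
      nlinarith

instance finite_valid : Finite {D : Diagram n m k // D.Valid r c} := by
  let f : {D : Diagram n m k // D.Valid r c} → (Fin k → Fin d) × (Fin k → Option (Name n k × Bool)) ×
      (Fin k × Bool → Fin (2 ^ k * d + 1)) × (Name n k → Option (Fin m.length)) :=
    fun D => (D.1.q, D.1.other, fun s => ⟨D.1.ow s,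
      Nat.lt_succ_iff.2 (D.2.wt_le k (a := Sum.inr s) s.1.2)⟩, D.1.lab)
  refine Finite.of_injective f fun D D' e => Subtype.ext ?_
  simp only [f, Prod.mk.injEq] at e
  obtain ⟨h₁, h₂, h₃, h₄⟩ := e
  ext1
  · exact h₁
  · exact h₂
  · funext s
    exact Fin.mk.inj (congrFun h₃ s)
  · exact h₄

open scoped Classical in
-- The fibre of `diagramOf` over D consists of the strings that realize D, each with exactly one
-- order of the final components, namely that given by the labels in D. All of these strings have
-- the same weight.
theorem sum_factWeight (hd : 0 < d) (hc : 1 ≤ c) :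
    ∑ f : (Fin k → Step d) × (Pt d → Fin m.length) with IsCounted n m r c f.1 f.2,
      factWeight (rhoOf n) f.1 = ∑ᶠ D : {D : Diagram n m k // D.Valid r c}, D.1.weight := by
  have := Fintype.ofFinite {D : Diagram n m k // D.Valid r c}
  rw [finsum_eq_sum_of_fintype, ← Finset.sum_subtype_eq_sum_filter]
  let Φ : {f : (Fin k → Step d) × (Pt d → Fin m.length) // IsCounted n m r c f.1 f.2} →
      {D : Diagram n m k // D.Valid r c} := fun f => ⟨diagramOf n m f.1.1 f.1.2, f.2.valid hc⟩
  rw [← Finset.sum_fiberwise_of_maps_to (g := Φ) (t := Finset.univ) (fun _ _ => Finset.mem_univ _)]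
  refine Finset.sum_congr rfl fun D _ => ?_
  have hreal : ∀ f, Φ f = D → ∀ t, Realizes D.1 f.1.1 t := by
    rintro f rfl t
    exact realizes_diagramOf (f.2.transMono.lt t)
  rw [Finset.sum_congr rfl fun f hf => D.2.factWeight_eq (hreal f (Finset.mem_filter.1 hf).2),
    Finset.sum_const, Diagram.weight, Finset.prod_mul_distrib, nsmul_eq_mul, mul_comm]
  congr 1
  rw [← Nat.cast_prod, ← D.2.ncard_realizing hd, ← Set.ncard_coe_finset]
  congr 1
  refine Set.ncard_congr (fun f _ => f.1.1) (fun f hf => ?_) (fun f f' hf hf' e => ?_)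
    (fun σ hσ => ?_)
  · exact hreal f (Finset.mem_filter.1 hf).2
  · replace hf : Φ f = D := (Finset.mem_filter.1 hf).2
    replace hf' : Φ f' = D := (Finset.mem_filter.1 hf').2
    obtain ⟨⟨σ, lab⟩, h⟩ := f
    obtain ⟨⟨σ', lab'⟩, h'⟩ := f'
    change σ = σ' at e
    subst e
    have h₁ : lab = lab' := by
      funext y
      have h₁ := h.ordering.diagramOf_lab y
      have h₂ := h'.ordering.diagramOf_lab y
      have h₃ : diagramOf n m σ lab = diagramOf n m σ lab' :=
        congrArg Subtype.val (hf.trans hf'.symm)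
      simp only at h₁ h₂
      rw [h₃, h₂] at h₁
      simpa using h₁.symm
    subst h₁
    rfl
  · choose lab hlab using D.2.exists_lab hσ
    refine ⟨⟨(σ, lab), D.2.isCounted hc hσ hlab⟩, ?_, rfl⟩
    refine Finset.mem_filter.2 ⟨Finset.mem_subtype.2 (Finset.mem_univ _), Subtype.ext ?_⟩
    exact diagramOf_eq D.2.mono D.2.lab_some hσ hlab

end Diagram
end RefinedHurwitz

namespace RefinedHurwitz

section Canonical

variable {d k : ℕ} {n m : Composition d} {D : Diagram n m k} {r : Fin m.length} {c : ℕ}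

/-! ### The cover defined by a diagram -/

theorem Diagram.Valid.blk_mono (hD : D.Valid r c) : Monotone D.blk :=
  fun _ _ h => index_mono n (hD.mono h)

theorem Diagram.Valid.main_of_lt (hD : D.Valid r c) {s t : Fin k} (hst : s < t)
    (h : D.blk s = D.blk t) : ∃ u : Fin k, (u : ℕ) + 1 = t ∧ D.main t = Sum.inr (u, true) := by
  obtain ⟨t', ht'⟩ : ∃ t' : ℕ, t' + 1 = t := ⟨(t : ℕ) - 1, by have := Fin.lt_def.1 hst; omega⟩
  have hk : t' < k := by omega
  refine ⟨⟨t', hk⟩, ht', ?_⟩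
  have h₁ : D.blk s ≤ D.blk ⟨t', hk⟩ := hD.blk_mono (Fin.le_def.2 (by
    have := Fin.lt_def.1 hst; simp only; omega))
  have h₂ : D.blk ⟨t', hk⟩ ≤ D.blk t := hD.blk_mono (Fin.le_def.2 (by simp only; omega))
  unfold Diagram.main
  rw [← ht']
  refine (head_succ ⟨t', hk⟩ _).trans (if_pos ?_)
  exact le_antisymm h₂ (h ▸ h₁)

theorem Diagram.Valid.blk_of_main (_hD : D.Valid r c) {t : Fin k} {i : Fin n.length}
    (h : D.main t = Sum.inl i) : D.blk t = i :=
  (head_eq_inl h).symm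

/-- If the main name is an output, it is that of the preceding step and thus too young to have been
used before. If it is an in-end, the block was not active before, and an earlier join of this in-end
would need an earlier active block with at least its label. -/
theorem Diagram.Valid.live_main (hD : D.Valid r c) (t : Fin k) : D.Live t (D.main t) := by
  refine ⟨?_, born_head _ _ _, ?_⟩
  · rcases h : D.main t with i | ⟨s, b⟩
    · exact n.one_le_blocksFun i
    · obtain ⟨-, rfl, -⟩ := head_eq_inr h
      exact hD.ow_pos s
  · rintro s hst (h | ⟨b, h⟩)
    · rcases h₁ : D.main t with i | ⟨u, b⟩
      · obtain ⟨u, -, h₂⟩ := hD.main_of_lt hst (by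
          rw [hD.blk_of_main h₁, hD.blk_of_main (h.symm.trans h₁)])
        rw [h₁] at h₂
        cases h₂
      · have h₂ := (head_eq_inr h₁).1
        have h₃ := (head_eq_inr (h.symm.trans h₁)).1
        omega
    · obtain ⟨h₁, h₂, h₃⟩ := hD.other_live s _ _ h
      rcases h₄ : D.main t with i | ⟨u, b⟩
      · have h₅ := h₃ i h₄
        rw [← hD.blk_of_main h₄] at h₅
        obtain ⟨u, -, h₂⟩ := hD.main_of_lt hst (le_antisymm (hD.blk_mono hst.le) h₅)
        rw [h₄] at h₂
        cases h₂
      · have h₅ := (head_eq_inr h₄).1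
        have h₆ := h₁.2.1
        rw [h₄] at h₆
        change (u : ℕ) < s at h₆
        omega

namespace Diagram

variable (D) in
/-- The strand `b` of the edge named `a` ends at the preferred vertex over `t`. -/
def Slot (t : Fin k) (a : Name n k) (b : Bool) : Prop :=
  (a = D.main t ∧ b = true) ∨ D.other t = some (a, b)

variable (D) in
/-- There is a single vertex over `t`. -/
def IsTwist (t : Fin k) : Prop := D.ow (t, false) = 0 ∧ D.other t = none

variable (D) in
-- Two mirror vertices over each branch point, of which only the flag `true` survives over a twist.
abbrev Vert : Type := {v : Fin k × Bool // D.IsTwist v.1 → v.2 = true}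

variable (D) in
abbrev Edge : Type := {a : Name n k // 0 < D.wt a} × Bool

open scoped Classical in
variable (D) in
-- Over a twist both flags give the same vertex, so that source and target of an edge can be defined
-- without distinguishing cases.
noncomputable def vtx (t : Fin k) (b : Bool) : D.Vert :=
  ⟨(t, if D.IsTwist t then true else b), fun h => if_pos h⟩

@[simp] theorem vtx_fst (t : Fin k) (b : Bool) : (D.vtx t b).1.1 = t := rfl

theorem vtx_eq_iff {s t : Fin k} {b b' : Bool} :
    D.vtx s b = D.vtx t b' ↔ s = t ∧ (b = b' ∨ D.IsTwist t) := by
  constructor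
  · intro h
    obtain rfl : s = t := congrArg (fun v : D.Vert => v.1.1) h
    refine ⟨rfl, ?_⟩
    by_cases hs : D.IsTwist s
    · exact Or.inr hs
    · have := congrArg (fun v : D.Vert => v.1.2) h
      simp only [vtx, if_neg hs] at this
      exact Or.inl this
  · rintro ⟨rfl, rfl | h⟩
    · rfl
    · simp only [vtx, if_pos h]

theorem vtx_surj (v : D.Vert) : D.vtx v.1.1 v.1.2 = v := by
  obtain ⟨⟨t, b⟩, h⟩ := v
  simp only [vtx, Subtype.mk.injEq, Prod.mk.injEq, true_and]
  split_ifs with h'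
  · exact (h h').symm
  · rfl

theorem Vert.cases {P : D.Vert → Prop} (h : ∀ t b, P (D.vtx t b)) (v : D.Vert) : P v :=
  vtx_surj v ▸ h _ _

variable (D) in
noncomputable def flip (v : D.Vert) : D.Vert := D.vtx v.1.1 (!v.1.2)

theorem flip_vtx (t : Fin k) (b : Bool) : D.flip (D.vtx t b) = D.vtx t (!b) := by
  unfold flip
  rw [vtx_eq_iff]
  refine ⟨rfl, ?_⟩
  by_cases h : D.IsTwist t
  · exact Or.inr h
  · simp [vtx, h]

theorem flip_flip (v : D.Vert) : D.flip (D.flip v) = v := by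
  induction v using Vert.cases with
  | h t b => rw [flip_vtx, flip_vtx, Bool.not_not]

variable (D) in
noncomputable def src (e : D.Edge) : Option D.Vert :=
  Sum.elim (fun _ => none) (fun s => some (D.vtx s.1 e.2)) e.1.1

open scoped Classical in
variable (D) in
-- The recorded strand ends at the preferred vertex, the other one at its mirror image. By
-- `Valid.slot_unique` the chosen slot is the only one.
noncomputable def tgt (e : D.Edge) : Option D.Vert :=
  if h : ∃ f : Fin k × Bool, D.Slot f.1 e.1.1 f.2 then
    some (D.vtx h.choose.1 (e.2 == h.choose.2)) else none

theorem src_eq_some {a : {a : Name n k // 0 < D.wt a}} {b β : Bool} {t : Fin k} :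
    D.src (a, b) = some (D.vtx t β) ↔ (∃ b', a.1 = Sum.inr (t, b')) ∧ (b = β ∨ D.IsTwist t) := by
  obtain ⟨i | ⟨s, b'⟩, h⟩ := a
  · simp [src]
  · simp only [src, Sum.elim_inr, Option.some.injEq, vtx_eq_iff, Sum.inr.injEq, Prod.mk.injEq]
    constructor
    · rintro ⟨rfl, h⟩; exact ⟨⟨_, rfl, rfl⟩, h⟩
    · rintro ⟨⟨_, rfl, -⟩, h⟩; exact ⟨rfl, h⟩

theorem src_eq_none {e : D.Edge} : D.src e = none ↔ ∃ i, e.1.1 = Sum.inl i := by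
  obtain ⟨⟨i | s, h⟩, b⟩ := e <;> simp [src]

theorem Valid.live_slot (hD : D.Valid r c) {t : Fin k} {a : Name n k} {b : Bool}
    (h : D.Slot t a b) : D.Live t a := by
  rcases h with ⟨rfl, -⟩ | h
  · exact hD.live_main t
  · exact (hD.other_live t a b h).1

theorem Slot.uses {t : Fin k} {a : Name n k} {b : Bool} (h : D.Slot t a b) : D.Uses t a := by
  rcases h with ⟨rfl, -⟩ | h
  · exact Or.inl rfl
  · exact Or.inr ⟨b, h⟩

theorem Uses.slot {t : Fin k} {a : Name n k} (h : D.Uses t a) : ∃ b, D.Slot t a b := by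
  rcases h with rfl | ⟨b, h⟩
  · exact ⟨true, Or.inl ⟨rfl, rfl⟩⟩
  · exact ⟨b, Or.inr h⟩

theorem slot_main (t : Fin k) : D.Slot t (D.main t) true := Or.inl ⟨rfl, rfl⟩

/-- A name used at one branch point is no longer live at a later one, and a partner is never the
main name. -/
theorem Valid.slot_unique (hD : D.Valid r c) {t t' : Fin k} {a : Name n k} {b b' : Bool}
    (h : D.Slot t a b) (h' : D.Slot t' a b') : t = t' ∧ b = b' := by
  obtain rfl : t = t' := by
    rcases lt_trichotomy t t' with hlt | rfl | hlt
    · exact absurd h.uses ((hD.live_slot h').2.2 t hlt)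
    · rfl
    · exact absurd h'.uses ((hD.live_slot h).2.2 t' hlt)
  refine ⟨rfl, ?_⟩
  rcases h with ⟨h₁, rfl⟩ | h <;> rcases h' with ⟨h₂, rfl⟩ | h'
  · rfl
  · exact absurd h₁ (hD.other_live _ _ _ h').2.1
  · exact absurd h₂ (hD.other_live _ _ _ h).2.1
  · rw [h] at h'; simpa using h'

theorem Valid.tgt_of_slot (hD : D.Valid r c) {t : Fin k} {a : {a : Name n k // 0 < D.wt a}}
    {b b' : Bool} (h : D.Slot t a.1 b') : D.tgt (a, b) = some (D.vtx t (b == b')) := by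
  have hex : ∃ f : Fin k × Bool, D.Slot f.1 a.1 f.2 := ⟨(t, b'), h⟩
  simp only [tgt, dif_pos hex]
  obtain ⟨h₁, h₂⟩ := hD.slot_unique hex.choose_spec h
  rw [h₁, h₂]

theorem tgt_eq_none {e : D.Edge} : D.tgt e = none ↔ ∀ t, ¬ D.Uses t e.1.1 := by
  unfold tgt
  split_ifs with h
  · obtain ⟨f, hf⟩ := h
    simp only [false_iff, not_forall, not_not]
    exact ⟨f.1, hf.uses⟩
  · simp only [true_iff]
    intro t ht
    obtain ⟨b, hb⟩ := ht.slot
    exact h ⟨(t, b), hb⟩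

theorem Valid.tgt_eq_some (hD : D.Valid r c) {a : {a : Name n k // 0 < D.wt a}} {b β : Bool}
    {t : Fin k} : D.tgt (a, b) = some (D.vtx t β) ↔
      ∃ b', D.Slot t a.1 b' ∧ ((b == b') = β ∨ D.IsTwist t) := by
  constructor
  · intro h
    have h₁ : ¬ ∀ t, ¬ D.Uses t a.1 := fun h₁ => by
      rw [tgt_eq_none.2 h₁] at h; cases h
    push Not at h₁
    obtain ⟨s, hs⟩ := h₁
    obtain ⟨b', hb'⟩ := hs.slot
    rw [hD.tgt_of_slot hb', Option.some.injEq, vtx_eq_iff] at h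
    obtain ⟨rfl, h⟩ := h
    exact ⟨b', hb', h⟩
  · rintro ⟨b', h, h'⟩
    rw [hD.tgt_of_slot h, Option.some.injEq, vtx_eq_iff]
    exact ⟨rfl, h'⟩

variable (hD : D.Valid r c)
include hD

theorem Valid.wt_main_pos (t : Fin k) : 0 < D.wt (D.main t) := (hD.live_main t).1

theorem Valid.in_join {t : Fin k} {a : Name n k} {b : Bool} (h : D.other t = some (a, b))
    (β : Bool) : {e | D.tgt e = some (D.vtx t β)} =
      {(⟨D.main t, hD.wt_main_pos t⟩, β), (⟨a, (hD.other_live t a b h).1.1⟩, b == β)} := by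
  have hn : ¬ D.IsTwist t := fun h' => by rw [h'.2] at h; cases h
  ext ⟨⟨a', ha'⟩, b₁⟩
  simp only [Set.mem_ofPred_eq, hD.tgt_eq_some, Slot, h, hn, or_false, Set.mem_insert_iff,
    Set.mem_singleton_iff, Prod.mk.injEq, Subtype.mk.injEq, Option.some.injEq]
  constructor
  · rintro ⟨b', ⟨rfl, rfl⟩ | ⟨rfl, rfl⟩, h₁⟩
    · left; simpa using h₁
    · right; revert h₁; cases b₁ <;> cases β <;> cases b <;> simp
  · rintro (⟨rfl, rfl⟩ | ⟨rfl, rfl⟩)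
    · exact ⟨true, Or.inl ⟨rfl, rfl⟩, by simp⟩
    · exact ⟨b, Or.inr ⟨rfl, rfl⟩, by cases β <;> cases b <;> rfl⟩

theorem Valid.in_cut {t : Fin k} (h : 0 < D.ow (t, false))
    (β : Bool) : {e | D.tgt e = some (D.vtx t β)} = {(⟨D.main t, hD.wt_main_pos t⟩, β)} := by
  have hn : ¬ D.IsTwist t := fun h' => by have := h'.1; omega
  ext ⟨⟨a', ha'⟩, b₁⟩
  simp only [Set.mem_ofPred_eq, hD.tgt_eq_some, Slot, hD.side t h, hn, or_false,
    Set.mem_singleton_iff, Prod.mk.injEq, Subtype.mk.injEq, reduceCtorEq]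
  constructor
  · rintro ⟨b', ⟨rfl, rfl⟩, h₁⟩
    simpa using h₁
  · rintro ⟨rfl, rfl⟩
    exact ⟨true, ⟨rfl, rfl⟩, by simp⟩

theorem Valid.in_twist {t : Fin k} (h : D.IsTwist t)
    (β : Bool) : {e | D.tgt e = some (D.vtx t β)} =
      {(⟨D.main t, hD.wt_main_pos t⟩, true), (⟨D.main t, hD.wt_main_pos t⟩, false)} := by
  ext ⟨⟨a', ha'⟩, b₁⟩
  simp only [Set.mem_ofPred_eq, hD.tgt_eq_some, Slot, h.2, h, or_true, and_true, reduceCtorEq,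
    or_false, Set.mem_insert_iff, Set.mem_singleton_iff, Prod.mk.injEq, Subtype.mk.injEq]
  cases b₁ <;> simp

theorem Valid.out_one {t : Fin k} (h : ¬ D.IsTwist t) (h₀ : D.ow (t, false) = 0) (β : Bool) :
    {e | D.src e = some (D.vtx t β)} = {(⟨Sum.inr (t, true), hD.ow_pos t⟩, β)} := by
  ext ⟨⟨a', ha'⟩, b₁⟩
  simp only [Set.mem_ofPred_eq, src_eq_some, h, or_false, Set.mem_singleton_iff, Prod.mk.injEq,
    Subtype.ext_iff]
  constructor
  · rintro ⟨⟨b', rfl⟩, rfl⟩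
    cases b'
    · exact absurd h₀ (Nat.pos_iff_ne_zero.1 ha')
    · exact ⟨rfl, rfl⟩
  · rintro ⟨rfl, rfl⟩
    exact ⟨⟨true, rfl⟩, rfl⟩

theorem Valid.out_cut {t : Fin k} (h : 0 < D.ow (t, false)) (β : Bool) :
    {e | D.src e = some (D.vtx t β)} =
      {(⟨Sum.inr (t, true), hD.ow_pos t⟩, β), (⟨Sum.inr (t, false), h⟩, β)} := by
  have hn : ¬ D.IsTwist t := fun h' => by have := h'.1; omega
  ext ⟨⟨a', ha'⟩, b₁⟩
  simp only [Set.mem_ofPred_eq, src_eq_some, hn, or_false, Set.mem_insert_iff,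
    Set.mem_singleton_iff, Prod.mk.injEq, Subtype.ext_iff]
  constructor
  · rintro ⟨⟨b', rfl⟩, rfl⟩
    cases b' <;> simp
  · rintro (⟨rfl, rfl⟩ | ⟨rfl, rfl⟩) <;> exact ⟨⟨_, rfl⟩, rfl⟩

theorem Valid.out_twist {t : Fin k} (h : D.IsTwist t) (β : Bool) :
    {e | D.src e = some (D.vtx t β)} =
      {(⟨Sum.inr (t, true), hD.ow_pos t⟩, true), (⟨Sum.inr (t, true), hD.ow_pos t⟩, false)} := by
  ext ⟨⟨a', ha'⟩, b₁⟩
  simp only [Set.mem_ofPred_eq, src_eq_some, h, or_true, and_true, Set.mem_insert_iff,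
    Set.mem_singleton_iff, Prod.mk.injEq, Subtype.ext_iff]
  constructor
  · rintro ⟨b', rfl⟩
    cases b'
    · exact absurd h.1 (Nat.pos_iff_ne_zero.1 ha')
    · cases b₁ <;> simp
  · rintro (⟨rfl, rfl⟩ | ⟨rfl, rfl⟩) <;> exact ⟨_, rfl⟩

omit hD in
theorem cut_or_join_or_twist (t : Fin k) : 0 < D.ow (t, false) ∨
    (D.ow (t, false) = 0 ∧ ∃ a b, D.other t = some (a, b)) ∨ D.IsTwist t := by
  rcases Nat.eq_zero_or_pos (D.ow (t, false)) with h | h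
  · rcases ho : D.other t with _ | ⟨a, b⟩
    · exact Or.inr (Or.inr ⟨h, ho⟩)
    · exact Or.inr (Or.inl ⟨h, a, b, rfl⟩)
  · exact Or.inl h

end Diagram
end Canonical
end RefinedHurwitz

open scoped ENNReal
namespace RefinedHurwitz

/-! ### The metric, the involution and the ends of the cover of a diagram -/

section Canonical

variable {d k : ℕ} {n m : Composition d} {D : Diagram n m k} {r : Fin m.length} {c : ℕ}

namespace Diagram

variable (D) in
-- The only lengths compatible with the slopes.
noncomputable def len (x : Fin k → ℝ) (e : D.Edge) : ℝ≥0∞ :=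
  match D.src e, D.tgt e with
  | some u, some v => ENNReal.ofReal (x v.1.1 - x u.1.1) / D.wt e.1.1
  | _, _ => ⊤

theorem len_of_some {x : Fin k → ℝ} {e : D.Edge} {u v : D.Vert} (h : D.src e = some u)
    (h' : D.tgt e = some v) : D.len x e = ENNReal.ofReal (x v.1.1 - x u.1.1) / D.wt e.1.1 := by
  simp only [len, h, h']

theorem len_eq_top {x : Fin k → ℝ} {e : D.Edge} :
    D.len x e = ⊤ ↔ D.src e = none ∨ D.tgt e = none := by
  rcases h : D.src e with _ | u
  · simp [len, h]
  · rcases h' : D.tgt e with _ | v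
    · simp [len, h, h']
    · rw [len_of_some h h']
      simp only [reduceCtorEq, or_self, iff_false]
      refine (ENNReal.div_lt_top ENNReal.ofReal_ne_top ?_).ne
      exact_mod_cast e.1.2.ne'

theorem Valid.lt_of_src_tgt (hD : D.Valid r c) {e : D.Edge} {u v : D.Vert}
    (h : D.src e = some u) (h' : D.tgt e = some v) : u.1.1 < v.1.1 := by
  obtain ⟨a, b⟩ := e
  rw [← vtx_surj u, src_eq_some] at h
  rw [← vtx_surj v, hD.tgt_eq_some] at h'
  obtain ⟨⟨b', hb'⟩, -⟩ := h
  obtain ⟨b'', hs, -⟩ := h'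
  have := (hD.live_slot hs).2.1
  rw [hb'] at this
  exact this

theorem Valid.balanced (hD : D.Valid r c) (v : D.Vert) :
    ∑ᶠ (e) (_ : D.tgt e = some v), D.wt e.1.1 = ∑ᶠ (e) (_ : D.src e = some v), D.wt e.1.1 := by
  induction v using Vert.cases with
  | h t β =>
  have hc := hD.conserve t
  change ∑ᶠ (e) (_ : e ∈ {e | D.tgt e = some _}), D.wt e.1.1 =
    ∑ᶠ (e) (_ : e ∈ {e | D.src e = some _}), D.wt e.1.1
  rcases cut_or_join_or_twist (D := D) t with h | ⟨h, a, b, ho⟩ | h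
  · rw [hD.in_cut h, hD.out_cut h, finsum_mem_singleton, finsum_mem_pair (by simp [Subtype.ext_iff])]
    rw [hD.side t h] at hc
    exact hc.symm
  · rw [hD.in_join ho, hD.out_one (fun h' => by rw [h'.2] at ho; cases ho) h, finsum_mem_singleton,
      finsum_mem_pair]
    · rw [ho, h] at hc
      exact hc.symm
    · intro e
      exact (hD.other_live t a b ho).2.1 (congrArg (fun e : D.Edge => e.1.1) e).symm
  -- Both strands pass through the single vertex of a twist, so both sides of the balancing
  -- condition are doubled.
  · rw [hD.in_twist h, hD.out_twist h, finsum_mem_pair (by simp), finsum_mem_pair (by simp)]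
    rw [h.1, h.2] at hc
    have : D.ow (t, true) = D.wt (D.main t) := hc
    change D.wt (D.main t) + D.wt (D.main t) = D.ow (t, true) + D.ow (t, true)
    rw [this]

/-- The tropical cover defined by a diagram. -/
noncomputable def Valid.tropical (hD : D.Valid r c) {x : Fin k → ℝ} (hx : StrictMono x) :
    TropicalCover x where
  V := D.Vert
  E := D.Edge
  fintypeV := Fintype.ofFinite _
  fintypeE := Fintype.ofFinite _
  pt v := v.1.1
  src := D.src
  tgt := D.tgt
  src_lt_tgt _ _ _ h h' := hD.lt_of_src_tgt h h'
  wt e := D.wt e.1.1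
  wt_pos e := e.1.2
  len := D.len x
  len_end _ := len_eq_top
  len_inner e u v h h' := by
    have h₁ := hx (hD.lt_of_src_tgt h h')
    rw [len_of_some h h', ENNReal.mul_div_cancel]
    · exact_mod_cast e.1.2.ne'
    · exact ENNReal.natCast_ne_top _
  balanced := hD.balanced

variable (D) in
def flipEdge (e : D.Edge) : D.Edge := (e.1, !e.2)

theorem src_flipEdge (e : D.Edge) : D.src (D.flipEdge e) = (D.src e).map D.flip := by
  obtain ⟨⟨i | ⟨t, b'⟩, h⟩, b⟩ := e
  · rfl
  · exact congrArg some (flip_vtx t b).symm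

theorem Valid.tgt_flipEdge (hD : D.Valid r c) (e : D.Edge) :
    D.tgt (D.flipEdge e) = (D.tgt e).map D.flip := by
  obtain ⟨a, b⟩ := e
  by_cases h : ∀ t, ¬ D.Uses t a.1
  · rw [tgt_eq_none.2 h, tgt_eq_none.2 h]; rfl
  · push Not at h
    obtain ⟨t, ht⟩ := h
    obtain ⟨b', hb'⟩ := ht.slot
    rw [flipEdge, hD.tgt_of_slot hb', hD.tgt_of_slot hb', Option.map_some, flip_vtx]
    congr 2
    cases b <;> cases b' <;> rfl

theorem flip_fst (v : D.Vert) : (D.flip v).1.1 = v.1.1 := rfl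

theorem Valid.len_flipEdge (hD : D.Valid r c) (x : Fin k → ℝ) (e : D.Edge) :
    D.len x (D.flipEdge e) = D.len x e := by
  unfold len
  rw [src_flipEdge, hD.tgt_flipEdge]
  rcases D.src e with _ | u <;> rcases D.tgt e with _ | v <;> rfl

theorem ncard_fibre_of_twist {t : Fin k} (h : D.IsTwist t) :
    Set.ncard {v : D.Vert | v.1.1 = t} = 1 := by
  rw [Set.ncard_eq_one]
  refine ⟨D.vtx t true, ?_⟩
  ext v
  induction v using Vert.cases with
  | h s b =>
  simp only [Set.mem_ofPred_eq, Set.mem_singleton_iff, vtx_fst, vtx_eq_iff]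
  constructor
  · rintro rfl; exact ⟨rfl, Or.inr h⟩
  · exact fun h => h.1

theorem ncard_fibre_of_not_twist {t : Fin k} (h : ¬ D.IsTwist t) :
    Set.ncard {v : D.Vert | v.1.1 = t} = 2 := by
  rw [Set.ncard_eq_two]
  refine ⟨D.vtx t true, D.vtx t false, ?_, ?_⟩
  · simp [vtx_eq_iff, h]
  · ext v
    induction v using Vert.cases with
    | h s b =>
    simp only [Set.mem_ofPred_eq, Set.mem_singleton_iff, Set.mem_insert_iff, vtx_fst, vtx_eq_iff]
    constructor
    · rintro rfl; cases b <;> simp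
    · rintro (h | h) <;> exact h.1

variable (hD : D.Valid r c) {x : Fin k → ℝ} (hx : StrictMono x)

noncomputable def Valid.inv : TropicalCover.Iso (hD.tropical hx) (hD.tropical hx) where
  onV := Function.Involutive.toPerm D.flip flip_flip
  onE := Function.Involutive.toPerm D.flipEdge fun e => Prod.ext rfl (Bool.not_not e.2)
  pt_eq := flip_fst
  src_eq := src_flipEdge
  tgt_eq := hD.tgt_flipEdge
  wt_eq _ := rfl
  len_eq := hD.len_flipEdge x

theorem Valid.inDeg_of_not_cut {t : Fin k} (h : D.ow (t, false) = 0) (β : Bool) :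
    (hD.tropical hx).inDeg (D.vtx t β) = 2 := by
  change Set.ncard {e : D.Edge | D.tgt e = some (D.vtx t β)} = 2
  rcases cut_or_join_or_twist (D := D) t with h' | ⟨-, a, b, ho⟩ | h'
  · omega
  · rw [hD.in_join ho, Set.ncard_pair]
    intro e
    exact (hD.other_live t a b ho).2.1 (congrArg (fun e : D.Edge => e.1.1) e).symm
  · rw [hD.in_twist h', Set.ncard_pair (by simp)]

theorem Valid.inDeg_of_cut {t : Fin k} (h : 0 < D.ow (t, false)) (β : Bool) :
    (hD.tropical hx).inDeg (D.vtx t β) = 1 := by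
  change Set.ncard {e : D.Edge | D.tgt e = some (D.vtx t β)} = 1
  rw [hD.in_cut h, Set.ncard_singleton]

theorem Valid.outDeg_of_join {t : Fin k} (h : D.ow (t, false) = 0) (h' : ¬ D.IsTwist t) (β : Bool) :
    (hD.tropical hx).outDeg (D.vtx t β) = 1 := by
  change Set.ncard {e : D.Edge | D.src e = some (D.vtx t β)} = 1
  rw [hD.out_one h' h, Set.ncard_singleton]

theorem Valid.outDeg_of_twist {t : Fin k} (h' : D.IsTwist t) (β : Bool) :
    (hD.tropical hx).outDeg (D.vtx t β) = 2 := by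
  change Set.ncard {e : D.Edge | D.src e = some (D.vtx t β)} = 2
  rw [hD.out_twist h', Set.ncard_pair (by simp)]

theorem Valid.outDeg_of_cut {t : Fin k} (h : 0 < D.ow (t, false)) (β : Bool) :
    (hD.tropical hx).outDeg (D.vtx t β) = 2 := by
  change Set.ncard {e : D.Edge | D.src e = some (D.vtx t β)} = 2
  rw [hD.out_cut h, Set.ncard_pair (by simp [Subtype.ext_iff])]

theorem Valid.valence_of_twist {t : Fin k} (h : D.IsTwist t) (β : Bool) :
    (hD.tropical hx).valence (D.vtx t β) = 4 := by
  change (hD.tropical hx).inDeg _ + (hD.tropical hx).outDeg _ = 4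
  rw [hD.outDeg_of_twist hx h, hD.inDeg_of_not_cut hx h.1]

theorem Valid.valence_of_not_twist {t : Fin k} (h : ¬ D.IsTwist t) (β : Bool) :
    (hD.tropical hx).valence (D.vtx t β) = 3 := by
  change (hD.tropical hx).inDeg _ + (hD.tropical hx).outDeg _ = 3
  rcases Nat.eq_zero_or_pos (D.ow (t, false)) with h' | h'
  · rw [hD.outDeg_of_join hx h' h, hD.inDeg_of_not_cut hx h']
  · rw [hD.outDeg_of_cut hx h', hD.inDeg_of_cut hx h']

theorem Valid.adjacent_of_touches {t : Fin k} {a : Name n k} (h : D.Touches t a) :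
    ∃ h : 0 < D.wt a, ∃ β, (hD.tropical hx).Adjacent ((⟨a, h⟩, β) : D.Edge) (D.vtx t true) := by
  rcases h with h | ⟨⟨b, rfl⟩, h⟩
  · obtain ⟨b, hb⟩ := h.slot
    refine ⟨(hD.live_slot hb).1, b, Or.inr ?_⟩
    refine (hD.tgt_of_slot (a := ⟨a, (hD.live_slot hb).1⟩) hb).trans ?_
    rw [beq_self_eq_true]
    rfl
  · exact ⟨h, true, Or.inl rfl⟩

/-- The names occurring in one equivalence class of edges form a closed set, since the involution
identifies the two strands of each name. Hence `conn` applies. -/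
theorem Valid.connected (e e' : D.Edge) : Relation.EqvGen
    (fun f f' => f' = (hD.inv hx).onE f ∨ ∃ v, (hD.tropical hx).Adjacent f v ∧
      (hD.tropical hx).Adjacent f' v) e e' := by
  set R : D.Edge → D.Edge → Prop := fun f f' => f' = (hD.inv hx).onE f ∨
    ∃ v, (hD.tropical hx).Adjacent f v ∧ (hD.tropical hx).Adjacent f' v
  have hflip : ∀ (a : {a : Name n k // 0 < D.wt a}) (b b' : Bool),
      Relation.EqvGen R (a, b) (a, b') := by
    intro a b b'
    by_cases h : b' = b
    · rw [h]; exact Relation.EqvGen.refl _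
    · refine Relation.EqvGen.rel _ _ (Or.inl ?_)
      change (a, b') = (a, !b)
      rw [Bool.eq_not_of_ne h]
  have hS := hD.conn {a | ∃ h β, Relation.EqvGen R e (⟨a, h⟩, β)} ?_ e.1.1 e'.1.1 e.1.2 e'.1.2
    ⟨e.1.2, e.2, Relation.EqvGen.refl _⟩
  · obtain ⟨h, β, h'⟩ := hS
    exact h'.trans _ _ _ (hflip _ _ _)
  · rintro t a a' ha ha' ⟨h, β, h'⟩
    obtain ⟨h₁, β₁, hA₁⟩ := hD.adjacent_of_touches hx ha
    obtain ⟨h₂, β₂, hA₂⟩ := hD.adjacent_of_touches hx ha'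
    refine ⟨h₂, β₂, (h'.trans _ _ _ (hflip _ _ β₁)).trans _ _ _ ?_⟩
    exact Relation.EqvGen.rel _ _ (Or.inr ⟨_, hA₁, hA₂⟩)

theorem Valid.lab_eq_iff_exists (hD : D.Valid r c) (a : Name n k) :
    (∃ j, D.lab a = some j) ↔ 0 < D.wt a ∧ ∀ t, ¬ D.Uses t a := by
  rw [← Option.isSome_iff_exists, hD.lab_some]
  constructor
  · rintro ⟨h₁, -, h₂⟩
    exact ⟨h₁, fun t => h₂ t t.2⟩
  · rintro ⟨h₁, h₂⟩
    refine ⟨h₁, ?_, fun t _ => h₂ t⟩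
    rcases a with i | ⟨t, b⟩
    · trivial
    · exact t.2

noncomputable def Valid.outName (hD : D.Valid r c) (j : Fin m.length) : {a : Name n k // 0 < D.wt a} :=
  ⟨(hD.lab_surj j).choose,
    ((hD.lab_eq_iff_exists _).1 ⟨j, (hD.lab_surj j).choose_spec⟩).1⟩

theorem Valid.lab_outName (hD : D.Valid r c) (j : Fin m.length) :
    D.lab (hD.outName j).1 = some j := (hD.lab_surj j).choose_spec

theorem Valid.outName_eq (hD : D.Valid r c) {a : {a : Name n k // 0 < D.wt a}} {j : Fin m.length}
    (h : D.lab a.1 = some j) : hD.outName j = a :=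
  Subtype.ext (hD.lab_inj _ _ j (hD.lab_outName j) h)

/-- The twisted tropical cover defined by a diagram. -/
noncomputable def Valid.twisted : TwistedCover x n m where
  toTropicalCover := hD.tropical hx
  inv := hD.inv hx
  inv_inv_V := flip_flip
  inv_inv_E e := Prod.ext rfl (Bool.not_not e.2)
  fibre t := by
    by_cases h : D.IsTwist t
    · right
      refine ⟨ncard_fibre_of_twist h, ?_⟩
      · intro v hv
        induction v using Vert.cases with
        | h s b =>
        obtain rfl : s = t := hv
        exact hD.valence_of_twist hx h b
    · left
      refine ⟨ncard_fibre_of_not_twist h, ?_⟩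
      · intro v hv
        induction v using Vert.cases with
        | h s b =>
        obtain rfl : s = t := hv
        exact hD.valence_of_not_twist hx h b
  four_wt v e e' hv he he' := by
    induction v using Vert.cases with
    | h t β =>
    have h : D.IsTwist t := by
      by_contra h
      rw [hD.valence_of_not_twist hx h] at hv
      omega
    have hc := hD.conserve t
    rw [h.1, h.2] at hc
    replace hc : D.ow (t, true) = D.wt (D.main t) := hc
    have key : ∀ e : D.Edge, (hD.tropical hx).Adjacent e (D.vtx t β) →
        D.wt e.1.1 = D.wt (D.main t) := by
      rintro e (h' | h')
      · have h₁ : e ∈ {e | D.src e = some (D.vtx t β)} := h'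
        rw [hD.out_twist h] at h₁
        rcases h₁ with rfl | rfl <;> exact hc
      · have h₁ : e ∈ {e | D.tgt e = some (D.vtx t β)} := h'
        rw [hD.in_twist h] at h₁
        rcases h₁ with rfl | rfl <;> rfl
    exact (key e he).trans (key e' he').symm
  fixed_V v := by
    induction v using Vert.cases with
    | h t β =>
    change D.flip (D.vtx t β) = D.vtx t β ↔ _
    rw [flip_vtx, vtx_eq_iff]
    by_cases h : D.IsTwist t
    · simp [h, hD.valence_of_twist hx h β]
    · simp [h, hD.valence_of_not_twist hx h β]
  fixed_E e h := Bool.not_ne_self _ (congrArg Prod.snd h)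
  inEnd f := (⟨Sum.inl f.1, n.one_le_blocksFun f.1⟩, f.2)
  inEnd_inj f f' h := Prod.ext (Sum.inl_injective (congrArg (fun e : D.Edge => e.1.1) h))
    (congrArg (fun e : D.Edge => e.2) h)
  inEnd_range e := by
    refine src_eq_none.trans ⟨?_, ?_⟩
    · rintro ⟨i, hi⟩
      exact ⟨(i, e.2), Prod.ext (Subtype.ext hi.symm) rfl⟩
    · rintro ⟨f, rfl⟩
      exact ⟨f.1, rfl⟩
  inEnd_inv _ _ := rfl
  inEnd_wt _ _ := rfl
  -- Which strand receives the label j and which q + j is arbitrary. This is harmless because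
  -- isomorphisms may exchange these two labels.
  outEnd f := (hD.outName f.1, f.2)
  outEnd_inj f f' h := by
    refine Prod.ext ?_ (congrArg (fun e : D.Edge => e.2) h)
    have h₁ := hD.lab_outName f.1
    rw [show hD.outName f.1 = hD.outName f'.1 from congrArg (fun e : D.Edge => e.1) h,
      hD.lab_outName] at h₁
    exact (Option.some.inj h₁).symm
  outEnd_range e := by
    refine tgt_eq_none.trans ⟨?_, ?_⟩
    · intro h
      obtain ⟨j, hj⟩ := (hD.lab_eq_iff_exists _).2 ⟨e.1.2, h⟩
      exact ⟨(j, e.2), Prod.ext (hD.outName_eq hj) rfl⟩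
    · rintro ⟨f, rfl⟩
      exact ((hD.lab_eq_iff_exists _).1 ⟨_, hD.lab_outName f.1⟩).2
  outEnd_inv _ _ := rfl
  outEnd_wt j _ := hD.lab_wt _ _ (hD.lab_outName j)
  connected := hD.connected hx

end Diagram
end Canonical
end RefinedHurwitz

/-! ### Colours, counters and chains of the cover of a diagram -/

namespace RefinedHurwitz

section Canonical

variable {d k : ℕ} {n m : Composition d} {D : Diagram n m k} {r : Fin m.length} {c : ℕ}

namespace Diagram

/-- The names of the pairs of edges one of which is not normal. -/
def IsSpine : Name n k → Prop
  | Sum.inl _ => True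
  | Sum.inr (_, b) => b = true

theorem isSpine_main (t : Fin k) : IsSpine (D.main t) := by
  rcases h : D.main t with i | ⟨s, b⟩
  · trivial
  · exact (head_eq_inr h).2.1

open scoped Classical in
variable (D) in
-- The non-normal edges are the strands `true` of the in-ends and of the main outputs. Such an edge
-- is bold precisely if it is later the main edge of a branch point.
noncomputable def col (e : D.Edge) : Colour :=
  if e.2 = true ∧ IsSpine e.1.1 then
    if ∃ t, e.1.1 = D.main t then Colour.bold else Colour.dashed
  else Colour.normal

theorem col_ne_normal {e : D.Edge} : D.col e ≠ Colour.normal ↔ e.2 = true ∧ IsSpine e.1.1 := by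
  unfold col
  split_ifs with h h' <;> simp [h]

theorem col_eq_bold {e : D.Edge} : D.col e = Colour.bold ↔ e.2 = true ∧ ∃ t, e.1.1 = D.main t := by
  unfold col
  split_ifs with h h'
  · simp [h, h']
  · simp [h']
  · simp only [false_iff]
    rintro ⟨h₁, t, h₂⟩
    exact h ⟨h₁, h₂ ▸ isSpine_main t⟩

variable (D) in
-- The value on normal edges is a dummy: neither the conditions on covers nor the isomorphisms look
-- at it.
def cnt (e : D.Edge) : ℕ := Sum.elim (fun _ => 1) (fun s => D.ctr s.1) e.1.1

variable (hD : D.Valid r c) {x : Fin k → ℝ} (hx : StrictMono x)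

/-- The coloured cover defined by a diagram. -/
noncomputable def Valid.coloured : ColouredCover x n m where
  toTwistedCover := hD.twisted hx
  col := D.col
  cnt := D.cnt

variable (D) in
/-- The name `a` belongs to the chain that begins at the in-end labelled `p + i`. -/
def FromChain (i : Fin n.length) (a : Name n k) : Prop :=
  a = Sum.inl i ∨ ∃ t, a = Sum.inr (t, true) ∧ D.blk t = i

theorem fromChain_main (t : Fin k) : D.FromChain (D.blk t) (D.main t) := by
  rcases h : D.main t with i | ⟨s, b⟩
  · exact Or.inl (by rw [head_eq_inl h])
  · obtain ⟨-, rfl, h₂⟩ := head_eq_inr h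
    exact Or.inr ⟨s, rfl, h₂⟩

theorem FromChain.unique {i j : Fin n.length} {a : Name n k} (h : D.FromChain i a)
    (h' : D.FromChain j a) : i = j := by
  rcases h with rfl | ⟨t, rfl, rfl⟩ <;> rcases h' with h' | ⟨t', h', rfl⟩
  · exact Sum.inl_injective h'
  · cases h'
  · cases h'
  · simp only [Sum.inr.injEq, Prod.mk.injEq, and_true] at h'
    rw [h']

theorem IsSpine.fromChain {a : Name n k} (h : IsSpine a) : ∃ i, D.FromChain i a := by
  rcases a with i | ⟨t, b⟩
  · exact ⟨i, Or.inl rfl⟩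
  · obtain rfl : b = true := h
    exact ⟨_, Or.inr ⟨t, rfl, rfl⟩⟩

theorem FromChain.isSpine {i : Fin n.length} {a : Name n k} (h : D.FromChain i a) : IsSpine a := by
  rcases h with rfl | ⟨t, rfl, -⟩
  · trivial
  · rfl

theorem Valid.tgt_main (hD : D.Valid r c) (t : Fin k) (b : Bool) :
    D.tgt (⟨D.main t, hD.wt_main_pos t⟩, b) = some (D.vtx t b) := by
  rw [hD.tgt_of_slot (slot_main t)]
  simp

theorem Valid.of_arises {i : Fin n.length} {e : (hD.coloured hx).E}
    (h : (hD.coloured hx).Arises i e) :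
    (e : D.Edge).2 = true ∧ D.FromChain i (e : D.Edge).1.1 := by
  induction h with
  | start => exact ⟨rfl, Or.inl rfl⟩
  | next e e' v _ h₁ h₂ h₃ h₄ ih =>
    change D.Edge at e e'
    change D.Vert at v
    obtain ⟨-, t, ht⟩ := col_eq_bold.1 h₁
    obtain ⟨h₅, h₆⟩ := col_ne_normal.1 h₄
    refine ⟨h₅, ?_⟩
    have h₇ : D.tgt (e.1, e.2) = some v := h₂
    rw [hD.tgt_of_slot (Or.inl ⟨ht, rfl⟩)] at h₇
    obtain rfl : _ = v := Option.some.inj h₇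
    obtain ⟨⟨b', hb'⟩, -⟩ := (src_eq_some (a := e'.1) (b := e'.2)).1 h₃
    rw [hb'] at h₆ ⊢
    obtain rfl : b' = true := h₆
    refine Or.inr ⟨t, rfl, ?_⟩
    have := fromChain_main (D := D) t
    rw [← ht] at this
    exact this.unique ih.2

theorem Valid.arises_inl (i : Fin n.length) (h : 0 < D.wt (Sum.inl i)) :
    (hD.coloured hx).Arises i ((⟨Sum.inl i, h⟩, true) : D.Edge) :=
  ColouredCover.Arises.start

/-- Induction along the chain: the main edge of a step is the in-end of its block or the main output
of the preceding step, which belongs to the same block. -/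
theorem Valid.arises_inr (t : Fin k) (h : 0 < D.wt (Sum.inr (t, true))) :
    (hD.coloured hx).Arises (D.blk t) ((⟨Sum.inr (t, true), h⟩, true) : D.Edge) := by
  induction hN : (t : ℕ) using Nat.strong_induction_on generalizing t with
  | _ N ih =>
  have key : ∀ (a : Name n k) (ha : 0 < D.wt a), D.main t = a →
      (hD.coloured hx).Arises (D.blk t) ((⟨a, ha⟩, true) : D.Edge) := by
    intro a ha h₀
    rcases a with i | ⟨s, b⟩
    · obtain rfl := head_eq_inl h₀
      exact hD.arises_inl hx _ ha
    · obtain ⟨h₁, rfl, h₂⟩ := head_eq_inr h₀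
      have h₃ := ih s (by omega) s ha rfl
      rwa [show D.blk s = D.blk t from h₂] at h₃
  let e₀ : (hD.coloured hx).E := ((⟨D.main t, hD.wt_main_pos t⟩, true) : D.Edge)
  exact ColouredCover.Arises.next e₀ _ (D.vtx t true) (key _ _ rfl) (col_eq_bold.2 ⟨rfl, t, rfl⟩)
    (hD.tgt_main t true) rfl (col_ne_normal.2 ⟨rfl, rfl⟩)

theorem Valid.arises_iff (i : Fin n.length) (e : D.Edge) :
    (hD.coloured hx).Arises i e ↔ e.2 = true ∧ D.FromChain i e.1.1 := by
  refine ⟨hD.of_arises hx, ?_⟩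
  obtain ⟨⟨a, ha⟩, b⟩ := e
  rintro ⟨rfl, rfl | ⟨t, rfl, rfl⟩⟩
  · exact hD.arises_inl hx i ha
  · exact hD.arises_inr hx t ha

theorem Valid.onChain_iff (i : Fin n.length) (v : D.Vert) :
    (hD.coloured hx).OnChain i v ↔ ∃ t, v = D.vtx t true ∧ D.blk t = i := by
  constructor
  · rintro ⟨e, h₁, h₂, h₃⟩
    change D.Edge at e
    obtain ⟨h₄, t, ht⟩ := col_eq_bold.1 h₂
    have h₇ : D.tgt (e.1, e.2) = some v := h₃
    rw [hD.tgt_of_slot (Or.inl ⟨ht, rfl⟩), h₄] at h₇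
    refine ⟨t, (Option.some.inj h₇).symm, ?_⟩
    have := fromChain_main (D := D) t
    rw [← ht] at this
    exact this.unique ((hD.arises_iff hx i e).1 h₁).2
  · rintro ⟨t, rfl, rfl⟩
    exact ⟨((⟨D.main t, hD.wt_main_pos t⟩, true) : D.Edge),
      (hD.arises_iff hx _ _).2 ⟨rfl, fromChain_main t⟩, col_eq_bold.2 ⟨rfl, t, rfl⟩,
      hD.tgt_main t true⟩

/-- Going back through the main edges of one block ends at the in-end of this block. -/
theorem exists_main_eq_inl (t : Fin k) : ∃ s, D.main s = Sum.inl (D.blk t) ∧ D.blk s = D.blk t := by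
  induction hN : (t : ℕ) using Nat.strong_induction_on generalizing t with
  | _ N ih =>
  rcases h : D.main t with i | ⟨s, b⟩
  · exact ⟨t, by rw [h, ← head_eq_inl h], rfl⟩
  · obtain ⟨h₁, -, h₂⟩ := head_eq_inr h
    obtain ⟨u, h₃, h₄⟩ := ih s (by omega) s rfl
    have h₂' : D.blk s = D.blk t := h₂
    exact ⟨u, by rw [h₃, h₂'], h₄.trans h₂'⟩

theorem Valid.hasChain_iff (i : Fin n.length) :
    (hD.coloured hx).HasChain i ↔ ∃ t, D.blk t = i := by
  refine (col_eq_bold (D := D)).trans ?_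
  constructor
  · rintro ⟨-, t, ht⟩
    exact ⟨t, (head_eq_inl ht.symm).symm⟩
  · rintro ⟨t, rfl⟩
    obtain ⟨s, hs, -⟩ := exists_main_eq_inl (D := D) t
    exact ⟨rfl, s, hs.symm⟩

theorem Valid.lt_of_blk_lt (hD : D.Valid r c) {s t : Fin k} (h : D.blk s < D.blk t) : s < t :=
  hD.blk_mono.reflect_lt h

theorem Valid.tgt_inl {i : Fin n.length} {b : Bool} {v : D.Vert}
    (h : (hD.coloured hx).tgt ((hD.coloured hx).inEnd (i, b)) = some v) :
    ∃ t, D.Uses t (Sum.inl i) ∧ v.1.1 = t := by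
  replace h : D.tgt (⟨Sum.inl i, n.one_le_blocksFun i⟩, b) = some v := h
  rw [← vtx_surj v, hD.tgt_eq_some] at h
  obtain ⟨b', h, -⟩ := h
  exact ⟨_, h.uses, rfl⟩

theorem Valid.main_eq_inl_unique (hD : D.Valid r c) {s t : Fin k} {i : Fin n.length}
    (h : D.main s = Sum.inl i) (h' : D.Uses t (Sum.inl i)) : s = t := by
  obtain ⟨b, hb⟩ := h'.slot
  exact (hD.slot_unique (Or.inl ⟨h.symm, rfl⟩) hb).1

/-- The monotone twisted tropical cover defined by a diagram. -/
noncomputable def Valid.cover : MonotoneCover x n m where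
  toColouredCover := hD.coloured hx
  in_normal i := by
    have := (col_ne_normal (D := D) (e := (⟨Sum.inl i, n.one_le_blocksFun i⟩, false))).not
    rw [not_not] at this
    exact this.2 (by simp)
  in_not_normal i := col_ne_normal.2 ⟨rfl, trivial⟩
  bold_tgt e h := by
    obtain ⟨-, t, ht⟩ := col_eq_bold.1 h
    intro h'
    exact tgt_eq_none.1 h' t (Or.inl ht)
  -- The active block increases weakly along the string, so different chains occupy separate
  -- stretches of branch points.
  chain_disjoint i i' hne u v u' v' hu hv hu' hv' := by
    obtain ⟨s, rfl, hs⟩ := (hD.onChain_iff hx _ _).1 hu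
    obtain ⟨t, rfl, ht⟩ := (hD.onChain_iff hx _ _).1 hv
    obtain ⟨s', rfl, hs'⟩ := (hD.onChain_iff hx _ _).1 hu'
    obtain ⟨t', rfl, ht'⟩ := (hD.onChain_iff hx _ _).1 hv'
    change Disjoint (Set.Icc (x s) (x t)) (Set.Icc (x s') (x t'))
    rw [Set.disjoint_left]
    rintro y ⟨h₁, h₂⟩ ⟨h₃, h₄⟩
    rcases lt_or_gt_of_ne hne with h | h
    · have := hx (hD.lt_of_blk_lt (s := t) (t := s') (by rw [ht, hs']; exact h))
      linarith
    · have := hx (hD.lt_of_blk_lt (s := t') (t := s) (by rw [hs, ht']; exact h))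
      linarith
  chain_order i i' v v' h h' ht ht' := by
    change D.Vert at v v'
    obtain ⟨-, s, hs⟩ := col_eq_bold.1 h
    obtain ⟨-, s', hs'⟩ := col_eq_bold.1 h'
    obtain ⟨t, h₁, h₂⟩ := hD.tgt_inl hx ht
    obtain ⟨t', h₁', h₂'⟩ := hD.tgt_inl hx ht'
    obtain rfl := hD.main_eq_inl_unique hs.symm h₁
    obtain rfl := hD.main_eq_inl_unique hs'.symm h₁'
    change x v.1.1 < x v'.1.1 ↔ _
    rw [h₂, h₂', hx.lt_iff_lt]
    have e : i = D.blk s := head_eq_inl hs.symm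
    have e' : i' = D.blk s' := head_eq_inl hs'.symm
    rw [e, e']
    refine ⟨fun h₃ => lt_of_le_of_ne (hD.blk_mono h₃.le) fun h₄ => ?_, hD.lt_of_blk_lt⟩
    have h₅ : D.main s = D.main s' := by
      rw [← show Sum.inl i = D.main s from hs, ← show Sum.inl i' = D.main s' from hs', e, e', h₄]
    exact absurd (hD.slot_unique (slot_main s) (Or.inl ⟨h₅, rfl⟩)).1 h₃.ne
  chain_label i j b v w hv hw ht := by
    obtain ⟨s, rfl, rfl⟩ := (hD.onChain_iff hx _ _).1 hv
    have h₁ : (w : D.Vert).1.1 = s := by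
      rcases hw with rfl | rfl <;> rfl
    obtain ⟨t, h₂, h₃⟩ := hD.tgt_inl hx ht
    obtain rfl : s = t := h₁.symm.trans h₃
    rcases h₂ with h₂ | ⟨b, h₂⟩
    · exact (head_eq_inl h₂.symm).le
    · exact (hD.other_live _ _ _ h₂).2.2 j rfl
  in_counter i := rfl
  vertex v := by
    change D.Vert at v
    obtain ⟨t, b, rfl⟩ : ∃ t b, v = D.vtx t b := ⟨_, _, (vtx_surj v).symm⟩
    refine ⟨D.vtx t true, ?_, ((⟨D.main t, hD.wt_main_pos t⟩, true) : D.Edge),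
      ((⟨Sum.inr (t, true), hD.ow_pos t⟩, true) : D.Edge), ?_, ?_, ?_⟩
    · cases b
      · exact Or.inr (flip_vtx t false).symm
      · exact Or.inl rfl
    · rintro f
      change D.Edge at f
      constructor
      · rintro ⟨h₁, h₂⟩
        obtain ⟨h₃, s, hs⟩ := col_eq_bold.1 h₂
        have h₄ : D.tgt (f.1, f.2) = some (D.vtx t true) := h₁
        rw [hD.tgt_of_slot (Or.inl ⟨hs, rfl⟩), Option.some.injEq, vtx_eq_iff] at h₄
        obtain rfl := h₄.1
        exact Prod.ext (Subtype.ext hs) h₃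
      · rintro rfl
        exact ⟨hD.tgt_main t true, col_eq_bold.2 ⟨rfl, t, rfl⟩⟩
    · rintro f
      change D.Edge at f
      constructor
      · rintro ⟨h₁, h₂⟩
        obtain ⟨h₃, h₄⟩ := col_ne_normal.1 h₂
        obtain ⟨⟨b', h₅⟩, -⟩ := (src_eq_some (a := f.1) (b := f.2)).1 h₁
        rw [h₅] at h₄
        obtain rfl : b' = true := h₄
        exact Prod.ext (Subtype.ext h₅) h₃
      · rintro rfl
        exact ⟨rfl, col_ne_normal.2 ⟨rfl, rfl⟩⟩
    · change Sum.elim (fun _ => 1) (fun s => D.ctr s.1) (D.main t) ≤ D.ctr t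
      -- The incoming counter is 1 at an in-end. Otherwise the preceding step worked in the same
      -- block, and the monotonicity of `q` compares the positions.
      rcases h : D.main t with i | ⟨s, b⟩
      · exact Nat.le_add_left _ _
      · obtain ⟨h₁, -, h₂⟩ := head_eq_inr h
        exact Nat.succ_le_succ ((le_iff_offset_le n h₂).1 (hD.mono (Fin.le_def.2 (by omega))))
  unique_chain e h := by
    obtain ⟨h₁, h₂⟩ := col_ne_normal.1 h
    obtain ⟨i, hi⟩ := h₂.fromChain (D := D)
    exact ⟨i, (hD.arises_iff hx i e).2 ⟨h₁, hi⟩,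
      fun j hj => ((hD.arises_iff hx j e).1 hj).2.unique hi⟩
  counter_bounds i e h := by
    change D.Edge at e
    replace h := ((hD.arises_iff hx i e).1 h).2
    change n.blocksFun i < Sum.elim (fun _ => 1) (fun s => D.ctr s.1) e.1.1 + D.wt e.1.1 ∧
      Sum.elim (fun _ => 1) (fun s => D.ctr s.1) e.1.1 ≤ _
    rcases h with h | ⟨t, h, rfl⟩ <;> rw [h]
    · have h₁ := n.one_le_blocksFun i
      change _ < 1 + n.blocksFun i ∧ 1 ≤ _
      omega
    · have h₁ := hD.bound t
      have h₂ := offset_lt (n := n) (D.q t)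
      refine ⟨?_, h₂⟩
      rw [add_comm]
      exact h₁

theorem Valid.isOfType : (hD.cover hx).IsOfType r c := by
  have hout : ∀ a : {a : Name n k // 0 < D.wt a}, D.lab a.1 = some r → IsSpine a.1 →
      D.col (a, true) = Colour.dashed ∧ (a, true) = (hD.outName r, true) := by
    intro a ha hs
    refine ⟨?_, by rw [hD.outName_eq ha]⟩
    have h₁ := ((hD.lab_eq_iff_exists _).1 ⟨r, ha⟩).2
    rw [col, if_pos ⟨rfl, hs⟩, if_neg]
    rintro ⟨t, ht⟩
    exact h₁ t (Or.inl ht)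
  rcases Nat.eq_zero_or_pos k with hk | hk
  · obtain ⟨h₁, h₂⟩ := hD.final_zero hk
    obtain ⟨i | ⟨t, b⟩, ha⟩ := hD.lab_surj r
    · obtain ⟨h₃, h₄⟩ := hout ⟨Sum.inl i, n.one_le_blocksFun i⟩ ha trivial
      exact ⟨i, Or.inl hk, _, true, (hD.arises_iff hx i _).2 ⟨rfl, Or.inl rfl⟩, h₃, h₄, h₁.symm⟩
    · subst hk
      exact t.elim0
  · have ht : ((⟨k - 1, by omega⟩ : Fin k) : ℕ) + 1 = k := by simp only; omega
    set t : Fin k := ⟨k - 1, by omega⟩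
    obtain ⟨h₁, h₂⟩ := hD.final t ht
    obtain ⟨h₃, h₄⟩ := hout ⟨Sum.inr (t, true), hD.ow_pos t⟩ h₁ rfl
    refine ⟨D.blk t, Or.inr ⟨(hD.hasChain_iff hx _).2 ⟨t, rfl⟩, ?_⟩, _, true,
      (hD.arises_iff hx _ _).2 ⟨rfl, Or.inr ⟨t, rfl, rfl⟩⟩, h₃, h₄, h₂⟩
    intro j hj
    obtain ⟨s, rfl⟩ := (hD.hasChain_iff hx _).1 hj
    exact hD.blk_mono (Fin.le_def.2 (by have := s.2; omega))

end Diagram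
end Canonical
end RefinedHurwitz

/-! ### The multiplicity of the cover of a diagram -/

namespace RefinedHurwitz

section Canonical

variable {d k : ℕ} {n m : Composition d} {D : Diagram n m k} {r : Fin m.length} {c : ℕ}

namespace MonotoneCover

variable {x : Fin k → ℝ} (C : MonotoneCover x n m) {v : C.V}

theorem twistNumber_eq {i : Fin n.length} {e : C.E} (hs : C.src e = some v) (ha : C.Arises i e)
    (h : ∀ j f, C.src f = some v → C.Arises j f → j = i ∧ f = e) :
    C.twistNumber v = (C.wt e : ℤ) - n.blocksFun i + C.cnt e - 1 := by
  classical
  unfold twistNumber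
  rw [Finset.sum_eq_single i, Finset.sum_eq_single e]
  · intro f hf hne
    rw [Finset.mem_filter] at hf
    exact absurd (h i f hf.2.1 hf.2.2).2 hne
  · intro h'
    rw [Finset.mem_filter] at h'
    exact absurd ⟨Finset.mem_univ _, hs, ha⟩ h'
  · intro j _ hj
    refine Finset.sum_eq_zero fun f hf => ?_
    rw [Finset.mem_filter] at hf
    exact absurd (h j f hf.2.1 hf.2.2).1 hj
  · exact fun h' => absurd (Finset.mem_univ _) h'

theorem vertexMult_of_cut (h : C.inDeg v = 1) : C.vertexMult v = varC := if_pos h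

theorem vertexMult_of_join (h : C.inDeg v = 2) (h' : C.outDeg v = 1) : C.vertexMult v = varJ := by
  rw [vertexMult, if_neg (by omega), if_pos h']

theorem vertexMult_of_twist (h : C.inDeg v = 2) (h' : C.outDeg v = 2) :
    C.vertexMult v = varT * (C.twistNumber v : CJT) := by
  rw [vertexMult, if_neg (by omega), if_neg (by omega)]

theorem mult_eq_of {ι ε : Type*} [Fintype ι] [Fintype ε] (f : ι → C.V) (g : ε → C.E)
    (hf : Function.Injective f) (hg : Function.Injective g)
    (hf' : ∀ v, C.ContribVertex v ↔ ∃ i, f i = v)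
    (hg' : ∀ e, C.ContribEdge e ∧ C.tgt e ≠ none ↔ ∃ i, g i = e) :
    C.mult = algebraMap ℂ CJT ((Real.sqrt (∏ i, (C.wt (g i) : ℝ)) : ℝ) : ℂ) *
      ∏ i, C.vertexMult (f i) := by
  classical
  unfold mult
  congr 1
  · congr 3
    symm
    refine Finset.prod_bij (fun i _ => g i) (fun i _ => ?_) (fun _ _ _ _ h => hg h)
      (fun e he => ?_) (fun _ _ => rfl)
    · rw [Finset.mem_filter, hg']
      exact ⟨Finset.mem_univ _, i, rfl⟩
    · rw [Finset.mem_filter, hg'] at he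
      obtain ⟨-, i, rfl⟩ := he
      exact ⟨i, Finset.mem_univ _, rfl⟩
  · symm
    refine Finset.prod_bij (fun i _ => f i) (fun i _ => ?_) (fun _ _ _ _ h => hf h)
      (fun e he => ?_) (fun _ _ => rfl)
    · rw [Finset.mem_filter, hf']
      exact ⟨Finset.mem_univ _, i, rfl⟩
    · rw [Finset.mem_filter, hf'] at he
      obtain ⟨-, i, rfl⟩ := he
      exact ⟨i, Finset.mem_univ _, rfl⟩

end MonotoneCover

namespace Diagram

variable (D) in
/-- The weight of the edge that is joined over `t`, if there is one. -/
def joined (t : Fin k) : ℕ := (D.other t).elim 1 fun f => D.wt f.1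

variable (hD : D.Valid r c) {x : Fin k → ℝ} (hx : StrictMono x)

/-- An edge that ends at a vertex is either a main edge, and then it or its mirror image is bold, or
it is joined there. -/
theorem Valid.contribEdge_iff (e : D.Edge) :
    (hD.cover hx).ContribEdge e ∧ (hD.cover hx).tgt e ≠ none ↔
      ∃ t b, D.other t = some (e.1.1, b) := by
  have h₁ : (hD.cover hx).ContribEdge e ↔ ∀ t, e.1.1 ≠ D.main t := by
    change D.col e ≠ Colour.bold ∧ D.col (D.flipEdge e) ≠ Colour.bold ↔ _
    rw [Ne, Ne, col_eq_bold, col_eq_bold, flipEdge]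
    obtain ⟨a, b⟩ := e
    cases b <;> simp
  have h₂ : (hD.cover hx).tgt e ≠ none ↔ ∃ t, D.Uses t e.1.1 := by
    refine (tgt_eq_none (D := D)).not.trans ?_
    push Not
    rfl
  rw [h₁, h₂]
  constructor
  · rintro ⟨h, t, h' | ⟨b, h'⟩⟩
    · exact absurd h' (h t)
    · exact ⟨t, b, h'⟩
  · rintro ⟨t, b, h⟩
    refine ⟨fun s hs => ?_, t, Or.inr ⟨b, h⟩⟩
    obtain ⟨rfl, rfl⟩ := hD.slot_unique (Or.inl ⟨hs, rfl⟩) (Or.inr h)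
    exact (hD.other_live _ _ _ h).2.1 hs

theorem Valid.contribVertex_iff (v : D.Vert) :
    (hD.cover hx).ContribVertex v ↔ ∃ t, v = D.vtx t true := by
  constructor
  · rintro ⟨e, h, h'⟩
    change D.Edge at e
    obtain ⟨h₃, s, hs⟩ := col_eq_bold.1 h'
    have h₄ : D.tgt (e.1, e.2) = some v := h
    rw [hD.tgt_of_slot (Or.inl ⟨hs, rfl⟩), h₃] at h₄
    exact ⟨s, (Option.some.inj h₄).symm⟩
  · rintro ⟨t, rfl⟩
    exact ⟨((⟨D.main t, hD.wt_main_pos t⟩, true) : D.Edge), hD.tgt_main t true,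
      col_eq_bold.2 ⟨rfl, t, rfl⟩⟩

theorem Valid.twistNumber_vtx (t : Fin k) : (hD.cover hx).twistNumber (D.vtx t true) =
    (D.ow (t, true) : ℤ) - n.blocksFun (D.blk t) + D.ctr t - 1 := by
  let e₀ : (hD.cover hx).E := ((⟨Sum.inr (t, true), hD.ow_pos t⟩, true) : D.Edge)
  refine (hD.cover hx).twistNumber_eq (e := e₀) rfl (hD.arises_inr hx t _) ?_
  rintro i e h₁ h₂
  obtain ⟨h₃, h₄⟩ := (hD.arises_iff hx i e).1 h₂
  change D.Edge at e
  obtain ⟨⟨b', h₅⟩, -⟩ := (src_eq_some (a := e.1) (b := e.2)).1 h₁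
  have h₆ := h₄.isSpine
  rw [h₅] at h₆
  obtain rfl : b' = true := h₆
  exact ⟨h₄.unique (Or.inr ⟨t, h₅, rfl⟩), Prod.ext (Subtype.ext h₅) h₃⟩

/-- In a join the number of choices is the weight of the joined edge, which the multiplicity counts
among the edges and not at the vertex. In a cut or a twist nothing is joined and the extra factor is
1. -/
theorem Valid.vertexMult_vtx (t : Fin k) : (D.joined t : CJT) * (hD.cover hx).vertexMult (D.vtx t true) =
    D.stepVar t * (D.choices t : CJT) := by
  rcases cut_or_join_or_twist (D := D) t with h | ⟨h, a, b, ho⟩ | h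
  · have h₁ := (hD.cover hx).vertexMult_of_cut (hD.inDeg_of_cut hx h true)
    rw [h₁, joined, stepVar, choices, hD.side t h]
    simp [h]
  · have h₁ := (hD.cover hx).vertexMult_of_join (hD.inDeg_of_not_cut hx h true)
      (hD.outDeg_of_join hx h (fun h' => by rw [h'.2] at ho; cases ho) true)
    rw [h₁, joined, stepVar, choices, ho]
    simp [mul_comm]
  · have h₁ := (hD.cover hx).vertexMult_of_twist (hD.inDeg_of_not_cut hx h.1 true)
      (hD.outDeg_of_twist hx h true)
    have h₂ := hD.twistNumber_vtx hx t
    rw [h₁, h₂, joined, stepVar, choices, h.2]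
    have hb := hD.bound t
    simp only [Option.elim_none, Nat.cast_one, one_mul, if_true, h.1, lt_irrefl, if_false]
    congr 1
    rw [Nat.cast_sub (by omega), Nat.cast_sub (by omega)]
    push_cast
    ring

/-- Every joined name stands for two mirror edges of equal weight. The product under the root is
thus a perfect square, and its root contributes each joined weight once. -/
theorem Valid.mult_cover : (hD.cover hx).mult = D.weight := by
  have hsome : ∀ t : {t // (D.other t).isSome}, ∃ a b, D.other t = some (a, b) := fun t => by
    obtain ⟨g, hg⟩ := Option.isSome_iff_exists.1 t.2
    exact ⟨g.1, g.2, hg⟩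
  choose a b hab using hsome
  have h₁ : ∏ t, D.joined t = ∏ t : {t // (D.other t).isSome}, D.wt (a t) := by
    rw [← Finset.prod_filter_of_ne (p := fun t => (D.other t).isSome), ← Finset.prod_subtype_eq_prod_filter]
    · refine Finset.prod_congr (by ext; simp) fun t _ => ?_
      rw [joined, hab t]; rfl
    · intro t _ h
      rcases ho : D.other t with _ | f
      · exact absurd (by rw [joined, ho]; rfl) h
      · rfl
  have h₂ := (hD.cover hx).mult_eq_of (fun t => D.vtx t true)
    (fun f : {t // (D.other t).isSome} × Bool =>
      (((⟨a f.1, (hD.other_live f.1 _ _ (hab f.1)).1.1⟩, f.2) : D.Edge) : (hD.cover hx).E))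
    (fun t t' h => (vtx_eq_iff.1 h).1) ?_ ?_ ?_
  · rw [h₂, Fintype.prod_prod_type]
    have h₃ : ∏ t : {t // (D.other t).isSome}, ∏ _b : Bool, (D.wt (a t) : ℝ) =
        ((∏ t, D.joined t : ℕ) : ℝ) ^ 2 := by
      rw [h₁, Nat.cast_prod, ← Finset.prod_pow]
      simp
    refine (congrArg (fun y : ℝ => algebraMap ℂ CJT ((Real.sqrt y : ℝ) : ℂ) *
      ∏ t, (hD.cover hx).vertexMult (D.vtx t true)) h₃).trans ?_
    rw [Real.sqrt_sq (Nat.cast_nonneg _), Complex.ofReal_natCast, map_natCast, Nat.cast_prod,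
      ← Finset.prod_mul_distrib]
    exact Finset.prod_congr rfl fun t _ => hD.vertexMult_vtx hx t
  · intro f f' e
    have h₃ : a f.1 = a f'.1 := congrArg (fun e : D.Edge => e.1.1) e
    have h₅ := hab f'.1
    rw [← h₃] at h₅
    exact Prod.ext (Subtype.ext (hD.slot_unique (Or.inr (hab f.1)) (Or.inr h₅)).1)
      (congrArg (fun e : D.Edge => e.2) e)
  · intro v
    refine (hD.contribVertex_iff hx v).trans ⟨?_, ?_⟩ <;> rintro ⟨t, h⟩ <;> exact ⟨t, h.symm⟩
  · intro e
    refine (hD.contribEdge_iff hx e).trans ⟨?_, ?_⟩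
    · rintro ⟨t, b', h⟩
      refine ⟨(⟨t, by rw [h]; rfl⟩, (e : D.Edge).2), Prod.ext (Subtype.ext ?_) rfl⟩
      have h₃ := (hab ⟨t, by rw [h]; rfl⟩).symm.trans h
      exact congrArg Prod.fst (Option.some.inj h₃)
    · rintro ⟨f, rfl⟩
      exact ⟨f.1, b f.1, hab f.1⟩

end Diagram
end Canonical
end RefinedHurwitz

namespace RefinedHurwitz

section Canonical

variable {d k : ℕ} {n m : Composition d} {r : Fin m.length} {c : ℕ}

namespace Diagram

/-! ### The diagram is determined by the cover -/

variable {D D' : Diagram n m k} (hD : D.Valid r c) (hD' : D'.Valid r c) {x : Fin k → ℝ}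
  (hx : StrictMono x) (F : MonotoneCover.Iso (hD.cover hx) (hD'.cover hx))
include hD hD' hx F

/-- The preferred vertices are the contributing ones, so an isomorphism respects them. Compatibility
with the involution settles their mirror images. -/
theorem Valid.iso_vtx (t : Fin k) (b : Bool) : F.onV (D.vtx t b) = D'.vtx t b := by
  have h₁ : F.onV (D.vtx t true) = D'.vtx t true := by
    obtain ⟨e, h, h'⟩ := (hD.contribVertex_iff hx _).2 ⟨t, rfl⟩
    have h₂ : (hD'.cover hx).ContribVertex (F.onV (D.vtx t true)) :=
      ⟨F.onE e, (F.tgt_some _ _).2 h, (F.col_eq _).trans h'⟩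
    obtain ⟨s, hs⟩ := (hD'.contribVertex_iff hx _).1 h₂
    have h₃ := F.pt_eq (D.vtx t true)
    rw [hs] at h₃
    obtain rfl : s = t := h₃
    exact hs
  cases b
  · have h₂ := F.inv_V (D.vtx t true)
    rw [h₁] at h₂
    have h₃ : (hD.cover hx).inv.onV (D.vtx t true) = D.vtx t false := flip_vtx t true
    have h₄ : (hD'.cover hx).inv.onV (D'.vtx t true) = D'.vtx t false := flip_vtx t true
    rw [h₃, h₄] at h₂
    exact h₂
  · exact h₁

theorem Valid.iso_spine (t : Fin k) (b : Bool) :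
    F.onE ((⟨Sum.inr (t, true), hD.ow_pos t⟩, b) : D.Edge) =
      ((⟨Sum.inr (t, true), hD'.ow_pos t⟩, b) : D'.Edge) := by
  have h₁ : F.onE ((⟨Sum.inr (t, true), hD.ow_pos t⟩, true) : D.Edge) =
      ((⟨Sum.inr (t, true), hD'.ow_pos t⟩, true) : D'.Edge) := by
    have h₂ := (F.src_some ((⟨Sum.inr (t, true), hD.ow_pos t⟩, true) : D.Edge) (D.vtx t true)).2 rfl
    have h₃ := F.col_eq ((⟨Sum.inr (t, true), hD.ow_pos t⟩, true) : D.Edge)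
    have h₄ : D.col (⟨Sum.inr (t, true), hD.ow_pos t⟩, true) ≠ Colour.normal :=
      col_ne_normal.2 ⟨rfl, rfl⟩
    rw [hD.iso_vtx hD' hx F] at h₂
    generalize F.onE ((⟨Sum.inr (t, true), hD.ow_pos t⟩, true) : D.Edge) = e at h₂ h₃ ⊢
    change D'.Edge at e
    have h₅ : D'.col e ≠ Colour.normal := fun h => h₄ (h₃.symm.trans h)
    obtain ⟨⟨b', h₆⟩, -⟩ := (src_eq_some (a := e.1) (b := e.2)).1 h₂
    obtain ⟨h₇, h₈⟩ := col_ne_normal.1 h₅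
    rw [h₆] at h₈
    obtain rfl : b' = true := h₈
    exact Prod.ext (Subtype.ext h₆) h₇
  cases b
  · have h₂ := F.inv_E ((⟨Sum.inr (t, true), hD.ow_pos t⟩, true) : D.Edge)
    rw [h₁] at h₂
    exact h₂
  · exact h₁

theorem Valid.iso_side (t : Fin k) (b : Bool) (h : 0 < D.ow (t, false)) :
    ∃ h' : 0 < D'.ow (t, false), F.onE ((⟨Sum.inr (t, false), h⟩, b) : D.Edge) =
      ((⟨Sum.inr (t, false), h'⟩, b) : D'.Edge) := by
  have h₂ := (F.src_some ((⟨Sum.inr (t, false), h⟩, b) : D.Edge) (D.vtx t b)).2 rfl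
  have h₃ : ∀ b', F.onE ((⟨Sum.inr (t, false), h⟩, b) : D.Edge) ≠
      ((⟨Sum.inr (t, true), hD'.ow_pos t⟩, b') : D'.Edge) := by
    intro b' h₄
    rw [← hD.iso_spine hD' hx F] at h₄
    have h₅ := congrArg (fun e : D.Edge => e.1.1) (F.onE.injective h₄)
    simp at h₅
  rw [hD.iso_vtx hD' hx F] at h₂
  generalize F.onE ((⟨Sum.inr (t, false), h⟩, b) : D.Edge) = e at h₂ h₃ ⊢
  change D'.Edge at e
  obtain ⟨⟨b', h₆⟩, h₇⟩ := (src_eq_some (a := e.1) (b := e.2)).1 h₂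
  obtain ⟨⟨a, ha⟩, β⟩ := e
  obtain rfl : a = _ := h₆
  cases b'
  · refine ⟨ha, ?_⟩
    rcases h₇ with h₇ | h₇
    · exact Prod.ext rfl h₇
    · exact absurd h₇.1 (Nat.pos_iff_ne_zero.1 ha)
  · exact absurd rfl (h₃ β)

theorem Valid.iso_edge (a : {a : Name n k // 0 < D.wt a}) (b : Bool) :
    ∃ h' : 0 < D'.wt a, F.onE ((a, b) : D.Edge) = ((⟨a.1, h'⟩, b) : D'.Edge) := by
  obtain ⟨i | ⟨t, b'⟩, h⟩ := a
  · exact ⟨n.one_le_blocksFun i, F.inEnd_eq i b⟩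
  · cases b'
    · exact hD.iso_side hD' hx F t b h
    · exact ⟨hD'.ow_pos t, hD.iso_spine hD' hx F t b⟩

theorem Valid.iso_wt (a : Name n k) (h : 0 < D.wt a) : D'.wt a = D.wt a := by
  obtain ⟨h', h₁⟩ := hD.iso_edge hD' hx F ⟨a, h⟩ true
  have h₂ := F.wt_eq ((⟨a, h⟩, true) : D.Edge)
  rw [h₁] at h₂
  exact h₂

/-- The block is the chain from which the main output arises, and the position in the block is its
counter. -/
theorem Valid.iso_q : D.q = D'.q := by
  funext t
  have h₁ := F.arises (hD.arises_inr hx t (hD.ow_pos t))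
  rw [hD.iso_spine hD' hx F] at h₁
  have h₂ := F.cnt_eq ((⟨Sum.inr (t, true), hD.ow_pos t⟩, true) : D.Edge)
    (col_ne_normal.2 ⟨rfl, rfl⟩)
  rw [hD.iso_spine hD' hx F] at h₂
  refine eq_of_index_offset n ?_ (Nat.succ_injective h₂).symm
  exact ((hD'.arises_iff hx _ _).1 h₁).2.unique (Or.inr ⟨t, rfl, rfl⟩)

theorem Valid.iso_other (t : Fin k) (f : Name n k × Bool) (h : D.other t = some f) :
    D'.other t = some f := by
  obtain ⟨a, b⟩ := f
  have ha := (hD.other_live t a b h).1.1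
  have hm : D'.main t = D.main t := by
    simp only [main, blk, hD.iso_q hD' hx F]
  obtain ⟨h', h₁⟩ := hD.iso_edge hD' hx F ⟨a, ha⟩ b
  have h₂ : D.tgt (⟨a, ha⟩, b) = some (D.vtx t true) := by
    rw [hD.tgt_of_slot (Or.inr h), beq_self_eq_true]
  have h₃ := (F.tgt_some ((⟨a, ha⟩, b) : D.Edge) (D.vtx t true)).2 h₂
  rw [h₁, hD.iso_vtx hD' hx F] at h₃
  obtain ⟨b', h₄, h₅⟩ := (hD'.tgt_eq_some (D := D') (a := ⟨a, h'⟩) (b := b)).1 h₃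
  rcases h₄ with ⟨h₄, -⟩ | h₄
  · exact absurd (h₄.trans hm) (hD.other_live t a b h).2.1
  · rcases h₅ with h₅ | h₅
    · rw [h₄, beq_iff_eq.1 h₅]
    · rw [h₅.2] at h₄
      cases h₄

/-- An isomorphism may exchange the out-ends j and q + j, but these are the two strands of one name,
and the diagram labels names only. -/
theorem Valid.iso_lab (a : Name n k) (j : Fin m.length) (h : D.lab a = some j) :
    D'.lab a = some j := by
  have h₀ := (hD.lab_eq_iff_exists a).1 ⟨j, h⟩
  obtain ⟨b', h₁⟩ := F.outEnd_eq j true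
  have h₂ : (hD.cover hx).outEnd (j, true) = (((⟨a, h₀.1⟩, true) : D.Edge) : (hD.cover hx).E) :=
    Prod.ext (hD.outName_eq (a := ⟨a, h₀.1⟩) h) rfl
  obtain ⟨h', h₃⟩ := hD.iso_edge hD' hx F ⟨a, h₀.1⟩ true
  rw [h₂, h₃] at h₁
  have h₄ : a = (hD'.outName j).1 := congrArg (fun e : D'.Edge => e.1.1) h₁
  rw [h₄]
  exact hD'.lab_outName j

omit hD hD' F in
theorem Valid.eq_of_iso (hD : D.Valid r c) (hD' : D'.Valid r c)
    (F : MonotoneCover.Iso (hD.cover hx) (hD'.cover hx)) : D = D' := by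
  ext1
  · exact hD.iso_q hD' hx F
  · funext t
    rcases h : D.other t with _ | f
    · rcases h' : D'.other t with _ | f
      · rfl
      · have := hD'.iso_other hD hx F.symm t f h'
        rw [h] at this
        cases this
    · exact (hD.iso_other hD' hx F t f h).symm
  · funext f
    rcases Nat.eq_zero_or_pos (D.ow f) with h | h
    · rcases Nat.eq_zero_or_pos (D'.ow f) with h' | h'
      · rw [h, h']
      · exact hD'.iso_wt hD hx F.symm (Sum.inr f) h'
    · exact (hD.iso_wt hD' hx F (Sum.inr f) h).symm
  · funext a
    rcases h : D.lab a with _ | j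
    · rcases h' : D'.lab a with _ | j
      · rfl
      · have := hD'.iso_lab hD hx F.symm a j h'
        rw [h] at this
        cases this
    · exact (hD.iso_lab hD' hx F a j h).symm

end Diagram
end Canonical
end RefinedHurwitz

namespace RefinedHurwitz

section Structure

variable {d k : ℕ} {n m : Composition d} {x : Fin k → ℝ}

namespace MonotoneCover

/-! ### The spine of a monotone cover -/

variable (X : MonotoneCover x n m)

/-- The level at which an edge begins. -/
def low (e : X.E) : ℕ := (X.src e).elim 0 fun u => X.pt u + 1

def EndsOver (e : X.E) (t : Fin k) : Prop := ∃ v, X.tgt e = some v ∧ X.pt v = t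

/-- The bold edge `f` ends before `e` begins. -/
def Before (f e : X.E) : Prop := X.col f = Colour.bold ∧ ∃ t, X.EndsOver f t ∧ (t : ℕ) + 1 ≤ X.low e

variable {X}

theorem low_of_src {e : X.E} {u : X.V} (h : X.src e = some u) : X.low e = X.pt u + 1 := by
  simp [low, h]

theorem EndsOver.unique {e : X.E} {s t : Fin k} (h : X.EndsOver e s) (h' : X.EndsOver e t) :
    s = t := by
  obtain ⟨v, h₁, rfl⟩ := h
  obtain ⟨v', h₂, rfl⟩ := h'
  rw [h₁] at h₂
  rw [Option.some.inj h₂]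

theorem EndsOver.low_le {e : X.E} {t : Fin k} (h : X.EndsOver e t) : X.low e ≤ t := by
  obtain ⟨v, h₁, rfl⟩ := h
  rcases hs : X.src e with _ | u
  · simp [low, hs]
  · rw [low_of_src hs]
    exact Fin.lt_def.1 (X.src_lt_tgt e u v hs h₁)

theorem low_start (i : Fin n.length) (b : Bool) : X.low (X.inEnd (i, b)) = 0 := by
  have h : X.src (X.inEnd (i, b)) = none := (X.inEnd_range _).2 ⟨_, rfl⟩
  simp [low, h]

theorem EndsOver.onChain {i : Fin n.length} {e : X.E} {t : Fin k} (h : X.EndsOver e t)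
    (ha : X.Arises i e) (hb : X.col e = Colour.bold) : ∃ v, X.OnChain i v ∧ X.pt v = t := by
  obtain ⟨v, h₁, h₂⟩ := h
  exact ⟨v, ⟨e, ha, hb, h₁⟩, h₂⟩

theorem bold_ne_normal {e : X.E} (h : X.col e = Colour.bold) : X.col e ≠ Colour.normal := by
  rw [h]; simp

theorem chain_eq {i j : Fin n.length} {e f : X.E} {t : Fin k} (he : X.Arises i e)
    (hf : X.Arises j f) (he' : X.col e = Colour.bold) (hf' : X.col f = Colour.bold)
    (h : X.EndsOver e t) (h' : X.EndsOver f t) : i = j := by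
  by_contra hne
  obtain ⟨v, h₁, h₂⟩ := h.onChain he he'
  obtain ⟨w, h₃, h₄⟩ := h'.onChain hf hf'
  have := X.chain_disjoint i j hne v v w w h₁ h₁ h₃ h₃
  rw [h₂, h₄] at this
  exact Set.disjoint_left.1 this ⟨le_rfl, le_rfl⟩ ⟨le_rfl, le_rfl⟩

theorem pt_inv (v : X.V) : X.pt (X.inv.onV v) = X.pt v := X.inv.pt_eq v

/-- This says that the edges arising from one in-end form a path. The induction replaces the edge
that begins later by its bold predecessor. If both begin over the same branch point, their
predecessors coincide by induction, and condition 5 provides a single non-normal continuation. -/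
theorem comparable {i : Fin n.length} {e f : X.E} (he : X.Arises i e) (hf : X.Arises i f) :
    e = f ∨ X.Before f e ∨ X.Before e f := by
  induction hN : X.low e + X.low f using Nat.strong_induction_on generalizing e f with
  | _ N ih =>
  have hno : ∀ {e f : X.E} {t : Fin k}, X.EndsOver e t → X.EndsOver f t → ¬ X.Before e f := by
    rintro e f t h₁ h₂ ⟨-, s, h₃, h₄⟩
    have := h₂.low_le
    rw [h₃.unique h₁] at h₄
    omega
  -- a step on one side
  have hstep : ∀ {e f f₁ : X.E} {v : X.V}, X.Arises i e → X.Arises i f₁ → X.col f₁ = Colour.bold →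
      X.tgt f₁ = some v → X.src f = some v → X.low e ≤ X.pt v → X.low e + X.low f ≤ N →
      e = f ∨ X.Before f e ∨ X.Before e f := by
    intro e f f₁ v he hf₁ hb ht hs hle hN'
    have hend : X.EndsOver f₁ (X.pt v) := ⟨v, ht, rfl⟩
    have h₀ := hend.low_le
    have h₁ := low_of_src hs
    rcases ih _ (by omega) he hf₁ rfl with rfl | ⟨-, s, h₂, h₃⟩ | ⟨h₂, s, h₃, h₄⟩
    · exact Or.inr (Or.inr ⟨hb, X.pt v, hend, by omega⟩)
    · rw [h₂.unique hend] at h₃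
      omega
    · exact Or.inr (Or.inr ⟨h₂, s, h₃, by omega⟩)
  have hsymm : ∀ {e f : X.E}, (f = e ∨ X.Before e f ∨ X.Before f e) →
      e = f ∨ X.Before f e ∨ X.Before e f := by
    rintro e f (h | h | h)
    · exact Or.inl h.symm
    · exact Or.inr (Or.inr h)
    · exact Or.inr (Or.inl h)
  cases he with
  | start =>
    cases hf with
    | start => exact Or.inl rfl
    | next f₁ _ v hf₁ hb ht hs _ =>
      exact hstep ColouredCover.Arises.start hf₁ hb ht hs (by rw [low_start]; omega) hN.le
  | next e₁ _ u he₁ hb ht hs hc =>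
    have he : X.Arises i e := ColouredCover.Arises.next e₁ e u he₁ hb ht hs hc
    cases hf with
    | start =>
      exact hsymm (hstep ColouredCover.Arises.start he₁ hb ht hs (by rw [low_start]; omega)
        (by omega))
    | next f₁ _ v hf₁ hb' ht' hs' hc' =>
      have hf : X.Arises i f := ColouredCover.Arises.next f₁ f v hf₁ hb' ht' hs' hc'
      have h₁ := low_of_src hs
      have h₁' := low_of_src hs'
      rcases lt_trichotomy (X.pt u) (X.pt v) with hlt | heq | hlt
      · exact hstep he hf₁ hb' ht' hs' (by rw [h₁]; exact hlt) hN.le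
      -- Two bold edges ending over the same branch point cannot be ordered by `Before`, so the
      -- induction hypothesis makes the two predecessors equal.
      · left
        have hend : X.EndsOver e₁ (X.pt u) := ⟨u, ht, rfl⟩
        have hend' : X.EndsOver f₁ (X.pt u) := ⟨v, ht', heq.symm⟩
        have h₂ := hend.low_le
        have h₂' := hend'.low_le
        obtain rfl : e₁ = f₁ := by
          rcases ih _ (by omega) he₁ hf₁ rfl with h | h | h
          · exact h
          · exact absurd h (hno hend' hend)
          · exact absurd h (hno hend hend')
        obtain rfl : u = v := by rw [ht] at ht'; exact Option.some.inj ht'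
        -- Condition 5 holds at u or at its mirror image. The bold edge b it provides ends over the
        -- same branch point, hence belongs to the same chain and equals the predecessor. So the
        -- condition holds at u itself.
        obtain ⟨w, hw, b, b', h₃, h₄, -⟩ := X.vertex u
        obtain ⟨h₅, h₆⟩ := (h₃ b).2 rfl
        have hwu : X.pt w = X.pt u := by
          rcases hw with rfl | rfl
          · rfl
          · exact pt_inv u
        have hendb : X.EndsOver b (X.pt u) := ⟨w, h₅, hwu⟩
        obtain ⟨j, hj, -⟩ := X.unique_chain b (bold_ne_normal h₆)
        obtain rfl := chain_eq hj he₁ h₆ hb hendb hend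
        have h₇ := hendb.low_le
        obtain rfl : b = e₁ := by
          rcases ih _ (by omega) hj he₁ rfl with h | h | h
          · exact h
          · exact absurd h (hno hend hendb)
          · exact absurd h (hno hendb hend)
        obtain rfl : w = u := by rw [ht] at h₅; exact (Option.some.inj h₅).symm
        exact ((h₄ e).1 ⟨hs, hc⟩).trans ((h₄ f).1 ⟨hs', hc'⟩).symm
      · exact hsymm (hstep hf he₁ hb ht hs (by rw [h₁']; exact hlt) (by omega))

theorem Before.not_of_endsOver {e f : X.E} {t : Fin k} (h : X.Before e f) (h₁ : X.EndsOver e t)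
    (h₂ : X.low f ≤ t) : False := by
  obtain ⟨-, s, h₃, h₄⟩ := h
  rw [h₃.unique h₁] at h₄
  omega

/-- Disjointness of the intervals puts both edges on one chain, and on a chain of which each edge
ends before the next begins no two can end over the same point. -/
theorem bold_unique {e f : X.E} {t : Fin k} (he : X.col e = Colour.bold)
    (hf : X.col f = Colour.bold) (h : X.EndsOver e t) (h' : X.EndsOver f t) : e = f := by
  obtain ⟨i, hi, -⟩ := X.unique_chain e (bold_ne_normal he)
  obtain ⟨j, hj, -⟩ := X.unique_chain f (bold_ne_normal hf)
  obtain rfl := chain_eq hi hj he hf h h'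
  rcases comparable hi hj with e | e | e
  · exact e
  · exact (e.not_of_endsOver h' h.low_le).elim
  · exact (e.not_of_endsOver h h'.low_le).elim

theorem exists_spine (X : MonotoneCover x n m) (t : Fin k) : ∃ (v : X.V) (e e' : X.E), X.pt v = t ∧
    (∀ f, (X.tgt f = some v ∧ X.col f = Colour.bold) ↔ f = e) ∧
    (∀ f, (X.src f = some v ∧ X.col f ≠ Colour.normal) ↔ f = e') ∧ X.cnt e ≤ X.cnt e' := by
  obtain ⟨v, hv⟩ : {v | X.pt v = t}.Nonempty := by
    rw [← Set.ncard_pos]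
    rcases X.fibre t with h | h <;> omega
  obtain ⟨w, hw, e, e', h₁, h₂, h₃⟩ := X.vertex v
  refine ⟨w, e, e', ?_, h₁, h₂, h₃⟩
  rcases hw with rfl | rfl
  · exact hv
  · exact (pt_inv v).trans hv

variable (X)

/-- The preferred vertex over the `t`-th branch point, into which the bold edge comes. -/
noncomputable def vert (t : Fin k) : X.V := (X.exists_spine t).choose

/-- The bold edge that ends over the `t`-th branch point. -/
noncomputable def eIn (t : Fin k) : X.E := (X.exists_spine t).choose_spec.choose

/-- The non-normal edge that begins over the `t`-th branch point. -/
noncomputable def eOut (t : Fin k) : X.E := (X.exists_spine t).choose_spec.choose_spec.choose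

variable {t : Fin k}

theorem spine_spec (t : Fin k) : X.pt (X.vert t) = t ∧
    (∀ f, (X.tgt f = some (X.vert t) ∧ X.col f = Colour.bold) ↔ f = X.eIn t) ∧
    (∀ f, (X.src f = some (X.vert t) ∧ X.col f ≠ Colour.normal) ↔ f = X.eOut t) ∧
    X.cnt (X.eIn t) ≤ X.cnt (X.eOut t) :=
  (X.exists_spine t).choose_spec.choose_spec.choose_spec

theorem pt_vert (t : Fin k) : X.pt (X.vert t) = t := (X.spine_spec t).1

theorem tgt_eIn (t : Fin k) : X.tgt (X.eIn t) = some (X.vert t) :=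
  (((X.spine_spec t).2.1 _).2 rfl).1

theorem col_eIn (t : Fin k) : X.col (X.eIn t) = Colour.bold :=
  (((X.spine_spec t).2.1 _).2 rfl).2

theorem src_eOut (t : Fin k) : X.src (X.eOut t) = some (X.vert t) :=
  (((X.spine_spec t).2.2.1 _).2 rfl).1

theorem col_eOut (t : Fin k) : X.col (X.eOut t) ≠ Colour.normal :=
  (((X.spine_spec t).2.2.1 _).2 rfl).2

theorem cnt_eIn_le (t : Fin k) : X.cnt (X.eIn t) ≤ X.cnt (X.eOut t) := (X.spine_spec t).2.2.2

theorem endsOver_eIn (t : Fin k) : X.EndsOver (X.eIn t) t := ⟨_, X.tgt_eIn t, X.pt_vert t⟩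

theorem low_eOut (t : Fin k) : X.low (X.eOut t) = t + 1 := by
  rw [low_of_src (X.src_eOut t), X.pt_vert]

theorem existsUnique_chain (t : Fin k) : ∃! i, X.Arises i (X.eIn t) :=
  X.unique_chain _ (bold_ne_normal (X.col_eIn t))

/-- The index of the chain through the preferred vertex over the `t`-th branch point. -/
noncomputable def chain (t : Fin k) : Fin n.length := (X.existsUnique_chain t).choose

theorem arises_eIn (t : Fin k) : X.Arises (X.chain t) (X.eIn t) :=
  (X.existsUnique_chain t).choose_spec.1

theorem arises_eOut (t : Fin k) : X.Arises (X.chain t) (X.eOut t) :=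
  ColouredCover.Arises.next _ _ _ (X.arises_eIn t) (X.col_eIn t) (X.tgt_eIn t) (X.src_eOut t)
    (X.col_eOut t)

variable {X}

theorem chain_eq_of_arises {i : Fin n.length} (h : X.Arises i (X.eIn t)) : X.chain t = i :=
  ((X.existsUnique_chain t).choose_spec.2 i h).symm

theorem eq_eIn {e : X.E} (h : X.EndsOver e t) (hb : X.col e = Colour.bold) : e = X.eIn t :=
  bold_unique hb (X.col_eIn t) h (X.endsOver_eIn t)

theorem arises_ne {i : Fin n.length} {e : X.E} (h : X.Arises i e) : X.col e ≠ Colour.normal :=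
  Iso.arises_ne h

/-- A non-normal edge is an in-end, or it is the non-normal edge that begins over some branch
point. -/
theorem Arises.cases {i : Fin n.length} {e : X.E} (h : X.Arises i e) :
    e = X.inEnd (i, true) ∨ ∃ t, X.chain t = i ∧ e = X.eOut t := by
  cases h with
  | start => exact Or.inl rfl
  | next e₁ _ v h hb ht hs hc =>
    refine Or.inr ⟨X.pt v, ?_⟩
    obtain rfl := eq_eIn (t := X.pt v) ⟨v, ht, rfl⟩ hb
    refine ⟨chain_eq_of_arises h, ?_⟩
    have := (X.tgt_eIn (X.pt v)).symm.trans ht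
    exact ((X.spine_spec (X.pt v)).2.2.1 e).1 ⟨by rw [hs, this], hc⟩

theorem eq_eOut {e : X.E} {v : X.V} (hc : X.col e ≠ Colour.normal) (hs : X.src e = some v)
    (hv : X.pt v = t) : e = X.eOut t := by
  obtain ⟨i, hi, -⟩ := X.unique_chain e hc
  rcases Arises.cases hi with rfl | ⟨s, -, rfl⟩
  · rw [(X.inEnd_range _).2 ⟨_, rfl⟩] at hs
    cases hs
  · rw [X.src_eOut] at hs
    rw [← hv, ← Option.some.inj hs, X.pt_vert]

theorem bold_start {i : Fin n.length} {e : X.E} (h : X.Arises i e) (hb : X.col e = Colour.bold) :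
    X.HasChain i := by
  induction h with
  | start => exact hb
  | next _ _ _ _ hb' _ _ _ ih => exact ih hb'

theorem start_endsOver {i : Fin n.length} (h : X.HasChain i) :
    ∃ s, X.inEnd (i, true) = X.eIn s ∧ X.chain s = i := by
  obtain ⟨v, hv⟩ := Option.ne_none_iff_exists'.1 (X.bold_tgt _ h)
  have h₁ := eq_eIn (X := X) (t := X.pt v) ⟨v, hv, rfl⟩ h
  exact ⟨X.pt v, h₁, chain_eq_of_arises (h₁ ▸ ColouredCover.Arises.start)⟩

theorem hasChain_chain (t : Fin k) : X.HasChain (X.chain t) :=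
  bold_start (X.arises_eIn t) (X.col_eIn t)

/-- Of two bold edges on a chain, the one that ends earlier ends before the other begins. -/
theorem lt_low_eIn {s t : Fin k} (hst : s < t) (h : X.chain s = X.chain t) :
    (s : ℕ) + 1 ≤ X.low (X.eIn t) := by
  rcases comparable (X.arises_eIn t) (h ▸ X.arises_eIn s) with e | ⟨-, u, hu, h'⟩ | ⟨-, u, hu, h'⟩
  · have := (X.endsOver_eIn t).unique (e ▸ X.endsOver_eIn s)
    exact absurd this hst.ne'
  · rwa [hu.unique (X.endsOver_eIn s)] at h'
  · rw [hu.unique (X.endsOver_eIn t)] at h'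
    have := (X.endsOver_eIn s).low_le
    have := Fin.lt_def.1 hst
    omega

theorem start_le {s t : Fin k} (hs : X.inEnd (X.chain t, true) = X.eIn s)
    (h : X.chain s = X.chain t) : s ≤ t := by
  by_contra hlt
  have h₁ := lt_low_eIn (not_le.1 hlt) h.symm
  rw [← hs, low_start] at h₁
  omega

/-- If a later branch point belonged to a chain of smaller label, that chain would begin before the
other one and reach beyond it. Its interval would contain the left end of the other chain. -/
theorem chain_mono (hx : StrictMono x) : Monotone X.chain := by
  intro s t hst
  by_contra hlt
  rw [not_le] at hlt
  have hst : s < t := lt_of_le_of_ne hst (by rintro rfl; exact lt_irrefl _ hlt)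
  obtain ⟨a, ha, ha'⟩ := start_endsOver (hasChain_chain (X := X) s)
  obtain ⟨b, hb, hb'⟩ := start_endsOver (hasChain_chain (X := X) t)
  have h₁ := start_le ha ha'
  have h₂ := (X.chain_order (X.chain t) (X.chain s) (X.vert b) (X.vert a) (hasChain_chain t)
    (hasChain_chain s) (by rw [hb, X.tgt_eIn]) (by rw [ha, X.tgt_eIn])).2 hlt
  have hon : ∀ t, X.OnChain (X.chain t) (X.vert t) := fun t =>
    ⟨_, X.arises_eIn t, X.col_eIn t, X.tgt_eIn t⟩
  have h₃ := X.chain_disjoint _ _ hlt.ne _ _ _ _ (hb' ▸ hon b) (hon t) (ha' ▸ hon a) (hon s)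
  rw [X.pt_vert, X.pt_vert] at h₂ h₃
  rw [X.pt_vert, X.pt_vert] at h₃
  exact Set.disjoint_left.1 h₃ ⟨h₂.le, hx.monotone (h₁.trans hst.le)⟩ ⟨le_rfl, hx.monotone h₁⟩

theorem eIn_of_succ {s t : Fin k} (hst : (s : ℕ) + 1 = t) (h : X.chain s = X.chain t) :
    X.eIn t = X.eOut s := by
  have hlt : s < t := Fin.lt_def.2 (by omega)
  have h₁ := lt_low_eIn hlt h
  have h₂ := (X.endsOver_eIn t).low_le
  rcases Arises.cases (X.arises_eIn t) with h₃ | ⟨u, -, h₃⟩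
  · rw [h₃, low_start] at h₁
    omega
  · rw [h₃, low_eOut] at h₁ h₂
    rw [h₃, show u = s from Fin.ext (by omega)]

/-- A bold edge coming from an earlier vertex of the chain would begin before t − 1. But the branch
point following that vertex lies on the same chain by `chain_mono`, and its own bold edge must end
before the given one begins. -/
theorem eIn_of_first (hx : StrictMono x) (h : ∀ s : Fin k, (s : ℕ) + 1 = t → X.chain s ≠ X.chain t) :
    X.eIn t = X.inEnd (X.chain t, true) := by
  rcases Arises.cases (X.arises_eIn t) with h₁ | ⟨s, hs, h₁⟩
  · exact h₁
  · have hlt : s < t := by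
      have := (X.endsOver_eIn t).low_le
      rw [h₁, low_eOut] at this
      exact Fin.lt_def.2 (by omega)
    have h₂ : (s : ℕ) + 1 < t :=
      lt_of_le_of_ne (Fin.lt_def.1 hlt) fun e => h s e hs
    set u : Fin k := ⟨s + 1, by omega⟩
    have hsu : s ≤ u := Fin.le_def.2 (by simp only [u]; omega)
    have hut : u < t := Fin.lt_def.2 h₂
    have h₃ : X.chain u = X.chain t :=
      le_antisymm (chain_mono hx hut.le) (hs ▸ chain_mono hx hsu)
    have h₄ := lt_low_eIn hut h₃
    rw [h₁, low_eOut] at h₄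
    simp only [u] at h₄
    omega

theorem cnt_pos {i : Fin n.length} {e : X.E} (h : X.Arises i e) : 1 ≤ X.cnt e := by
  induction h with
  | start => exact (X.in_counter i).ge
  | next e₁ e v h hb ht hs hc ih =>
    obtain rfl := eq_eIn (t := X.pt v) ⟨v, ht, rfl⟩ hb
    obtain rfl := eq_eOut (t := X.pt v) hc hs rfl
    exact ih.trans (X.cnt_eIn_le _)

end MonotoneCover
end Structure
end RefinedHurwitz

namespace RefinedHurwitz

section Structure

variable {d k : ℕ} {n m : Composition d} {x : Fin k → ℝ}

namespace MonotoneCover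

/-! ### The diagram of a monotone cover -/

variable {X : MonotoneCover x n m} {t : Fin k}

theorem src_inv {e : X.E} {v : X.V} : X.src (X.inv.onE e) = some (X.inv.onV v) ↔ X.src e = some v := by
  rw [X.inv.src_eq]
  simp

theorem tgt_inv {e : X.E} {v : X.V} : X.tgt (X.inv.onE e) = some (X.inv.onV v) ↔ X.tgt e = some v := by
  rw [X.inv.tgt_eq]
  simp

theorem wt_inv (e : X.E) : X.wt (X.inv.onE e) = X.wt e := X.inv.wt_eq e

theorem EndsOver.inv {e : X.E} (h : X.EndsOver e t) : X.EndsOver (X.inv.onE e) t := by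
  obtain ⟨v, h₁, h₂⟩ := h
  exact ⟨_, tgt_inv.2 h₁, (pt_inv v).trans h₂⟩

theorem eq_vert_or {v : X.V} (h : X.pt v = t) : v = X.vert t ∨ v = X.inv.onV (X.vert t) := by
  have h₀ : X.pt (X.inv.onV (X.vert t)) = t := (pt_inv _).trans (X.pt_vert t)
  rcases X.fibre t with ⟨h₁, h₂⟩ | ⟨h₁, h₂⟩
  · have hne : X.vert t ≠ X.inv.onV (X.vert t) := fun e => by
      have h₃ := (X.fixed_V _).1 e.symm
      rw [h₂ _ (X.pt_vert t)] at h₃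
      omega
    have h₄ : ({X.vert t, X.inv.onV (X.vert t)} : Set X.V) = {v | X.pt v = t} := by
      refine Set.eq_of_subset_of_ncard_le ?_ (by rw [h₁, Set.ncard_pair hne]) (Set.toFinite _)
      rintro w (rfl | rfl)
      · exact X.pt_vert t
      · exact h₀
    have h₅ : v ∈ {v | X.pt v = t} := h
    rw [← h₄] at h₅
    exact h₅
  · obtain ⟨w, hw⟩ := Set.ncard_eq_one.1 h₁
    have h₃ : ∀ u, X.pt u = t → u = w := fun u hu => by
      have : u ∈ {v | X.pt v = t} := hu
      rw [hw] at this
      exact this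
    exact Or.inl ((h₃ v h).trans (h₃ _ (X.pt_vert t)).symm)

variable (X) in
def SideOut (t : Fin k) (f : X.E) : Prop :=
  X.src f = some (X.vert t) ∧ f ≠ X.eOut t ∧ f ≠ X.inv.onE (X.eOut t)

variable (X) in
def SideIn (t : Fin k) (f : X.E) : Prop :=
  X.tgt f = some (X.vert t) ∧ f ≠ X.eIn t ∧ f ≠ X.inv.onE (X.eIn t)

variable (X) in
structure IsCut (t : Fin k) (g : X.E) : Prop where
  inv_ne : X.inv.onV (X.vert t) ≠ X.vert t
  tgt_iff : ∀ f, X.tgt f = some (X.vert t) ↔ f = X.eIn t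
  side : X.SideOut t g
  src_iff : ∀ f, X.src f = some (X.vert t) ↔ f = X.eOut t ∨ f = g

variable (X) in
structure IsJoin (t : Fin k) (g : X.E) : Prop where
  inv_ne : X.inv.onV (X.vert t) ≠ X.vert t
  src_iff : ∀ f, X.src f = some (X.vert t) ↔ f = X.eOut t
  side : X.SideIn t g
  tgt_iff : ∀ f, X.tgt f = some (X.vert t) ↔ f = X.eIn t ∨ f = g

variable (X) in
structure IsTwist (t : Fin k) : Prop where
  inv_eq : X.inv.onV (X.vert t) = X.vert t
  src_iff : ∀ f, X.src f = some (X.vert t) ↔ f = X.eOut t ∨ f = X.inv.onE (X.eOut t)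
  tgt_iff : ∀ f, X.tgt f = some (X.vert t) ↔ f = X.eIn t ∨ f = X.inv.onE (X.eIn t)

theorem exists_pair {α : Type*} {S : Set α} {a : α} (ha : a ∈ S) (h : S.ncard = 2) :
    ∃ b, b ≠ a ∧ ∀ y, y ∈ S ↔ y = a ∨ y = b := by
  obtain ⟨u, v, huv, rfl⟩ := Set.ncard_eq_two.1 h
  rcases ha with rfl | rfl
  · exact ⟨v, huv.symm, fun y => Iff.rfl⟩
  · exact ⟨u, huv, fun y => or_comm⟩

theorem exists_single {α : Type*} {S : Set α} {a : α} (ha : a ∈ S) (h : S.ncard = 1) :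
    ∀ y, y ∈ S ↔ y = a := by
  obtain ⟨u, rfl⟩ := Set.ncard_eq_one.1 h
  obtain rfl : a = u := ha
  exact fun y => Iff.rfl

variable (X) in
-- At a 4-valent vertex the involution fixes the vertex but no edge, so the spine edges and their
-- mirror images already account for the valence. At a 3-valent vertex one further edge remains, and
-- it is incoming or outgoing.
theorem cut_or_join_or_twist (t : Fin k) :
    (∃ g, X.IsCut t g) ∨ (∃ g, X.IsJoin t g) ∨ X.IsTwist t := by
  have hin : X.eIn t ∈ {e | X.tgt e = some (X.vert t)} := X.tgt_eIn t
  have hout : X.eOut t ∈ {e | X.src e = some (X.vert t)} := X.src_eOut t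
  have hi := (Set.ncard_pos (Set.toFinite _)).2 ⟨_, hin⟩
  have ho := (Set.ncard_pos (Set.toFinite _)).2 ⟨_, hout⟩
  by_cases hval : X.valence (X.vert t) = 4
  · right; right
    have hv := (X.fixed_V _).2 hval
    have hin' : X.inv.onE (X.eIn t) ∈ {e | X.tgt e = some (X.vert t)} :=
      (tgt_inv.2 (X.tgt_eIn t)).trans (congrArg some hv)
    have hout' : X.inv.onE (X.eOut t) ∈ {e | X.src e = some (X.vert t)} :=
      (src_inv.2 (X.src_eOut t)).trans (congrArg some hv)
    have h₁ : ({X.eIn t, X.inv.onE (X.eIn t)} : Set X.E) ⊆ {e | X.tgt e = some (X.vert t)} := by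
      rintro e (rfl | rfl)
      · exact hin
      · exact hin'
    have h₂ : ({X.eOut t, X.inv.onE (X.eOut t)} : Set X.E) ⊆ {e | X.src e = some (X.vert t)} := by
      rintro e (rfl | rfl)
      · exact hout
      · exact hout'
    have h₃ := Set.ncard_le_ncard h₁ (Set.toFinite _)
    have h₄ := Set.ncard_le_ncard h₂ (Set.toFinite _)
    have h₅ := Set.ncard_pair (X.fixed_E (X.eIn t)).symm
    have h₆ := Set.ncard_pair (X.fixed_E (X.eOut t)).symm
    have h₇ : Set.ncard {e | X.tgt e = some (X.vert t)} +
      Set.ncard {e | X.src e = some (X.vert t)} = 4 := hval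
    have h₈ := Set.eq_of_subset_of_ncard_le h₁ (by omega) (Set.toFinite _)
    have h₉ := Set.eq_of_subset_of_ncard_le h₂ (by omega) (Set.toFinite _)
    exact ⟨hv, fun f => (Set.ext_iff.1 h₉ f).symm, fun f => (Set.ext_iff.1 h₈ f).symm⟩
  · have hv : X.inv.onV (X.vert t) ≠ X.vert t := fun h => hval ((X.fixed_V _).1 h)
    have h₇ : Set.ncard {e | X.tgt e = some (X.vert t)} +
        Set.ncard {e | X.src e = some (X.vert t)} = 3 := by
      rcases X.fibre t with h | h
      · exact h.2 _ (X.pt_vert t)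
      · exact absurd (h.2 _ (X.pt_vert t)) hval
    by_cases h₁ : Set.ncard {e | X.tgt e = some (X.vert t)} = 1
    · left
      obtain ⟨g, hg, h⟩ := exists_pair hout (by omega)
      refine ⟨g, hv, exists_single hin h₁, ⟨(h g).2 (Or.inr rfl), hg, ?_⟩, h⟩
      rintro rfl
      exact hv (Option.some.inj ((src_inv.2 (X.src_eOut t)).symm.trans ((h _).2 (Or.inr rfl))))
    · right; left
      have h₂ : Set.ncard {e | X.tgt e = some (X.vert t)} = 2 := by omega
      have h₃ : Set.ncard {e | X.src e = some (X.vert t)} = 1 := by omega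
      obtain ⟨g, hg, h⟩ := exists_pair hin h₂
      refine ⟨g, hv, exists_single hout h₃, ⟨(h g).2 (Or.inr rfl), hg, ?_⟩, h⟩
      rintro rfl
      exact hv (Option.some.inj ((tgt_inv.2 (X.tgt_eIn t)).symm.trans ((h _).2 (Or.inr rfl))))

theorem IsTwist.not_sideOut (h : X.IsTwist t) {f : X.E} : ¬ X.SideOut t f := by
  rintro ⟨h₁, h₂, h₃⟩
  rcases (h.src_iff f).1 h₁ with h | h
  · exact h₂ h
  · exact h₃ h

theorem IsTwist.not_sideIn (h : X.IsTwist t) {f : X.E} : ¬ X.SideIn t f := by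
  rintro ⟨h₁, h₂, h₃⟩
  rcases (h.tgt_iff f).1 h₁ with h | h
  · exact h₂ h
  · exact h₃ h

theorem SideOut.isCut {g : X.E} (h : X.SideOut t g) : X.IsCut t g := by
  rcases X.cut_or_join_or_twist t with ⟨g', h'⟩ | ⟨g', h'⟩ | h'
  · rcases (h'.src_iff g).1 h.1 with e | rfl
    · exact absurd e h.2.1
    · exact h'
  · exact absurd ((h'.src_iff g).1 h.1) h.2.1
  · exact absurd h h'.not_sideOut

theorem SideIn.isJoin {g : X.E} (h : X.SideIn t g) : X.IsJoin t g := by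
  rcases X.cut_or_join_or_twist t with ⟨g', h'⟩ | ⟨g', h'⟩ | h'
  · exact absurd ((h'.tgt_iff g).1 h.1) h.2.1
  · rcases (h'.tgt_iff g).1 h.1 with e | rfl
    · exact absurd e h.2.1
    · exact h'
  · exact absurd h h'.not_sideIn

theorem SideOut.unique {f g : X.E} (h : X.SideOut t f) (h' : X.SideOut t g) : f = g := by
  rcases (h'.isCut.src_iff f).1 h.1 with e | e
  · exact absurd e h.2.1
  · exact e

theorem SideIn.unique {f g : X.E} (h : X.SideIn t f) (h' : X.SideIn t g) : f = g := by
  rcases (h'.isJoin.tgt_iff f).1 h.1 with e | e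
  · exact absurd e h.2.1
  · exact e

theorem SideOut.not_sideIn {f g : X.E} (h : X.SideOut t f) : ¬ X.SideIn t g := fun h' =>
  h'.2.1 ((h.isCut.tgt_iff g).1 h'.1)

theorem IsTwist.of_not (h : ¬ ∃ g, X.SideOut t g) (h' : ¬ ∃ g, X.SideIn t g) : X.IsTwist t := by
  rcases X.cut_or_join_or_twist t with ⟨g', h₁⟩ | ⟨g', h₁⟩ | h₁
  · exact absurd ⟨g', h₁.side⟩ h
  · exact absurd ⟨g', h₁.side⟩ h'
  · exact h₁

variable (X) in
/-- `e` is the preferred one of the two edges named `a`. -/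
def Base (e : X.E) : Name n k → Prop
  | Sum.inl i => e = X.inEnd (i, true)
  | Sum.inr (t, true) => e = X.eOut t
  | Sum.inr (t, false) => X.SideOut t e

theorem Base.edge_unique {e e' : X.E} {a : Name n k} (h : X.Base e a) (h' : X.Base e' a) :
    e = e' := by
  rcases a with i | ⟨t, _ | _⟩
  · exact Eq.trans h (Eq.symm h')
  · exact SideOut.unique h h'
  · exact Eq.trans h (Eq.symm h')

theorem Base.src_inr {e : X.E} {t : Fin k} {b : Bool} (h : X.Base e (Sum.inr (t, b))) :
    X.src e = some (X.vert t) := by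
  cases b
  · exact h.1
  · obtain rfl : e = X.eOut t := h
    exact X.src_eOut t

theorem Base.src_inl {e : X.E} {i : Fin n.length} (h : X.Base e (Sum.inl i)) : X.src e = none :=
  (X.inEnd_range e).2 ⟨_, Eq.symm h⟩

theorem vert_injective : Function.Injective X.vert := fun s t h => by
  rw [← X.pt_vert s, h, X.pt_vert]

theorem Base.name_unique {e : X.E} {a a' : Name n k} (h : X.Base e a) (h' : X.Base e a') :
    a = a' := by
  rcases a with i | ⟨t, b⟩ <;> rcases a' with i' | ⟨t', b'⟩
  · have h₁ : X.inEnd (i, true) = X.inEnd (i', true) := (Eq.symm h).trans h'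
    exact congrArg Sum.inl (congrArg Prod.fst (X.inEnd_inj h₁))
  · have := h'.src_inr
    rw [h.src_inl] at this
    cases this
  · have := h.src_inr
    rw [h'.src_inl] at this
    cases this
  · obtain rfl := vert_injective (Option.some.inj (h.src_inr.symm.trans h'.src_inr))
    cases b <;> cases b'
    · rfl
    · exact absurd h' h.2.1
    · exact absurd h h'.2.1
    · rfl

/-- Of two mirror edges only one is preferred. Together with `exists_base` this makes the name and
the strand of an edge well defined. -/
theorem Base.not_inv {e : X.E} {a a' : Name n k} (h : X.Base e a) (h' : X.Base (X.inv.onE e) a') :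
    False := by
  rcases a with i | ⟨t, b⟩ <;> rcases a' with i' | ⟨t', b'⟩
  · obtain rfl : e = X.inEnd (i, true) := h
    have h₁ : X.inv.onE (X.inEnd (i, true)) = X.inEnd (i', true) := h'
    rw [X.inEnd_inv] at h₁
    have := congrArg Prod.snd (X.inEnd_inj h₁)
    simp at this
  · have h₁ := h'.src_inr
    rw [X.inv.src_eq, h.src_inl] at h₁
    cases h₁
  · have h₁ := h'.src_inl
    rw [X.inv.src_eq, h.src_inr] at h₁
    cases h₁
  · have h₁ : X.inv.onV (X.vert t) = X.vert t' :=
      Option.some.inj ((src_inv.2 h.src_inr).symm.trans h'.src_inr)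
    obtain rfl : t = t' := by
      rw [← X.pt_vert t, ← X.pt_vert t', ← h₁, pt_inv]
    cases b <;> cases b'
    · exact h.isCut.inv_ne h₁
    · exact h.isCut.inv_ne h₁
    · exact h'.isCut.inv_ne h₁
    · obtain rfl : e = X.eOut t := h
      exact X.fixed_E _ h'

theorem base_of_src {e : X.E} (h : X.src e = some (X.vert t)) :
    (∃ b, X.Base e (Sum.inr (t, b))) ∨ X.Base (X.inv.onE e) (Sum.inr (t, true)) := by
  by_cases h₁ : e = X.eOut t
  · exact Or.inl ⟨true, h₁⟩
  · by_cases h₂ : e = X.inv.onE (X.eOut t)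
    · right
      change X.inv.onE e = X.eOut t
      rw [h₂, X.inv_inv_E]
    · exact Or.inl ⟨false, h, h₁, h₂⟩

theorem exists_base (e : X.E) : ∃ a, X.Base e a ∨ X.Base (X.inv.onE e) a := by
  rcases hs : X.src e with _ | v
  · obtain ⟨⟨i, b⟩, rfl⟩ := (X.inEnd_range e).1 hs
    cases b
    · exact ⟨Sum.inl i, Or.inr (X.inEnd_inv i false)⟩
    · exact ⟨Sum.inl i, Or.inl rfl⟩
  · rcases eq_vert_or (X := X) (v := v) rfl with hv | hv
    · rw [hv] at hs
      rcases base_of_src hs with ⟨b, h⟩ | h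
      · exact ⟨_, Or.inl h⟩
      · exact ⟨_, Or.inr h⟩
    · rw [← X.inv_inv_E e, hv, src_inv] at hs
      rcases base_of_src hs with ⟨b, h⟩ | h
      · exact ⟨_, Or.inr h⟩
      · rw [X.inv_inv_E] at h
        exact ⟨_, Or.inl h⟩

variable (X) in
/-- `e` is the edge with the name and the strand `f`. -/
def Named (e : X.E) (f : Name n k × Bool) : Prop := X.Base (if f.2 then e else X.inv.onE e) f.1

theorem exists_named (e : X.E) : ∃ f, X.Named e f := by
  obtain ⟨a, h | h⟩ := exists_base e
  · exact ⟨(a, true), h⟩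
  · exact ⟨(a, false), h⟩

variable (X) in
/-- The name and the strand of an edge. -/
noncomputable def name (e : X.E) : Name n k × Bool := (exists_named e).choose

theorem named_name (e : X.E) : X.Named e (X.name e) := (exists_named e).choose_spec

theorem Named.unique {e : X.E} {f f' : Name n k × Bool} (h : X.Named e f) (h' : X.Named e f') :
    f = f' := by
  obtain ⟨a, b⟩ := f
  obtain ⟨a', b'⟩ := f'
  cases b <;> cases b'
  · exact Prod.ext (Base.name_unique h h') rfl
  · exact (Base.not_inv h' h).elim
  · exact (Base.not_inv h h').elim
  · exact Prod.ext (Base.name_unique h h') rfl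

theorem Named.name_eq {e : X.E} {f : Name n k × Bool} (h : X.Named e f) : X.name e = f :=
  (named_name e).unique h

theorem Base.name_eq {e : X.E} {a : Name n k} (h : X.Base e a) : X.name e = (a, true) :=
  Named.name_eq h

theorem name_inv (e : X.E) : X.name (X.inv.onE e) = ((X.name e).1, !(X.name e).2) := by
  refine Named.name_eq ?_
  have h := named_name e
  unfold Named at h ⊢
  cases hb : (X.name e).2
  · simpa [hb] using h
  · simpa [hb, X.inv_inv_E] using h

theorem name_injective : Function.Injective X.name := by
  intro e e' h
  have h₁ := named_name e
  have h₂ := named_name e'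
  rw [← h] at h₂
  have h₃ := Base.edge_unique h₁ h₂
  split_ifs at h₃
  · exact h₃
  · exact X.inv.onE.injective h₃

theorem eq_or_of_name_fst {e e' : X.E} (h : (X.name e).1 = (X.name e').1) :
    e' = e ∨ e' = X.inv.onE e := by
  by_cases hb : (X.name e).2 = (X.name e').2
  · exact Or.inl (name_injective (Prod.ext h.symm hb.symm))
  · refine Or.inr (name_injective ?_)
    rw [name_inv]
    refine Prod.ext h.symm ?_
    revert hb
    cases (X.name e).2 <;> cases (X.name e').2 <;> simp

end MonotoneCover
end Structure
end RefinedHurwitz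

/-! ### Reading a diagram off a cover -/

namespace RefinedHurwitz

section Structure

variable {d k : ℕ} {n m : Composition d} {x : Fin k → ℝ}

namespace MonotoneCover

variable {X : MonotoneCover x n m} {t : Fin k}

theorem cnt_sub_one_lt (X : MonotoneCover x n m) (t : Fin k) :
    X.cnt (X.eOut t) - 1 < n.blocksFun (X.chain t) := by
  have h₁ := (X.counter_bounds _ _ (X.arises_eOut t)).2
  have h₂ := cnt_pos (X.arises_eOut t)
  omega

open scoped Classical in
variable (X) in
/-- The combinatorial data of a monotone cover. -/
noncomputable def diagram : Diagram n m k where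
  -- The chain gives the block and the counter the position in it; positions are counted from 0
  -- here.
  q t := n.embedding (X.chain t) ⟨X.cnt (X.eOut t) - 1, X.cnt_sub_one_lt t⟩
  other t := if h : ∃ f, X.SideIn t f then some (X.name h.choose) else none
  ow f := if h : ∃ e, X.Base e (Sum.inr f) then X.wt h.choose else 0
  lab a := if h : ∃ f, (X.name (X.outEnd f)).1 = a then some h.choose.1 else none

theorem blk_diagram (t : Fin k) : X.diagram.blk t = X.chain t := n.index_embedding _ _

theorem ctr_diagram (t : Fin k) : X.diagram.ctr t = X.cnt (X.eOut t) := by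
  have h₁ := index_offset n (X.diagram.q t)
  have h₂ : n.index (X.diagram.q t) = X.chain t := blk_diagram t
  rw [h₂] at h₁
  have h₃ : ((X.diagram.q t : Fin d) : ℕ) = n.sizeUpTo (X.chain t) + (X.cnt (X.eOut t) - 1) :=
    n.coe_embedding _ _
  have h₄ := cnt_pos (X.arises_eOut t)
  unfold Diagram.ctr
  omega

theorem Base.wt_diagram {e : X.E} {a : Name n k} (h : X.Base e a) : X.diagram.wt a = X.wt e := by
  rcases a with i | f
  · obtain rfl : e = X.inEnd (i, true) := h
    exact (X.inEnd_wt i true).symm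
  · have hex : ∃ e, X.Base e (Sum.inr f) := ⟨e, h⟩
    classical
    change (if h : ∃ e, X.Base e (Sum.inr f) then X.wt h.choose else 0) = X.wt e
    rw [dif_pos hex, hex.choose_spec.edge_unique h]

theorem exists_base_of_wt {a : Name n k} (h : 0 < X.diagram.wt a) : ∃ e, X.Base e a := by
  rcases a with i | f
  · exact ⟨_, rfl⟩
  · by_contra hex
    classical
    change 0 < (if h : ∃ e, X.Base e (Sum.inr f) then X.wt h.choose else 0) at h
    rw [dif_neg hex] at h
    exact lt_irrefl _ h

theorem Base.wt_pos {e : X.E} {a : Name n k} (h : X.Base e a) : 0 < X.diagram.wt a := by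
  rw [h.wt_diagram]
  exact X.wt_pos e

theorem wt_name (e : X.E) : X.diagram.wt (X.name e).1 = X.wt e := by
  have h := named_name e
  rw [Base.wt_diagram h]
  split_ifs
  · rfl
  · exact wt_inv e

theorem SideIn.other_diagram {f : X.E} (h : X.SideIn t f) :
    X.diagram.other t = some (X.name f) := by
  have hex : ∃ f, X.SideIn t f := ⟨f, h⟩
  classical
  change (if h : ∃ f, X.SideIn t f then some (X.name h.choose) else none) = _
  rw [dif_pos hex, hex.choose_spec.unique h]

theorem exists_sideIn {f : Name n k × Bool} (h : X.diagram.other t = some f) :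
    ∃ e, X.SideIn t e ∧ X.name e = f := by
  classical
  change (if h : ∃ f, X.SideIn t f then some (X.name h.choose) else none) = _ at h
  split_ifs at h with hex
  exact ⟨_, hex.choose_spec, Option.some.inj h⟩

theorem ow_side_pos_iff : 0 < X.diagram.ow (t, false) ↔ ∃ g, X.SideOut t g :=
  ⟨fun h => exists_base_of_wt (a := Sum.inr (t, false)) h,
    fun ⟨_, h⟩ => Base.wt_pos (a := Sum.inr (t, false)) h⟩

theorem isTwist_diagram_iff : X.diagram.IsTwist t ↔ X.IsTwist t := by
  constructor
  · rintro ⟨h₁, h₂⟩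
    refine IsTwist.of_not (fun h => ?_) (fun ⟨g, h⟩ => ?_)
    · have := ow_side_pos_iff.2 h
      omega
    · rw [h.other_diagram] at h₂
      cases h₂
  · intro h
    refine ⟨?_, ?_⟩
    · by_contra h'
      obtain ⟨g, hg⟩ := ow_side_pos_iff.1 (Nat.pos_of_ne_zero h')
      exact h.not_sideOut hg
    · rcases ho : X.diagram.other t with _ | f
      · rfl
      · obtain ⟨g, hg, -⟩ := exists_sideIn ho
        exact absurd hg h.not_sideIn

theorem inv_vert_eq_iff : X.inv.onV (X.vert t) = X.vert t ↔ X.IsTwist t := by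
  constructor
  · intro h
    rcases X.cut_or_join_or_twist t with ⟨g, h'⟩ | ⟨g, h'⟩ | h'
    · exact absurd h h'.inv_ne
    · exact absurd h h'.inv_ne
    · exact h'
  · exact fun h => h.inv_eq

variable (hx : StrictMono x)
include hx

/-- Consecutive branch points on one chain are linked by a bold edge, and the first branch point of
a chain receives the in-end. This is exactly the rule that defines `head`. -/
theorem base_main (t : Fin k) : X.Base (X.eIn t) (X.diagram.main t) := by
  unfold Diagram.main
  by_cases h : ∃ s : Fin k, (s : ℕ) + 1 = t ∧ X.chain s = X.chain t
  · obtain ⟨s, hst, h⟩ := h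
    rw [← hst, head_succ, if_pos]
    · exact eIn_of_succ hst h
    · change X.diagram.blk s = X.diagram.blk t
      rw [blk_diagram, blk_diagram, h]
  · push Not at h
    rw [head_of_ne]
    · change X.eIn t = X.inEnd (X.diagram.blk t, true)
      rw [blk_diagram]
      exact eIn_of_first hx h
    · intro s hs
      change X.diagram.blk s ≠ X.diagram.blk t
      rw [blk_diagram, blk_diagram]
      exact h s hs

theorem exists_of_slot {a : Name n k} {b : Bool} (h : X.diagram.Slot t a b) :
    ∃ e, X.name e = (a, b) ∧ X.tgt e = some (X.vert t) := by
  rcases h with ⟨rfl, rfl⟩ | h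
  · exact ⟨X.eIn t, (base_main hx t).name_eq, X.tgt_eIn t⟩
  · obtain ⟨e, he, h'⟩ := exists_sideIn h
    exact ⟨e, h', he.1⟩

theorem slot_of_tgt {e : X.E} (h : X.tgt e = some (X.vert t)) :
    ∃ b, X.diagram.Slot t (X.name e).1 b ∧ ((X.name e).2 = b ∨ X.IsTwist t) := by
  by_cases h₁ : e = X.eIn t
  · subst h₁
    rw [(base_main hx t).name_eq]
    exact ⟨true, Or.inl ⟨rfl, rfl⟩, Or.inl rfl⟩
  · by_cases h₂ : e = X.inv.onE (X.eIn t)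
    · subst h₂
      rw [name_inv, (base_main hx t).name_eq]
      refine ⟨true, Or.inl ⟨rfl, rfl⟩, Or.inr (inv_vert_eq_iff.1 ?_)⟩
      exact Option.some.inj ((tgt_inv.2 (X.tgt_eIn t)).symm.trans h)
    · have h₃ : X.SideIn t e := ⟨h, h₁, h₂⟩
      exact ⟨_, Or.inr h₃.other_diagram, Or.inl rfl⟩

theorem slot_of_tgt_inv {e : X.E} (h : X.tgt e = some (X.inv.onV (X.vert t))) :
    ∃ b, X.diagram.Slot t (X.name e).1 b ∧ ((!(X.name e).2) = b ∨ X.IsTwist t) := by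
  rw [← X.inv_inv_E e, tgt_inv] at h
  have := slot_of_tgt hx h
  rwa [name_inv] at this

theorem EndsOver.uses {e : X.E} (h : X.EndsOver e t) : X.diagram.Uses t (X.name e).1 := by
  obtain ⟨v, h₁, h₂⟩ := h
  rcases eq_vert_or h₂ with rfl | rfl
  · obtain ⟨b, hb, -⟩ := slot_of_tgt hx h₁
    exact hb.uses
  · obtain ⟨b, hb, -⟩ := slot_of_tgt_inv hx h₁
    exact hb.uses

theorem endsOver_of_uses {e : X.E} (h : X.diagram.Uses t (X.name e).1) : X.EndsOver e t := by
  obtain ⟨b, hb⟩ := h.slot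
  obtain ⟨e', h₁, h₂⟩ := exists_of_slot hx hb
  have h₃ : X.EndsOver e' t := ⟨_, h₂, X.pt_vert t⟩
  rcases eq_or_of_name_fst (e := e') (e' := e) (by rw [h₁]) with rfl | rfl
  · exact h₃
  · exact h₃.inv

omit hx in
theorem exists_name_of_wt {a : Name n k} (h : 0 < X.diagram.wt a) (b : Bool) :
    ∃ e, X.name e = (a, b) := by
  obtain ⟨e, he⟩ := exists_base_of_wt h
  cases b
  · exact ⟨X.inv.onE e, by rw [name_inv, he.name_eq]; rfl⟩
  · exact ⟨e, he.name_eq⟩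

theorem tgt_eq_none_iff {e : X.E} : X.tgt e = none ↔ ∀ t, ¬ X.diagram.Uses t (X.name e).1 := by
  constructor
  · intro h t ht
    obtain ⟨v, hv, -⟩ := endsOver_of_uses hx ht
    rw [h] at hv
    cases hv
  · intro h
    rcases ht : X.tgt e with _ | v
    · rfl
    · exact absurd (EndsOver.uses hx ⟨v, ht, rfl⟩) (h _)

omit hx in
theorem base_src_pt {e : X.E} {v : X.V} (h : X.src e = some v) :
    ∃ b, (X.name e).1 = Sum.inr (X.pt v, b) := by
  rcases eq_vert_or (X := X) (v := v) rfl with hv | hv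
  · rw [hv] at h
    rcases base_of_src h with ⟨b, h'⟩ | h'
    · exact ⟨b, by rw [h'.name_eq]⟩
    · have h₂ := h'.name_eq
      rw [name_inv] at h₂
      exact ⟨true, (congrArg Prod.fst h₂ :)⟩
  · rw [← X.inv_inv_E e, hv, src_inv] at h
    rcases base_of_src h with ⟨b, h'⟩ | h'
    · have h₂ := h'.name_eq
      rw [name_inv] at h₂
      exact ⟨b, (congrArg Prod.fst h₂ :)⟩
    · rw [X.inv_inv_E] at h'
      exact ⟨true, by rw [h'.name_eq]⟩

theorem touches_of_adjacent {e : X.E} {v : X.V} (h : X.Adjacent e v) :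
    X.diagram.Touches (X.pt v) (X.name e).1 := by
  rcases h with h | h
  · obtain ⟨b, hb⟩ := base_src_pt h
    refine Or.inr ⟨⟨b, hb⟩, ?_⟩
    rw [wt_name]
    exact X.wt_pos e
  · exact Or.inl (EndsOver.uses hx ⟨v, h, rfl⟩)

omit hx in
theorem lab_diagram_iff {a : Name n k} {j : Fin m.length} :
    X.diagram.lab a = some j ↔ ∃ b, (X.name (X.outEnd (j, b))).1 = a := by
  have huniq : ∀ {f f'}, (X.name (X.outEnd f)).1 = (X.name (X.outEnd f')).1 → f.1 = f'.1 := by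
    rintro ⟨j, b⟩ ⟨j', b'⟩ h
    rcases eq_or_of_name_fst h with h | h
    · exact (congrArg Prod.fst (X.outEnd_inj h)).symm
    · rw [X.outEnd_inv] at h
      exact (congrArg Prod.fst (X.outEnd_inj h)).symm
  classical
  change (if h : ∃ f, (X.name (X.outEnd f)).1 = a then some h.choose.1 else none) = some j ↔ _
  constructor
  · intro h
    split_ifs at h with hex
    have h₁ := hex.choose_spec
    have h₂ := Option.some.inj h
    refine ⟨hex.choose.2, ?_⟩
    rw [← h₂]
    exact h₁
  · rintro ⟨b, h⟩
    have hex : ∃ f, (X.name (X.outEnd f)).1 = a := ⟨_, h⟩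
    rw [dif_pos hex]
    exact congrArg some (huniq (hex.choose_spec.trans h.symm))

/-- Between different chains this is `chain_mono`. Within a chain the bold edge into the next vertex
is the output of the previous one, and condition 5 compares the counters. -/
theorem mono_q : Monotone X.diagram.q := by
  have hstep : ∀ s t : Fin k, (s : ℕ) + 1 = t → X.diagram.q s ≤ X.diagram.q t := by
    intro s t hst
    have hc : X.diagram.blk s ≤ X.diagram.blk t := by
      rw [blk_diagram, blk_diagram]
      exact chain_mono hx (Fin.le_def.2 (by omega))
    rcases hc.lt_or_eq with h | h
    · exact ((index_mono n).reflect_lt h).le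
    · refine (le_iff_offset_le n h).2 (Nat.succ_le_succ_iff.1 ?_)
      change X.diagram.ctr s ≤ X.diagram.ctr t
      rw [ctr_diagram, ctr_diagram]
      rw [blk_diagram, blk_diagram] at h
      have := X.cnt_eIn_le t
      rwa [eIn_of_succ hst h] at this
  intro s t hst
  obtain ⟨N, hN⟩ := Nat.exists_eq_add_of_le (Fin.le_def.1 hst)
  induction N generalizing t with
  | zero => rw [show t = s from Fin.ext hN]
  | succ N ih =>
    have hk : (s : ℕ) + N < k := by omega
    exact (ih (t := ⟨s + N, hk⟩) (Fin.le_def.2 (by simp only; omega)) rfl).trans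
      (hstep _ _ (by simp only; omega))

theorem conserve_diagram (t : Fin k) : X.diagram.ow (t, true) + X.diagram.ow (t, false) =
    X.diagram.wt (X.diagram.main t) + (X.diagram.other t).elim 0 fun f => X.diagram.wt f.1 := by
  have hb := X.balanced (X.vert t)
  have h₁ : X.diagram.ow (t, true) = X.wt (X.eOut t) :=
    Base.wt_diagram (a := Sum.inr (t, true)) rfl
  rw [h₁, (base_main hx t).wt_diagram]
  rcases X.cut_or_join_or_twist t with ⟨g, h⟩ | ⟨g, h⟩ | h
  · have h₂ : X.diagram.ow (t, false) = X.wt g := Base.wt_diagram (a := Sum.inr (t, false)) h.side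
    have h₃ : X.diagram.other t = none := by
      rcases ho : X.diagram.other t with _ | f
      · rfl
      · obtain ⟨e, he, -⟩ := exists_sideIn ho
        exact absurd he h.side.not_sideIn
    simp only [h.tgt_iff, h.src_iff] at hb
    rw [finsum_cond_eq_left] at hb
    rw [h₂, h₃, hb]
    exact (finsum_mem_pair (f := X.wt) h.side.2.1.symm).symm
  · have h₂ : X.diagram.ow (t, false) = 0 := by
      by_contra h'
      obtain ⟨e, he⟩ := ow_side_pos_iff.1 (Nat.pos_of_ne_zero h')
      exact he.not_sideIn h.side
    simp only [h.tgt_iff, h.src_iff] at hb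
    rw [finsum_cond_eq_left] at hb
    rw [h₂, h.side.other_diagram, add_zero, ← hb, Option.elim_some, wt_name]
    exact finsum_mem_pair (f := X.wt) h.side.2.1.symm
  · obtain ⟨h₂, h₃⟩ := isTwist_diagram_iff.2 h
    rw [h₂, h₃]
    -- At a 4-valent vertex balancing would only give twice the claim; equality of the four weights
    -- gives it at once.
    refine X.four_wt (X.vert t) _ _ ((X.fixed_V _).1 h.inv_eq) (Or.inl (X.src_eOut t))
      (Or.inr (X.tgt_eIn t))

omit hx in
theorem connected_names {S : Set (Name n k)} (hx : StrictMono x)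
    (hS : ∀ t a a', X.diagram.Touches t a → X.diagram.Touches t a' → a ∈ S → a' ∈ S) (e e' : X.E) :
    (X.name e).1 ∈ S ↔ (X.name e').1 ∈ S := by
  induction X.connected e e' with
  | rel e e' h =>
    rcases h with rfl | ⟨v, h, h'⟩
    · rw [name_inv]
    · have h₁ := touches_of_adjacent hx h
      have h₂ := touches_of_adjacent hx h'
      exact ⟨hS _ _ _ h₁ h₂, hS _ _ _ h₂ h₁⟩
  | refl => rfl
  | symm _ _ _ ih => exact ih.symm
  | trans _ _ _ _ _ ih ih' => exact ih.trans ih'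

end MonotoneCover
end Structure
end RefinedHurwitz

open scoped ENNReal
namespace RefinedHurwitz

/-! ### Validity of the diagram, and reconstruction of the cover -/

section Structure

variable {d k : ℕ} {n m : Composition d} {x : Fin k → ℝ} {r : Fin m.length} {c : ℕ}

namespace MonotoneCover

variable {X : MonotoneCover x n m} {t : Fin k}

theorem name_inEnd (i : Fin n.length) (b : Bool) : X.name (X.inEnd (i, b)) = (Sum.inl i, b) := by
  have h : X.Base (X.inEnd (i, true)) (Sum.inl i) := rfl
  cases b
  · rw [show X.inEnd (i, false) = X.inv.onE (X.inEnd (i, true)) from (X.inEnd_inv i true).symm,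
      name_inv, h.name_eq]
    rfl
  · exact h.name_eq

theorem name_eOut (t : Fin k) : X.name (X.eOut t) = (Sum.inr (t, true), true) :=
  Base.name_eq (a := Sum.inr (t, true)) rfl

variable (hx : StrictMono x)
include hx

theorem other_live_diagram {a : Name n k} {b : Bool} (h : X.diagram.other t = some (a, b)) :
    X.diagram.Live t a ∧ a ≠ X.diagram.main t ∧ ∀ i, a = Sum.inl i → i ≤ X.diagram.blk t := by
  obtain ⟨e, he, hn⟩ := exists_sideIn h
  have hend : X.EndsOver e t := ⟨_, he.1, X.pt_vert t⟩
  obtain rfl : (X.name e).1 = a := congrArg Prod.fst hn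
  refine ⟨⟨?_, ?_, ?_⟩, ?_, ?_⟩
  · rw [wt_name]
    exact X.wt_pos e
  · rcases hs : X.src e with _ | u
    · obtain ⟨⟨i, b⟩, rfl⟩ := (X.inEnd_range e).1 hs
      rw [name_inEnd]
      trivial
    · obtain ⟨b', hb⟩ := base_src_pt hs
      rw [hb]
      have := X.src_lt_tgt _ _ _ hs he.1
      rw [X.pt_vert] at this
      exact this
  · intro s hst hu
    have := (endsOver_of_uses hx hu).unique hend
    exact absurd hst (by rw [this]; exact lt_irrefl _)
  · intro hm
    rw [show X.diagram.main t = (X.name (X.eIn t)).1 by rw [(base_main hx t).name_eq]] at hm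
    rcases eq_or_of_name_fst hm.symm with h' | h'
    · exact he.2.1 h'
    · exact he.2.2 h'
  · intro i hi
    rw [blk_diagram]
    have h₁ : X.name e = X.name (X.inEnd (i, (X.name e).2)) := by
      rw [name_inEnd]
      exact Prod.ext hi rfl
    have h₂ := name_injective h₁
    refine X.chain_label _ i (X.name e).2 (X.vert t) _
      ⟨_, X.arises_eIn t, X.col_eIn t, X.tgt_eIn t⟩ (Or.inl rfl) ?_
    rw [← h₂]
    exact he.1

theorem live_iff_lab {a : Name n k} : (X.diagram.lab a).isSome ↔ X.diagram.Live k a := by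
  rw [Option.isSome_iff_exists]
  constructor
  · rintro ⟨j, hj⟩
    obtain ⟨b, rfl⟩ := lab_diagram_iff.1 hj
    refine ⟨?_, ?_, ?_⟩
    · rw [wt_name]
      exact X.wt_pos _
    · rcases (X.name (X.outEnd (j, b))).1 with i | ⟨s, b⟩
      · trivial
      · exact s.2
    · exact fun s _ => (tgt_eq_none_iff hx).1 ((X.outEnd_range _).2 ⟨_, rfl⟩) s
  · rintro ⟨h₁, -, h₂⟩
    obtain ⟨e, he⟩ := exists_name_of_wt h₁ true
    have h₃ : X.tgt e = none := (tgt_eq_none_iff hx).2 fun s => by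
      rw [he]
      exact h₂ s s.2
    obtain ⟨⟨j, b⟩, rfl⟩ := (X.outEnd_range e).1 h₃
    exact ⟨j, lab_diagram_iff.2 ⟨b, by rw [he]⟩⟩

/-- The last branch point lies on the largest chain. The given dashed edge cannot precede the bold
edge ending there, since only bold edges precede others. Hence it begins after that bold edge, which
is possible only as the output of the last vertex. -/
theorem final_diagram (h : X.IsOfType r c) (ht : (t : ℕ) + 1 = k) :
    X.diagram.lab (Sum.inr (t, true)) = some r ∧ X.diagram.ctr t = c := by
  obtain ⟨i, h | ⟨h₁, h₂⟩, e, b, h₃, h₄, h₅, h₆⟩ := h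
  · have := t.2
    omega
  obtain ⟨s, -, hs⟩ := start_endsOver h₁
  have h₇ : X.chain t = i := le_antisymm (h₂ _ (hasChain_chain t))
    (hs ▸ chain_mono hx (Fin.le_def.2 (by have := s.2; omega)))
  obtain rfl : e = X.eOut t := by
    have h₈ := X.arises_eIn t
    rw [h₇] at h₈
    rcases comparable h₈ h₃ with h | ⟨h, -⟩ | ⟨-, s, hs, hs'⟩
    · rw [← h, X.col_eIn] at h₄
      cases h₄
    · rw [h] at h₄
      cases h₄
    · rw [hs.unique (X.endsOver_eIn t)] at hs'
      rcases hsrc : X.src e with _ | u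
      · simp [low, hsrc] at hs'
      · rw [low_of_src hsrc] at hs'
        refine eq_eOut (arises_ne h₃) hsrc (Fin.ext ?_)
        have := (X.pt u).2
        omega
  refine ⟨lab_diagram_iff.2 ⟨b, ?_⟩, by rw [ctr_diagram, h₆]⟩
  rw [← h₅, name_eOut]

theorem final_zero_diagram (h : X.IsOfType r c) (hk : k = 0) :
    c = 1 ∧ ∀ i, X.diagram.lab (Sum.inl i) = some r := by
  obtain ⟨i, -, e, b, h₁, -, h₂, h₃⟩ := h
  rcases Arises.cases h₁ with rfl | ⟨t, -, -⟩
  · refine ⟨h₃.symm.trans (X.in_counter i), fun j => ?_⟩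
    have h₄ := (connected_names (X := X) (S := {Sum.inl i}) hx
      (fun t => absurd t.2 (by omega)) (X.inEnd (i, true)) (X.inEnd (j, true))).1
      (by rw [name_inEnd]; rfl)
    rw [name_inEnd] at h₄
    have h₅ : (Sum.inl j : Name n k) = Sum.inl i := h₄
    rw [h₅]
    refine lab_diagram_iff.2 ⟨b, ?_⟩
    rw [← h₂, name_inEnd]
  · exact absurd t.2 (by omega)

theorem valid_diagram (h : X.IsOfType r c) : X.diagram.Valid r c where
  mono := mono_q hx
  other_live _ _ _ h := other_live_diagram hx h
  conserve := conserve_diagram hx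
  side t ht := by
    obtain ⟨g, hg⟩ := ow_side_pos_iff.1 ht
    rcases ho : X.diagram.other t with _ | f
    · rfl
    · obtain ⟨e, he, -⟩ := exists_sideIn ho
      exact absurd he hg.not_sideIn
  bound t := by
    have h₁ := (X.counter_bounds _ _ (X.arises_eOut t)).1
    have h₂ : X.diagram.ow (t, true) = X.wt (X.eOut t) :=
      Base.wt_diagram (a := Sum.inr (t, true)) rfl
    rw [blk_diagram, ctr_diagram, h₂]
    omega
  conn S hS a a' ha ha' haS := by
    obtain ⟨e, he⟩ := exists_name_of_wt ha true
    obtain ⟨e', he'⟩ := exists_name_of_wt ha' true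
    have := (connected_names hx hS e e').1 (by rw [he]; exact haS)
    rwa [he'] at this
  lab_some _ := live_iff_lab hx
  lab_inj a a' j ha ha' := by
    obtain ⟨b, rfl⟩ := lab_diagram_iff.1 ha
    obtain ⟨b', rfl⟩ := lab_diagram_iff.1 ha'
    cases b <;> cases b'
    · rfl
    · rw [← Bool.not_false, ← X.outEnd_inv, name_inv]
    · rw [← Bool.not_false, ← X.outEnd_inv, name_inv]
    · rfl
  lab_surj j := ⟨_, lab_diagram_iff.2 ⟨true, rfl⟩⟩
  lab_wt a j ha := by
    obtain ⟨b, rfl⟩ := lab_diagram_iff.1 ha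
    rw [wt_name, X.outEnd_wt]
  final t ht := final_diagram hx h ht
  final_zero hk := final_zero_diagram hx h hk

/-! ### A monotone cover is determined by its diagram -/

omit hx in
variable (X) in
noncomputable def toEdge (e : X.E) : X.diagram.Edge :=
  (⟨(X.name e).1, by rw [wt_name]; exact X.wt_pos e⟩, (X.name e).2)

omit hx in
theorem toEdge_bijective : Function.Bijective X.toEdge := by
  constructor
  · intro e e' h
    exact name_injective (Prod.ext (congrArg (fun f : X.diagram.Edge => f.1.1) h)
      (congrArg (fun f : X.diagram.Edge => f.2) h))
  · rintro ⟨⟨a, ha⟩, b⟩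
    obtain ⟨e, he⟩ := exists_name_of_wt ha b
    exact ⟨e, Prod.ext (Subtype.ext (congrArg Prod.fst he)) (congrArg (fun f : Name n k × Bool => f.2) he :)⟩

omit hx in
open scoped Classical in
variable (X) in
-- The flag tells the preferred vertex from its mirror image. Over a twist they coincide and `vtx`
-- ignores the flag.
noncomputable def toVert (v : X.V) : X.diagram.Vert :=
  X.diagram.vtx (X.pt v) (decide (v = X.vert (X.pt v)))

omit hx in
theorem toVert_vert (t : Fin k) : X.toVert (X.vert t) = X.diagram.vtx t true := by
  unfold toVert
  rw [X.pt_vert]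
  simp

omit hx in
theorem toVert_inv_vert (t : Fin k) :
    X.toVert (X.inv.onV (X.vert t)) = X.diagram.vtx t false := by
  unfold toVert
  rw [pt_inv, X.pt_vert, Diagram.vtx_eq_iff]
  refine ⟨rfl, ?_⟩
  rw [isTwist_diagram_iff, ← inv_vert_eq_iff]
  by_cases h : X.inv.onV (X.vert t) = X.vert t <;> simp [h]

omit hx in
theorem toVert_bijective : Function.Bijective X.toVert := by
  constructor
  · intro v v' h
    have h₁ : X.pt v = X.pt v' := (Diagram.vtx_eq_iff.1 h).1
    rcases eq_vert_or (X := X) (v := v) rfl with hv | hv <;>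
    rcases eq_vert_or (X := X) (v := v') rfl with hv' | hv' <;>
    rw [hv, hv'] at h <;> rw [hv, hv', h₁] <;>
    simp only [toVert_vert, toVert_inv_vert, Diagram.vtx_eq_iff, isTwist_diagram_iff,
      ← inv_vert_eq_iff] at h
    · rcases h.2 with h | h
      · cases h
      · rw [h]
    · rcases h.2 with h | h
      · cases h
      · rw [h]
  · intro w
    induction w using Diagram.Vert.cases with
    | h t b =>
    cases b
    · exact ⟨_, toVert_inv_vert t⟩
    · exact ⟨_, toVert_vert t⟩

omit hx in
theorem snd_of_src {e : X.E} (h : X.src e = some (X.vert t)) :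
    (X.name e).2 = true ∨ X.IsTwist t := by
  rcases base_of_src h with ⟨b, h'⟩ | h'
  · exact Or.inl (by rw [h'.name_eq])
  · refine Or.inr (inv_vert_eq_iff.1 ?_)
    exact Option.some.inj ((src_inv.2 h).symm.trans h'.src_inr)

omit hx in
theorem src_toEdge (e : X.E) : X.diagram.src (X.toEdge e) = (X.src e).map X.toVert := by
  rcases hs : X.src e with _ | v
  · obtain ⟨⟨i, b⟩, rfl⟩ := (X.inEnd_range e).1 hs
    exact Diagram.src_eq_none.2 ⟨i, congrArg Prod.fst (name_inEnd i b)⟩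
  · rw [Option.map_some]
    rcases eq_vert_or (X := X) (v := v) rfl with hv | hv <;> rw [hv] at hs ⊢
    · obtain ⟨b, hb⟩ := base_src_pt hs
      rw [X.pt_vert] at hb
      rw [toVert_vert]
      refine Diagram.src_eq_some.2 ⟨⟨b, hb⟩, ?_⟩
      rw [isTwist_diagram_iff]
      exact snd_of_src hs
    · obtain ⟨b, hb⟩ := base_src_pt hs
      rw [pt_inv, X.pt_vert] at hb
      rw [toVert_inv_vert]
      refine Diagram.src_eq_some.2 ⟨⟨b, hb⟩, ?_⟩
      rw [isTwist_diagram_iff]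
      rw [← X.inv_inv_E e, src_inv] at hs
      have := snd_of_src hs
      rwa [name_inv, Bool.not_eq_true'] at this

theorem tgt_toEdge (hD : X.diagram.Valid r c) (e : X.E) :
    X.diagram.tgt (X.toEdge e) = (X.tgt e).map X.toVert := by
  rcases ht : X.tgt e with _ | v
  · exact Diagram.tgt_eq_none.2 ((tgt_eq_none_iff hx).1 ht)
  · rw [Option.map_some]
    rcases eq_vert_or (X := X) (v := v) rfl with hv | hv <;> rw [hv] at ht ⊢
    · rw [toVert_vert]
      obtain ⟨b, h₁, h₂⟩ := slot_of_tgt hx ht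
      refine hD.tgt_eq_some.2 ⟨b, h₁, ?_⟩
      rw [isTwist_diagram_iff]
      exact h₂.imp_left fun h => by rw [h, beq_self_eq_true]
    · rw [toVert_inv_vert]
      obtain ⟨b, h₁, h₂⟩ := slot_of_tgt_inv hx ht
      refine hD.tgt_eq_some.2 ⟨b, h₁, ?_⟩
      rw [isTwist_diagram_iff]
      exact h₂.imp_left fun h => by rw [← h]; cases (X.name e).2 <;> rfl

omit hx in
theorem toVert_inv (v : X.V) : X.toVert (X.inv.onV v) = X.diagram.flip (X.toVert v) := by
  rcases eq_vert_or (X := X) (v := v) rfl with hv | hv <;> rw [hv]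
  · rw [toVert_inv_vert, toVert_vert, Diagram.flip_vtx]
    rfl
  · rw [X.inv_inv_V, toVert_inv_vert, toVert_vert, Diagram.flip_vtx]
    rfl

omit hx in
theorem toEdge_inv (e : X.E) : X.toEdge (X.inv.onE e) = X.diagram.flipEdge (X.toEdge e) := by
  refine Prod.ext (Subtype.ext ?_) ?_
  · change (X.name _).1 = (X.name _).1
    rw [name_inv]
  · change (X.name _).2 = !(X.name _).2
    rw [name_inv]

omit hx in
theorem colour_ext {a b : Colour} (h : a ≠ Colour.normal ↔ b ≠ Colour.normal)
    (h' : a = Colour.bold ↔ b = Colour.bold) : a = b := by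
  cases a <;> cases b <;> simp_all

theorem col_toEdge (e : X.E) : X.diagram.col (X.toEdge e) = X.col e := by
  refine colour_ext ?_ ?_
  · rw [Diagram.col_ne_normal]
    change (X.name e).2 = true ∧ Diagram.IsSpine (X.name e).1 ↔ _
    constructor
    · rintro ⟨h₁, h₂⟩
      have h₃ := named_name e
      unfold Named at h₃
      rw [if_pos h₁] at h₃
      rcases h₄ : (X.name e).1 with i | ⟨t, b⟩ <;> rw [h₄] at h₂ h₃
      · obtain rfl : e = X.inEnd (i, true) := h₃
        exact X.in_not_normal i
      · obtain rfl : b = true := h₂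
        obtain rfl : e = X.eOut t := h₃
        exact X.col_eOut t
    · intro h
      obtain ⟨i, hi, -⟩ := X.unique_chain e h
      rcases Arises.cases hi with rfl | ⟨t, -, rfl⟩
      · rw [name_inEnd]
        exact ⟨rfl, trivial⟩
      · rw [name_eOut]
        exact ⟨rfl, rfl⟩
  · rw [Diagram.col_eq_bold]
    change (X.name e).2 = true ∧ (∃ t, (X.name e).1 = _) ↔ _
    constructor
    · rintro ⟨h₁, t, h₂⟩
      have h₃ : X.name e = X.name (X.eIn t) := by
        rw [(base_main hx t).name_eq]
        exact Prod.ext h₂ h₁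
      rw [name_injective h₃]
      exact X.col_eIn t
    · intro h
      obtain ⟨v, hv⟩ := Option.ne_none_iff_exists'.1 (X.bold_tgt _ h)
      rw [eq_eIn (t := X.pt v) ⟨v, hv, rfl⟩ h, (base_main hx _).name_eq]
      exact ⟨rfl, _, rfl⟩

omit hx in
theorem cnt_toEdge (e : X.E) (h : X.col e ≠ Colour.normal) : X.diagram.cnt (X.toEdge e) = X.cnt e := by
  obtain ⟨i, hi, -⟩ := X.unique_chain e h
  change Sum.elim (fun _ => 1) (fun s => X.diagram.ctr s.1) (X.name e).1 = _
  rcases Arises.cases hi with rfl | ⟨t, -, rfl⟩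
  · rw [name_inEnd, X.in_counter]
    rfl
  · rw [name_eOut]
    exact ctr_diagram t

omit hx in
-- Ends are infinitely long, and the length of any other edge is the distance of its branch points
-- divided by its weight. So isomorphisms need no separate check of lengths.
theorem len_eq_of {C C' : TropicalCover x} {e : C.E} {e' : C'.E} {f : C.V → C'.V}
    (hpt : ∀ v, C'.pt (f v) = C.pt v) (hs : C'.src e' = (C.src e).map f)
    (ht : C'.tgt e' = (C.tgt e).map f) (hw : C'.wt e' = C.wt e) : C'.len e' = C.len e := by
  rcases h : C.src e with _ | u
  · rw [h] at hs
    rw [(C.len_end e).2 (Or.inl h), (C'.len_end e').2 (Or.inl hs)]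
  · rcases h' : C.tgt e with _ | v
    · rw [h'] at ht
      rw [(C.len_end e).2 (Or.inr h'), (C'.len_end e').2 (Or.inr ht)]
    · rw [h] at hs
      rw [h'] at ht
      have h₁ := C.len_inner e u v h h'
      have h₂ := C'.len_inner e' (f u) (f v) hs ht
      rw [hpt, hpt, ← h₁, hw] at h₂
      exact (ENNReal.mul_right_inj (by exact_mod_cast (C.wt_pos e).ne') (ENNReal.natCast_ne_top _)).1 h₂

theorem nonempty_iso_cover (hD : X.diagram.Valid r c) : Nonempty (Iso X (hD.cover hx)) :=
  ⟨{
    onV := Equiv.ofBijective X.toVert toVert_bijective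
    onE := Equiv.ofBijective X.toEdge toEdge_bijective
    pt_eq := fun _ => rfl
    src_eq := src_toEdge
    tgt_eq := tgt_toEdge hx hD
    wt_eq := wt_name
    len_eq := fun e => len_eq_of (C := X.toTropicalCover) (C' := (hD.cover hx).toTropicalCover)
      (f := X.toVert) (fun _ => rfl) (src_toEdge e) (tgt_toEdge hx hD e) (wt_name e)
    inv_V := toVert_inv
    inv_E := toEdge_inv
    inEnd_eq := fun i b => Prod.ext (Subtype.ext (congrArg Prod.fst (name_inEnd i b)))
      (congrArg (fun f : Name n k × Bool => f.2) (name_inEnd i b) :)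
    outEnd_eq := fun j b => ⟨(X.name (X.outEnd (j, b))).2,
      Prod.ext (hD.outName_eq (lab_diagram_iff.2 ⟨b, rfl⟩)).symm rfl⟩
    col_eq := col_toEdge hx
    cnt_eq := cnt_toEdge }⟩

end MonotoneCover

/-- Monotone covers up to isomorphism correspond to diagrams. -/
noncomputable def coverClassOf (hx : StrictMono x) (D : {D : Diagram n m k // D.Valid r c}) :
    CoverClass x n m r c :=
  Quotient.mk (coverSetoid x n m r c) ⟨D.2.cover hx, D.2.isOfType hx⟩

theorem coverClassOf_bijective (hx : StrictMono x) :
    Function.Bijective (coverClassOf (n := n) (m := m) (r := r) (c := c) hx) := by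
  constructor
  · intro D D' h
    obtain ⟨F⟩ := Quotient.exact h
    exact Subtype.ext (Diagram.Valid.eq_of_iso hx D.2 D'.2 F)
  · intro C
    induction C using Quotient.inductionOn with
    | h X =>
    obtain ⟨F⟩ := MonotoneCover.nonempty_iso_cover hx (MonotoneCover.valid_diagram hx X.2)
    exact ⟨⟨_, MonotoneCover.valid_diagram hx X.2⟩, Quotient.sound ⟨F.symm⟩⟩

end Structure
end RefinedHurwitz

theorem theorem6 {d : ℕ} (hd : 0 < d) (n m : Composition d)
    (g : ℚ) (hg : ∃ t : ℕ, g = (t : ℚ) / 2) (r : Fin m.length)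
    (a : ℕ) (ha : 1 ≤ a) (ha' : a ≤ RefinedHurwitz.lastPart n)
    (x : Fin (RefinedHurwitz.numSteps g n m) → ℝ) (hx : StrictMono x) :
    Finite (RefinedHurwitz.CoverClass x n m r a) ∧
      RefinedHurwitz.refinedN g n m r a =
        RefinedHurwitz.prefactor n m *
          ∑ᶠ c : RefinedHurwitz.CoverClass x n m r a, c.mult := by
  refine ⟨Finite.of_surjective _ (RefinedHurwitz.coverClassOf_bijective hx).2, ?_⟩
  rw [RefinedHurwitz.refinedN, RefinedHurwitz.sum_factWeight hd ha]
  congr 1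
  exact finsum_eq_of_bijective _ (RefinedHurwitz.coverClassOf_bijective hx)
    fun D => (D.2.mult_cover hx).symm
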